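/- **Conventions.** Let $n\ge 1$. $\omega_{\mathrm{std}}$ is the Fubini–Study form on $\mathbb{CP}^{n-1}$, normalized by $\int_{\mathbb{CP}^1}\omega_{\mathrm{std}}=1$. For a linear map $T:V\to W$ of finite-dimensional real vector spaces and a skew bilinear form $\omega$ on $W$, a complex structure $J$ on $V$ is $(\omega,T)$-*tame* if $T^*\omega(v,Jv)>0$ for $v\notin\ker T$, and $(\omega,T)$-*compatible* if moreover $T^*\omega$ is $J$-invariant; *$\omega$-tame* is the case $T=\mathrm{id}$. For a map $f$, $(\omega,f)$-tame/compatible means $(\omega,df_x)$-tame/compatible at every $x$. Complex structures on oriented bundles, in particular almost-complex structures on oriented manifolds, are required to induce the given orientation, and are only required to be continuous. If $J$ is $(\omega,f)$-tame, $f_*J$ denotes the complex structure induced on the fibers of $\operatorname{Im} df$, so that $f_*J\circ df=df\circ J$. A critical point $x$ of $f$ is *wrapped* if $\operatorname{span}P_x$ has real codimension at most $2$ in $\ker df_x$, where $P$ is the closure in the tangent bundle of the union of the kernels of $df$ at the regular points of $f$, and $P_x$ is its part over $x$. **Hyperpencils.** A *hyperpencil* on a smooth closed oriented $2n$-manifold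 $X$ is a finite subset $B\subset X$ and a smooth map $f:X-B\to\mathbb{CP}^{n-1}$ such that (1) each $b\in B$ is mapped to $0$ by an orientation-preserving local chart to $\mathbb C^n$ in which $f$ is projectivization $\mathbb C^n-\{0\}\to\mathbb{CP}^{n-1}$ (a *standard chart* at $b$); (2) each critical point of $f$ is wrapped and has a neighborhood in $X-B$ with a continuous $(\omega_{\mathrm{std}},f)$-compatible almost-complex structure; (3) each $F_y=\operatorname{cl}f^{-1}(y)\subset X$ contains only finitely many critical points of $f$, and each component of $F_y-\{\text{critical points}\}$ intersects $B$. Let $\omega$ be a continuous 2-form on $X$. A *taming cover* is a cover of $X$ by open sets $W_\alpha$ with continuous $\omega$-tame almost-complex structures $J_\alpha$ on $W_\alpha$ such that $J_\alpha|_{W_\alpha-B}$ is $(\omega_{\mathrm{std}},f)$-compatible and the structures $f_*J_\alpha$ agree on overlaps (off $B$). The hyperpencil $f$ is *$\omega$-tame* if a taming cover exists. **Families.** A *family of hyperpencils* over a topological space $S$ consists of fiber bundles $X\to S$ (fiber a smooth closed oriented $2n$-manifold, structure group its orientation-preserving diffeomorphisms in the $C^\infty$-topology) and $Y\to S$ (fiber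 $\mathbb{CP}^{n-1}$, structure group $\mathrm{PU}(n)$, so that the fibers of $Y$ carry $\omega_{\mathrm{std}}$ and the standard complex structure), a subset $B\subset X$ with $B\to S$ a finite covering map, and a continuous, fiberwise smooth map $f:X-B\to Y$ over $\mathrm{id}_S$ such that: (1) some neighborhood $V$ of $B$ has a lift $\tilde\pi:V\to B$ of $V\to S$ with the structure of a $\mathrm U(n)$-vector bundle with zero section $B$ (its local trivializations being fiberwise smooth on the fibers of $X\to S$, with continuous vertical derivative, and its fibers oriented compatibly with those of $X\to S$), and $f$ is projectivization on each fiber of $\tilde\pi$ (i.e. in unitary coordinates on that fiber and on the corresponding fiber of $Y$ it is $z\mapsto[z]$ up to $\mathrm{PU}(n)$); (2) the vertical derivative $df:T^v(X-B)\to f^*T^vY$ is continuous, and each critical point of $df$ has a neighborhood in $X-B$ over which $T^vX$ has an $(\omega_{\mathrm{std}},df)$-compatible complex vector bundle structure; (3) on each fiber $X_s$, every critical point of $f|_{X_s-B}$ is wrapped in $X_s$, and (3) above holds. For a continuous family $\omega$ of 2-forms on the fibers $X_s$, taming covers and $\omega$-tameness are defined as above, with open $W_\alpha\subset X$ and complex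 vector bundle structures $J_\alpha$ on $T^vX|_{W_\alpha}$. **Lemma.** (a) Let $f$ be a hyperpencil on $X$ and $\omega$ a continuous 2-form on $X$. Then $f$ is $\omega$-tame if and only if there is a global continuous $\omega$-tame almost-complex structure $J$ on $X$ with $J|_{X-B}$ $(\omega_{\mathrm{std}},f)$-compatible. Moreover, given any taming cover $\{(W_\alpha,J_\alpha)\}$ and any choice of a standard chart at each $b\in B$, such a $J$ can be chosen so that near each $b\in B$ it is the complex structure induced by the given chart and so that, if the structures $f_*J_\alpha$ agree near $B$ with the standard complex structure of $\mathbb{CP}^{n-1}$, then $f_*J=f_*J_\alpha$ on $W_\alpha-B$ for all $\alpha$. (b) Let $f:X-B\to Y$ be a family of hyperpencils parametrized by a metrizable space $S$ and $\omega$ a continuous family of 2-forms on the fibers of $X\to S$. Then the family is $\omega$-tame if and only if there is a global $\omega$-tame complex vector bundle structure $J$ on $T^vX$ whose restriction to $X-B$ is $(\omega_{\mathrm{std}},df)$-compatible. Moreover, given any taming cover $\{(W_\alpha,J_\alpha)\}$, such a $J$ can be chosen to agree on a neighborhood of $B$ with the fiberwise complex structure determined by the vector bundle $\tilde\pi:V\to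 B$ and so that, if the structures $f_*J_\alpha$ agree near $B$ with the standard complex structure of the fibers of $Y$, then $f_*J=f_*J_\alpha$ on $W_\alpha-B$ for all $\alpha$. -/

import Mathlib

open Set Topology Bundle
open scoped LinearAlgebra.Projectivization Manifold ContDiff

noncomputable section

namespace Hyperpencils

/-! ## Linear algebra -/

/-- `ℂᵏ` with its Hermitian norm. Regarded as a real normed space, it is the model of manifolds of
real dimension `2k`. -/
abbrev Cn (k : ℕ) : Type := EuclideanSpace ℂ (Fin k)

/-- `J` is `(Ω, T)`-tame: `(T^*Ω)(v, Jv) > 0` for all `v ∉ ker T`. -/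
def IsTame {V W : Type*} [AddCommGroup V] [Module ℝ V] [TopologicalSpace V]
    [AddCommGroup W] [Module ℝ W] [TopologicalSpace W]
    (Ω : W → W → ℝ) (T : V →L[ℝ] W) (J : V →L[ℝ] V) : Prop :=
  ∀ v, T v ≠ 0 → 0 < Ω (T v) (T (J v))

/-- `J` is `(Ω, T)`-compatible: it is `(Ω, T)`-tame and `T^*Ω` is `J`-invariant. -/
def IsCompatible {V W : Type*} [AddCommGroup V] [Module ℝ V] [TopologicalSpace V]
    [AddCommGroup W] [Module ℝ W] [TopologicalSpace W]
    (Ω : W → W → ℝ) (T : V →L[ℝ] W) (J : V →L[ℝ] V) : Prop :=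
  IsTame Ω T J ∧ ∀ v w, Ω (T (J v)) (T (J w)) = Ω (T v) (T w)

/-- `J` is a linear complex structure inducing the standard orientation of `ℂⁿ`, i.e. there is an
orientation-preserving complex isomorphism from `(ℂⁿ, J)` onto the standard `ℂⁿ`. -/
def IsPosComplexStructure {n : ℕ} (J : Cn n →L[ℝ] Cn n) : Prop :=
  (∀ v, J (J v) = -v) ∧
    ∃ A : Cn n ≃L[ℝ] Cn n, 0 < (A : Cn n →L[ℝ] Cn n).det ∧ ∀ v, A (J v) = Complex.I • A v

/-- The unitary group. -/
abbrev UnitaryGp (k : ℕ) := unitary (Cn k →L[ℂ] Cn k)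

/-- The action of a unitary transformation on `ℂᵏ`. -/
def unitaryAct {k : ℕ} (g : UnitaryGp k) (z : Cn k) : Cn k := (g : Cn k →L[ℂ] Cn k) z

theorem unitaryAct_injective {k : ℕ} (g : UnitaryGp k) :
    Function.Injective (g : Cn k →L[ℂ] Cn k) := by
  intro z z' h
  have h1 : star (g : Cn k →L[ℂ] Cn k) * (g : Cn k →L[ℂ] Cn k) = 1 :=
    Unitary.star_mul_self_of_mem g.2
  have h2 : ∀ v, star (g : Cn k →L[ℂ] Cn k) ((g : Cn k →L[ℂ] Cn k) v) = v := fun v =>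
    congrArg (fun L : Cn k →L[ℂ] Cn k => L v) h1
  rw [← h2 z, ← h2 z', h]

/-- The projective unitary group, with the quotient topology. -/
abbrev PUnitaryGp (k : ℕ) := UnitaryGp k ⧸ Subgroup.center (UnitaryGp k)

/-! ## Complex projective space -/

/-- Complex projective space of complex dimension `m`. -/
abbrev CP (m : ℕ) : Type := ℙ ℂ (Cn (m + 1))

namespace CP

variable {m : ℕ}

/-- The quotient topology. -/
instance : TopologicalSpace (CP m) :=
  inferInstanceAs (TopologicalSpace (Quotient (projectivizationSetoid ℂ (Cn (m + 1)))))

/-- The vector of `ℂᵐ⁺¹` with `i`-th coordinate `1` and remaining coordinates `w`. -/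
def lift (i : Fin (m + 1)) (w : Cn m) : Cn (m + 1) :=
  WithLp.toLp 2 (i.insertNth (α := fun _ => ℂ) 1 w)

@[simp] theorem lift_same (i : Fin (m + 1)) (w : Cn m) : lift i w i = 1 := by simp [lift]

@[simp] theorem lift_succAbove (i : Fin (m + 1)) (w : Cn m) (k : Fin m) :
    lift i w (i.succAbove k) = w k := by simp [lift]

theorem lift_ne_zero (i : Fin (m + 1)) (w : Cn m) : lift i w ≠ 0 := fun h => by
  have := congrArg (fun v : Cn (m + 1) => v i) h
  simp at this

theorem contDiff_lift_apply (i j : Fin (m + 1)) : ContDiff ℝ ∞ (fun w : Cn m => lift i w j) := by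
  refine Fin.succAboveCases i ?_ (fun k => ?_) j
  · simpa using contDiff_const
  · simp only [lift_succAbove]; fun_prop

/-- Affine coordinates `[z] ↦ (z_j / z_i)_{j ≠ i}`. -/
def affineFun (i : Fin (m + 1)) : CP m → Cn m :=
  Projectivization.lift (fun z => WithLp.toLp 2 fun k => (z : Cn (m + 1)) (i.succAbove k) /
    (z : Cn (m + 1)) i) (by
      rintro ⟨a, ha⟩ ⟨b, hb⟩ t (rfl : a = t • b)
      have ht : t ≠ 0 := by rintro rfl; simp at ha
      ext k
      simp [mul_div_mul_left _ _ ht])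

/-- The set of `[z]` with `z_i ≠ 0`. -/
def affineSource (i : Fin (m + 1)) : Set (CP m) := {p | p.rep i ≠ 0}

@[simp] theorem mk_mem_affineSource (i : Fin (m + 1)) (v : Cn (m + 1)) (hv : v ≠ 0) :
    Projectivization.mk ℂ v hv ∈ affineSource i ↔ v i ≠ 0 := by
  obtain ⟨a, ha⟩ := Projectivization.exists_smul_eq_mk_rep ℂ v hv
  simp [affineSource, ← ha, Units.smul_def]

theorem affineFun_mk (i : Fin (m + 1)) (v : Cn (m + 1)) (hv : v ≠ 0) (k : Fin m) :
    affineFun i (Projectivization.mk ℂ v hv) k = v (i.succAbove k) / v i := rfl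

theorem isQuotientMap_mk' :
    IsQuotientMap (Projectivization.mk' ℂ : {v : Cn (m + 1) // v ≠ 0} → CP m) :=
  isQuotientMap_quotient_mk'

theorem isOpen_affineSource (i : Fin (m + 1)) : IsOpen (affineSource i : Set (CP m)) := by
  rw [← isQuotientMap_mk'.isOpen_preimage]
  have : (Projectivization.mk' ℂ) ⁻¹' (affineSource i : Set (CP m)) =
      {v : {v : Cn (m + 1) // v ≠ 0} | (v : Cn (m + 1)) i ≠ 0} := by
    ext v; simp
  rw [this]
  exact isOpen_ne_fun (by fun_prop) (by fun_prop)

/-- The affine chart on `{z_i ≠ 0}`. -/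
def affineChart (i : Fin (m + 1)) : OpenPartialHomeomorph (CP m) (Cn m) where
  toFun := affineFun i
  invFun w := Projectivization.mk ℂ (lift i w) (lift_ne_zero i w)
  source := affineSource i
  target := univ
  map_source' _ _ := mem_univ _
  map_target' w _ := by simp
  left_inv' p hp := by
    induction p using Projectivization.ind with
    | h v hv =>
      rw [mk_mem_affineSource] at hp
      rw [Projectivization.mk_eq_mk_iff']
      refine ⟨(v i)⁻¹, ?_⟩
      ext j
      refine Fin.succAboveCases i ?_ (fun k => ?_) j
      · simp [hp]
      · simp [affineFun_mk, div_eq_inv_mul]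
  right_inv' w _ := by
    ext k
    simp [affineFun_mk]
  open_source := isOpen_affineSource i
  open_target := isOpen_univ
  continuousOn_toFun := by
    rw [isQuotientMap_mk'.continuousOn_isOpen_iff (isOpen_affineSource i)]
    have h : ContinuousOn (fun v : {v : Cn (m + 1) // v ≠ 0} => (WithLp.toLp 2 fun k =>
        (v : Cn (m + 1)) (i.succAbove k) / (v : Cn (m + 1)) i : Cn m))
        ((Projectivization.mk' ℂ) ⁻¹' (affineSource i : Set (CP m))) := by
      refine (PiLp.continuous_toLp 2 _).comp_continuousOn (continuousOn_pi.2 fun k => ?_)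
      refine ContinuousOn.div (by fun_prop) (by fun_prop) fun v hv => ?_
      simpa using hv
    exact h
  continuousOn_invFun := by
    have h : Continuous (fun w : Cn m => (⟨lift i w, lift_ne_zero i w⟩ : {v : Cn (m + 1) // v ≠ 0})) := by
      refine Continuous.subtype_mk ?_ _
      refine (PiLp.continuous_toLp 2 _).comp (continuous_pi fun j => ?_)
      exact (contDiff_lift_apply i j).continuous
    exact (isQuotientMap_mk'.continuous.comp h).continuousOn

/-- An index of a nonzero homogeneous coordinate. -/
theorem exists_mem_affineSource (p : CP m) : ∃ i, p ∈ affineSource i := by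
  by_contra! h
  refine p.rep_nonzero ?_
  ext i
  simpa [affineSource] using h i

instance : ChartedSpace (Cn m) (CP m) where
  atlas := range affineChart
  chartAt p := affineChart (exists_mem_affineSource p).choose
  mem_chart_source p := (exists_mem_affineSource p).choose_spec
  chart_mem_atlas _ := mem_range_self _

instance : IsManifold 𝓘(ℝ, Cn m) ∞ (CP m) := by
  refine isManifold_of_contDiffOn _ _ _ ?_
  rintro _ _ ⟨i, rfl⟩ ⟨j, rfl⟩
  have h : ContDiffOn ℝ ∞ (fun w : Cn m => (WithLp.toLp 2 fun k =>
      lift i w (j.succAbove k) / lift i w j : Cn m)) {w | lift i w j ≠ 0} := by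
    rw [contDiffOn_piLp]
    intro k
    simp only [div_eq_mul_inv]
    exact (contDiff_lift_apply i _).contDiffOn.mul ((contDiff_lift_apply i j).contDiffOn.inv
      fun w (hw : lift i w j ≠ 0) => hw)
  refine h.mono fun w hw => ?_
  have := hw.1.2
  exact (mk_mem_affineSource j (lift i w) (lift_ne_zero i w)).1 this

/-- The action of the unitary group on `CPᵐ`. -/
def act (g : UnitaryGp (m + 1)) (p : CP m) : CP m :=
  Projectivization.map ((g : Cn (m + 1) →L[ℂ] Cn (m + 1)) : Cn (m + 1) →ₗ[ℂ] Cn (m + 1))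
    (unitaryAct_injective g) p

/-- The Fubini-Study form in an affine chart at the point with coordinates `w`:
`(i / 2π) ∂∂̄ log (1 + |w|²)`. -/
def affineFubiniStudy (w : Cn m) : Cn m →ₗ[ℝ] Cn m →ₗ[ℝ] ℝ :=
  LinearMap.mk₂ ℝ
    (fun u v => Real.pi⁻¹ * ((inner ℂ u v).im / (1 + ‖w‖ ^ 2) -
      (inner ℂ u w * inner ℂ w v).im / (1 + ‖w‖ ^ 2) ^ 2))
    (fun u u' v => by simp only [inner_add_left, add_mul, Complex.add_im]; ring)
    (fun c u v => by
      have h : ∀ x : Cn m, inner ℂ (c • u) x = (c : ℂ) * inner ℂ u x := fun x => by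
        rw [RCLike.real_smul_eq_coe_smul (K := ℂ), inner_smul_left]; simp
      simp only [h, mul_assoc, Complex.im_ofReal_mul, smul_eq_mul]; ring)
    (fun u v v' => by simp only [inner_add_right, mul_add, Complex.add_im]; ring)
    (fun c u v => by
      have h : ∀ x : Cn m, inner ℂ x (c • v) = (c : ℂ) * inner ℂ x v := fun x => by
        rw [RCLike.real_smul_eq_coe_smul (K := ℂ), inner_smul_right]; simp
      simp only [h, mul_left_comm _ (c : ℂ), Complex.im_ofReal_mul, smul_eq_mul]; ring)

/-- The standard symplectic form on `CPᵐ` (Fubini-Study), of integral `1` on a projective line. -/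
def omegaStd (p : CP m) :
    TangentSpace 𝓘(ℝ, Cn m) p →ₗ[ℝ] TangentSpace 𝓘(ℝ, Cn m) p →ₗ[ℝ] ℝ :=
  affineFubiniStudy (chartAt (Cn m) p p)

end CP

/-! ## Oriented manifolds -/

/-- `X` is an oriented `2n`-manifold: the transition maps of the given atlas preserve the standard
orientation of `ℂⁿ`. Each tangent space is then oriented by any chart of the atlas. -/
class IsOrientedManifold (n : ℕ) (X : Type*) [TopologicalSpace X] [ChartedSpace (Cn n) X] :
    Prop where
  det_pos : ∀ e ∈ atlas (Cn n) X, ∀ e' ∈ atlas (Cn n) X, ∀ z ∈ (e.symm ≫ₕ e').source,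
    0 < (fderiv ℝ (e.symm ≫ₕ e') z).det

section Manifold

variable (n k : ℕ) {X : Type*} [TopologicalSpace X] [ChartedSpace (Cn n) X]
  {N : Type*} [TopologicalSpace N] [ChartedSpace (Cn k) N]

/-- The derivative of a map between manifolds of real dimensions `2n` and `2k`. -/
abbrev D (f : X → N) (x : X) : TangentSpace 𝓘(ℝ, Cn n) x →L[ℝ] TangentSpace 𝓘(ℝ, Cn k) (f x) :=
  mfderiv 𝓘(ℝ, Cn n) 𝓘(ℝ, Cn k) f x

/-- `φ`, a map between oriented manifolds of equal dimension, is an orientation-preserving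
local diffeomorphism at `x` (to first order). Here tangent spaces are identified with `ℂⁿ` through
charts of the oriented atlases. -/
def IsOrientationPreservingAt {M : Type*} [TopologicalSpace M] [ChartedSpace (Cn n) M]
    (φ : X → M) (x : X) : Prop :=
  0 < (D n n φ x : Cn n →L[ℝ] Cn n).det

variable (X) in
/-- Fields of endomorphisms of the tangent spaces. -/
abbrev EndField := ∀ x : X, TangentSpace 𝓘(ℝ, Cn n) x →L[ℝ] TangentSpace 𝓘(ℝ, Cn n) x

variable (X) in
/-- Fields of bilinear forms on the tangent spaces. -/
abbrev BilinField := ∀ x : X, TangentSpace 𝓘(ℝ, Cn n) x →L[ℝ] TangentSpace 𝓘(ℝ, Cn n) x →L[ℝ] ℝ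

variable {n} in
/-- `J` restricts to a continuous almost-complex structure on `W`, inducing the orientation. -/
structure IsACSOn [IsManifold 𝓘(ℝ, Cn n) ∞ X] (J : EndField n X) (W : Set X) : Prop where
  complex : ∀ x ∈ W, IsPosComplexStructure (n := n) (J x)
  continuousOn : ContinuousOn (fun x => (TotalSpace.mk' (Cn n →L[ℝ] Cn n) x (J x) :
    TotalSpace (Cn n →L[ℝ] Cn n)
      (fun x : X => TangentSpace 𝓘(ℝ, Cn n) x →L[ℝ] TangentSpace 𝓘(ℝ, Cn n) x))) W

variable {n} in
/-- `Ω` is a continuous 2-form. -/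
structure IsContinuousTwoForm [IsManifold 𝓘(ℝ, Cn n) ∞ X] (Ω : BilinField n X) : Prop where
  alternating : ∀ x v, Ω x v v = 0
  continuous : Continuous (fun x => (TotalSpace.mk' (Cn n →L[ℝ] Cn n →L[ℝ] ℝ) x (Ω x) :
    TotalSpace (Cn n →L[ℝ] Cn n →L[ℝ] ℝ)
      (fun x : X => TangentSpace 𝓘(ℝ, Cn n) x →L[ℝ] TangentSpace 𝓘(ℝ, Cn n) x →L[ℝ] ℝ)))

/-! ## Critical points and fibers

Maps `X - B → N` are represented by total maps whose values on `B` are irrelevant. -/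

/-- `x` is a critical point of `f`. -/
def IsCritical (f : X → N) (x : X) : Prop := ¬ Function.Surjective (D n k f x)

/-- The closure `P` in the tangent bundle of the union of `ker df_x` over the regular points `x` of
`f : X - B → N`. -/
def regularKernelClosure [IsManifold 𝓘(ℝ, Cn n) ∞ X] (B : Set X) (f : X → N) :
    Set (TangentBundle 𝓘(ℝ, Cn n) X) :=
  closure {v | v.proj ∉ B ∧ ¬ IsCritical n k f v.proj ∧ D n k f v.proj v.2 = 0}

/-- The span of `P_x` has real codimension at most 2 in `ker df_x`. -/
def IsWrapped [IsManifold 𝓘(ℝ, Cn n) ∞ X] (B : Set X) (f : X → N) (x : X) : Prop :=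
  Module.finrank ℝ (LinearMap.ker (D n k f x).toLinearMap) ≤
    Module.finrank ℝ (Submodule.span ℝ {v : TangentSpace 𝓘(ℝ, Cn n) x |
      (⟨x, v⟩ : TangentBundle 𝓘(ℝ, Cn n) X) ∈ regularKernelClosure n k B f}) + 2

/-- The critical points of `f : X - B → N` on the fiber over `y`. -/
def fiberCrit (B : Set X) (f : X → N) (y : N) : Set X := {x | x ∉ B ∧ f x = y ∧ IsCritical n k f x}

/-- Each fiber `F_y = cl f⁻¹(y)` contains finitely many critical points, and each component of the
complement of these in `F_y` meets `B`. -/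
def FiberCondition (B : Set X) (f : X → N) : Prop :=
  ∀ y, (fiberCrit n k B f y).Finite ∧
    ∀ x ∈ closure {x | x ∉ B ∧ f x = y} \ fiberCrit n k B f y,
      (connectedComponentIn (closure {x | x ∉ B ∧ f x = y} \ fiberCrit n k B f y) x ∩ B).Nonempty

variable {n} in
/-- Multiplication by `i` in the chart defining `TangentSpace`. -/
def mulI {x : X} (v : TangentSpace 𝓘(ℝ, Cn n) x) : TangentSpace 𝓘(ℝ, Cn n) x :=
  show Cn n from Complex.I • (show Cn n from v)

end Manifold

/-! ## Hyperpencils -/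

section Hyperpencil

variable {m : ℕ} {X : Type*} [TopologicalSpace X] [ChartedSpace (Cn (m + 1)) X]
  [IsManifold 𝓘(ℝ, Cn (m + 1)) ∞ X]

/-- `φ` is an orientation-preserving chart of `X` mapping `b` to `0` in which `f` is
projectivization `ℂᵐ⁺¹ - {0} → CPᵐ`. -/
structure IsStandardChart (B : Set X) (f : X → CP m) (b : X)
    (φ : OpenPartialHomeomorph X (Cn (m + 1))) : Prop where
  mem_atlas : φ ∈ IsManifold.maximalAtlas 𝓘(ℝ, Cn (m + 1)) ∞ X
  mem_source : b ∈ φ.source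
  map_base : φ b = 0
  oriented : ∀ x ∈ φ.source, IsOrientationPreservingAt (m + 1) φ x
  eq_mk : ∀ x ∈ φ.source, x ≠ b → x ∉ B ∧ ∃ h : φ x ≠ 0, f x = Projectivization.mk ℂ (φ x) h

/-- `f : X - B → CPᵐ` is a hyperpencil on the `2(m + 1)`-manifold `X` with base locus `B`. -/
structure IsHyperpencil (B : Set X) (f : X → CP m) : Prop where
  finite : B.Finite
  smooth : ContMDiffOn 𝓘(ℝ, Cn (m + 1)) 𝓘(ℝ, Cn m) ∞ f Bᶜ
  chart : ∀ b ∈ B, ∃ φ, IsStandardChart B f b φ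
  wrapped : ∀ x ∉ B, IsCritical (m + 1) m f x → IsWrapped (m + 1) m B f x
  local_acs : ∀ x ∉ B, IsCritical (m + 1) m f x → ∃ W, IsOpen W ∧ x ∈ W ∧ W ⊆ Bᶜ ∧
    ∃ J : EndField (m + 1) X, IsACSOn J W ∧
      ∀ y ∈ W, IsCompatible (fun a b => CP.omegaStd (f y) a b) (D (m + 1) m f y) (J y)
  fiber : FiberCondition (m + 1) m B f

/-- `J` restricts to a continuous `Ω`-tame almost-complex structure on `W` which is
`(ω_std, f)`-compatible on `W - B`. -/
structure IsTamingACSOn (Ω : BilinField (m + 1) X) (B : Set X) (f : X → CP m)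
    (J : EndField (m + 1) X) (W : Set X) : Prop where
  acs : IsACSOn J W
  tame : ∀ x ∈ W, IsTame (fun a b => Ω x a b) (ContinuousLinearMap.id ℝ _) (J x)
  compatible : ∀ x ∈ W \ B, IsCompatible (fun a b => CP.omegaStd (f x) a b) (D (m + 1) m f x) (J x)

/-- The structures `f_*J` and `f_*J'` on `Im df_x` agree. (If `J` is `(ω_std, f)`-compatible, then
`f_*J` is determined by `f_*J (df v) = df (J v)`.) -/
def PushEq (f : X → CP m) (J J' : EndField (m + 1) X) (x : X) : Prop :=
  ∀ v, D (m + 1) m f x (J x v) = D (m + 1) m f x (J' x v)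

/-- `𝒲` is a set of pairs `(W, J)` as in the definition of an `Ω`-tame hyperpencil. -/
structure IsTamingCover (Ω : BilinField (m + 1) X) (B : Set X) (f : X → CP m)
    (𝒲 : Set (Set X × EndField (m + 1) X)) : Prop where
  isOpen : ∀ P ∈ 𝒲, IsOpen P.1
  cover : ∀ x, ∃ P ∈ 𝒲, x ∈ P.1
  taming : ∀ P ∈ 𝒲, IsTamingACSOn Ω B f P.2 P.1
  agree : ∀ P ∈ 𝒲, ∀ Q ∈ 𝒲, ∀ x ∈ (P.1 ∩ Q.1) \ B, PushEq f P.2 Q.2 x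

/-- The hyperpencil `f` is `Ω`-tame. -/
def IsOmegaTame (Ω : BilinField (m + 1) X) (B : Set X) (f : X → CP m) : Prop :=
  ∃ 𝒲, IsTamingCover Ω B f 𝒲

/-- The structures `f_*J`, for `(W, J) ∈ 𝒲`, agree near `B` with the standard complex structure
of `CPᵐ` (on tangent spaces of `CPᵐ`, which are identified with `ℂᵐ` through holomorphic charts, it
is multiplication by `i`). -/
def PushStandardNear (B : Set X) (f : X → CP m) (𝒲 : Set (Set X × EndField (m + 1) X)) : Prop :=
  ∀ᶠ x in 𝓝ˢ B, x ∉ B → ∀ P ∈ 𝒲, x ∈ P.1 → ∀ v,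
    D (m + 1) m f x (P.2 x v) = mulI (D (m + 1) m f x v)

/-- `J_x` is the complex structure induced by the chart `φ`. -/
def IsChartStructureAt (φ : X → Cn (m + 1)) (J : EndField (m + 1) X) (x : X) : Prop :=
  ∀ v, D (m + 1) (m + 1) φ x (J x v) = mulI (D (m + 1) (m + 1) φ x v)

end Hyperpencil

/-! ## Bundles of manifolds -/

section Bundles

variable {S : Type*} [TopologicalSpace S] (k : ℕ)
  {F : Type*} [TopologicalSpace F] [ChartedSpace (Cn k) F]
  {X : S → Type*} [TopologicalSpace (TotalSpace F X)]
  [∀ s, TopologicalSpace (X s)] [∀ s, ChartedSpace (Cn k) (X s)]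

/-- The restriction to the fiber over `s` of a trivialization. -/
def fiberTriv (e : Trivialization F (π F X)) (s : S) (p : X s) : F := (e ⟨s, p⟩).2

/-- The coordinates of the vertical direction given by a trivialization and a chart of `F`. -/
def vertCoord (e : Trivialization F (π F X)) (c : F) (x : TotalSpace F X) : Cn k :=
  chartAt (Cn k) c (e x).2

/-- The domain of the vertical coordinates `vertCoord e c`. -/
def vertDom (e : Trivialization F (π F X)) (c : F) : Set (TotalSpace F X) :=
  {x | x.proj ∈ e.baseSet ∧ (e x).2 ∈ (chartAt (Cn k) c).source}

/-- The trivialization of the vertical tangent bundle given by vertical coordinates. -/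
def vertDeriv (e : Trivialization F (π F X)) (c : F) (x : TotalSpace F X) :
    TangentSpace 𝓘(ℝ, Cn k) x.2 →L[ℝ] Cn k :=
  mfderiv 𝓘(ℝ, Cn k) 𝓘(ℝ, Cn k) (fun p : X x.1 => vertCoord k e c ⟨x.1, p⟩) x.2

/-- The vertical tangent vector at `x` with given components in vertical coordinates. -/
def vertVec (e : Trivialization F (π F X)) (c : F) (x : TotalSpace F X) :
    Cn k →L[ℝ] TangentSpace 𝓘(ℝ, Cn k) x.2 :=
  (vertDeriv k e c x).inverse

/-- The change of trivialization `(s, y) ↦ τ_s(y)`. -/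
def transition (e e' : Trivialization F (π F X)) (s : S) (y : F) : F :=
  (e' (e.toOpenPartialHomeomorph.symm (s, y))).2

variable (F X) in
/-- `X → S` is a bundle of oriented manifolds with fiber `F` and structure group
the orientation-preserving diffeomorphisms of `F` with the `C^∞`-topology. (For compact `F`, a map
`s ↦ τ_s` to that group is continuous if and only if all derivatives of `τ_s` in charts are
continuous jointly in `s` and the point of `F`.) -/
structure IsOrientedManifoldBundle [FiberBundle F X] : Prop where
  fiber : ∀ e ∈ FiberBundle.trivializationAtlas F X, ∀ s ∈ e.baseSet,
    (∃ Φ : X s ≃ₘ⟮𝓘(ℝ, Cn k), 𝓘(ℝ, Cn k)⟯ F, ⇑Φ = fiberTriv e s) ∧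
      ∀ p, IsOrientationPreservingAt k (fiberTriv e s) p
  transition : ∀ e ∈ FiberBundle.trivializationAtlas F X,
    ∀ e' ∈ FiberBundle.trivializationAtlas F X, ∀ (c c' : F) (r : ℕ),
      ContinuousOn (fun q : S × Cn k => iteratedFDeriv ℝ r (fun z =>
          chartAt (Cn k) c' (transition e e' q.1 ((chartAt (Cn k) c).symm z))) q.2)
        {q | q.1 ∈ e.baseSet ∩ e'.baseSet ∧ q.2 ∈ (chartAt (Cn k) c).target ∧
          transition e e' q.1 ((chartAt (Cn k) c).symm q.2) ∈ (chartAt (Cn k) c').source}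

/-- Fields of endomorphisms of the vertical tangent spaces. -/
abbrev VEndField (k : ℕ) (F : Type*) {S : Type*} (X : S → Type*) [∀ s, TopologicalSpace (X s)]
    [∀ s, ChartedSpace (Cn k) (X s)] :=
  ∀ x : TotalSpace F X, TangentSpace 𝓘(ℝ, Cn k) x.2 →L[ℝ] TangentSpace 𝓘(ℝ, Cn k) x.2

/-- Fields of bilinear forms on the vertical tangent spaces. -/
abbrev VBilinField (k : ℕ) (F : Type*) {S : Type*} (X : S → Type*) [∀ s, TopologicalSpace (X s)]
    [∀ s, ChartedSpace (Cn k) (X s)] :=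
  ∀ x : TotalSpace F X, TangentSpace 𝓘(ℝ, Cn k) x.2 →L[ℝ] TangentSpace 𝓘(ℝ, Cn k) x.2 →L[ℝ] ℝ

/-- `J` restricts to a complex vector bundle structure on the (oriented) vertical tangent bundle
over `W`. Continuity is expressed through matrix entries in vertical coordinates. -/
structure IsVertACSOn [FiberBundle F X] (J : VEndField k F X) (W : Set (TotalSpace F X)) :
    Prop where
  complex : ∀ x ∈ W, IsPosComplexStructure (n := k) (J x)
  continuousOn : ∀ e ∈ FiberBundle.trivializationAtlas F X, ∀ (c : F) (u : Cn k),
    ContinuousOn (fun x => vertDeriv k e c x (J x (vertVec k e c x u))) (W ∩ vertDom k e c)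

/-- `Ω` is a continuous family of 2-forms on the fibers. -/
structure IsContinuousVertTwoForm [FiberBundle F X] (Ω : VBilinField k F X) : Prop where
  alternating : ∀ x v, Ω x v v = 0
  continuousOn : ∀ e ∈ FiberBundle.trivializationAtlas F X, ∀ (c : F) (u v : Cn k),
    ContinuousOn (fun x => Ω x (vertVec k e c x u) (vertVec k e c x v)) (vertDom k e c)

end Bundles

section ProjectiveBundles

variable {S : Type*} [TopologicalSpace S] {m : ℕ}
  {Y : S → Type*} [TopologicalSpace (TotalSpace (CP m) Y)]
  [∀ s, TopologicalSpace (Y s)] [∀ s, ChartedSpace (Cn m) (Y s)] [FiberBundle (CP m) Y]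

variable (m Y) in
/-- `Y → S` is a bundle with fiber `CPᵐ` and structure group `PU(m + 1)`. -/
structure IsProjectiveBundle : Prop where
  fiber : ∀ e ∈ FiberBundle.trivializationAtlas (CP m) Y, ∀ s ∈ e.baseSet,
    ∃ Φ : Y s ≃ₘ⟮𝓘(ℝ, Cn m), 𝓘(ℝ, Cn m)⟯ CP m, ⇑Φ = fiberTriv e s
  transition : ∀ e ∈ FiberBundle.trivializationAtlas (CP m) Y,
    ∀ e' ∈ FiberBundle.trivializationAtlas (CP m) Y, ∃ g : S → UnitaryGp (m + 1),
      ContinuousOn (fun s => (g s : PUnitaryGp (m + 1))) (e.baseSet ∩ e'.baseSet) ∧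
      ∀ s ∈ e.baseSet ∩ e'.baseSet, ∀ y, transition e e' s y = CP.act (g s) y

/-- The identification of a tangent space of a fiber of `Y` with one of `CPᵐ`, given by a
trivialization. It is well defined up to `PU(m + 1)`. -/
def tangentTriv (y : TotalSpace (CP m) Y) :
    TangentSpace 𝓘(ℝ, Cn m) y.2 →L[ℝ]
      TangentSpace 𝓘(ℝ, Cn m) (fiberTriv (trivializationAt (CP m) Y y.1) y.1 y.2) :=
  D m m (fiberTriv (trivializationAt (CP m) Y y.1) y.1) y.2

/-- The standard symplectic form on the fibers of `Y`. -/
def vertOmegaStd (y : TotalSpace (CP m) Y) (a b : TangentSpace 𝓘(ℝ, Cn m) y.2) : ℝ :=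
  CP.omegaStd (fiberTriv (trivializationAt (CP m) Y y.1) y.1 y.2) (tangentTriv y a) (tangentTriv y b)

end ProjectiveBundles

/-! ## Families of hyperpencils -/

section Families

variable {S : Type*} [TopologicalSpace S] {m : ℕ}
  {M : Type*} [TopologicalSpace M] [ChartedSpace (Cn (m + 1)) M]
  {X : S → Type*} [TopologicalSpace (TotalSpace M X)]
  [∀ s, TopologicalSpace (X s)] [∀ s, ChartedSpace (Cn (m + 1)) (X s)] [FiberBundle M X]
  {Y : S → Type*} [TopologicalSpace (TotalSpace (CP m) Y)]
  [∀ s, TopologicalSpace (Y s)] [∀ s, ChartedSpace (Cn m) (Y s)] [FiberBundle (CP m) Y]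

/-- The part of `A` in the fiber over `s`. -/
def onFiber (A : Set (TotalSpace M X)) (s : S) : Set (X s) := {p | (⟨s, p⟩ : TotalSpace M X) ∈ A}

/-- The map of total spaces given by a family of maps `f_s : X_s → Y_s`. -/
def totalMap (f : ∀ s, X s → Y s) (x : TotalSpace M X) : TotalSpace (CP m) Y := ⟨x.1, f x.1 x.2⟩

open Classical in
/-- The `ℂᵏ`-component of a local trivialization of a bundle `ρ : V → B`, extended by zero
outside `V`. -/
def nbhdCoord {B V : Set (TotalSpace M X)} {ρ : V → B} (Ψ : Trivialization (Cn (m + 1)) ρ)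
    (x : TotalSpace M X) : Cn (m + 1) :=
  if h : x ∈ V then (Ψ ⟨x, h⟩).2 else 0

/-- The restriction of `nbhdCoord` to a fiber of `X → S`. -/
def nbhdCoordOn {B V : Set (TotalSpace M X)} {ρ : V → B} (Ψ : Trivialization (Cn (m + 1)) ρ)
    (s : S) (p : X s) : Cn (m + 1) :=
  nbhdCoord Ψ ⟨s, p⟩

variable (m M X) in
/-- A neighborhood `V` of `B` together with a lift `V → B` of the projection to `S` and a structure
of `U(m + 1)`-vector bundle on it, with zero section `B` and with fibers oriented compatibly with
those of `X → S`. The linear coordinates on the fibers are smooth coordinates of the fibers of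
`X → S`, with vertical derivative continuous. -/
structure UnitaryNbhd (B : Set (TotalSpace M X)) where
  /-- The neighborhood. -/
  V : Set (TotalSpace M X)
  isOpen : IsOpen V
  subset : B ⊆ V
  /-- The projection. -/
  ρ : V → B
  lifts : ∀ x : V, (ρ x).1.proj = x.1.proj
  /-- The local unitary trivializations. -/
  triv : Set (Trivialization (Cn (m + 1)) ρ)
  exists_mem : ∀ b : B, ∃ Ψ ∈ triv, b ∈ Ψ.baseSet
  unitary : ∀ Ψ ∈ triv, ∀ Ψ' ∈ triv, ∃ g : B → UnitaryGp (m + 1),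
    ContinuousOn g (Ψ.baseSet ∩ Ψ'.baseSet) ∧
    ∀ b ∈ Ψ.baseSet ∩ Ψ'.baseSet, ∀ z,
      Ψ' (Ψ.toOpenPartialHomeomorph.symm (b, z)) = (b, unitaryAct (g b) z)
  proj_base : ∀ b : B, ρ ⟨b.1, subset b.2⟩ = b
  zero : ∀ Ψ ∈ triv, ∀ b ∈ Ψ.baseSet, Ψ ⟨b.1, subset b.2⟩ = (b, 0)
  smooth : ∀ Ψ ∈ triv, ∀ x : V, ρ x ∈ Ψ.baseSet →
    ContMDiffAt 𝓘(ℝ, Cn (m + 1)) 𝓘(ℝ, Cn (m + 1)) ∞ (nbhdCoordOn Ψ x.1.1) x.1.2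
  oriented : ∀ Ψ ∈ triv, ∀ x : V, ρ x ∈ Ψ.baseSet →
    IsOrientationPreservingAt (m + 1) (nbhdCoordOn Ψ x.1.1) x.1.2
  deriv_continuousOn : ∀ Ψ ∈ triv, ∀ e ∈ FiberBundle.trivializationAtlas M X,
    ∀ (c : M) (u : Cn (m + 1)),
      ContinuousOn (fun x : TotalSpace M X =>
          (D (m + 1) (m + 1) (nbhdCoordOn Ψ x.1) x.2 (vertVec (m + 1) e c x u) : Cn (m + 1)))
        ({x | ∃ h : x ∈ V, ρ ⟨x, h⟩ ∈ Ψ.baseSet} ∩ vertDom (m + 1) e c)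

/-- The vertical derivative `df` of a family of maps at `x`. -/
abbrev VD (f : ∀ s, X s → Y s) (x : TotalSpace M X) :
    TangentSpace 𝓘(ℝ, Cn (m + 1)) x.2 →L[ℝ] TangentSpace 𝓘(ℝ, Cn m) (totalMap (m := m) f x).2 :=
  D (m + 1) m (f x.1) x.2

variable (m M X Y) in
/-- A family of hyperpencils `f : X - B → Y` parametrized by `S`, on given bundles
`X → S` and `Y → S`, together with the vector bundle structure near `B`. (The values of `f` on
`B` are irrelevant.) -/
structure HyperpencilFamily [∀ s, IsManifold 𝓘(ℝ, Cn (m + 1)) ∞ (X s)] where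
  /-- The base locus. -/
  B : Set (TotalSpace M X)
  /-- The map. -/
  f : ∀ s, X s → Y s
  /-- The vector bundle structure near the base locus. -/
  nbhd : UnitaryNbhd m M X B
  covering : IsCoveringMap (fun b : B => b.1.proj)
  finite : ∀ s, (onFiber B s).Finite
  continuousOn : ContinuousOn (totalMap (m := m) f) Bᶜ
  smooth : ∀ s, ContMDiffOn 𝓘(ℝ, Cn (m + 1)) 𝓘(ℝ, Cn m) ∞ (f s) (onFiber B s)ᶜ
  /-- On each fiber of `V → B`, the map `f` is projectivization: in unitary coordinates on this
  fiber and on the corresponding fiber of `Y`, it is `z ↦ [z]` up to the action of `PU(m + 1)`. -/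
  eq_mk : ∀ Ψ ∈ nbhd.triv, ∀ e ∈ FiberBundle.trivializationAtlas (CP m) Y,
    ∀ b ∈ Ψ.baseSet, b.1.proj ∈ e.baseSet → ∃ g : UnitaryGp (m + 1),
      ∀ (z : Cn (m + 1)) (hz : z ≠ 0),
        (e (totalMap (m := m) f (Ψ.toOpenPartialHomeomorph.symm (b, z)).1)).2 =
          CP.act g (Projectivization.mk ℂ z hz)
  deriv_continuousOn : ∀ e ∈ FiberBundle.trivializationAtlas M X,
    ∀ e' ∈ FiberBundle.trivializationAtlas (CP m) Y, ∀ (c : M) (c' : CP m) (u : Cn (m + 1)),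
      ContinuousOn (fun x => vertDeriv m e' c' (totalMap (m := m) f x) (VD f x (vertVec (m + 1) e c x u)))
        (Bᶜ ∩ vertDom (m + 1) e c ∩ totalMap (m := m) f ⁻¹' vertDom m e' c')
  local_acs : ∀ x ∉ B, IsCritical (m + 1) m (f x.1) x.2 → ∃ W, IsOpen W ∧ x ∈ W ∧ W ⊆ Bᶜ ∧
    ∃ J : VEndField (m + 1) M X, IsVertACSOn (m + 1) J W ∧
      ∀ y ∈ W, IsCompatible (vertOmegaStd (totalMap (m := m) f y)) (VD f y) (J y)
  wrapped : ∀ s, ∀ p ∉ onFiber B s, IsCritical (m + 1) m (f s) p → IsWrapped (m + 1) m (onFiber B s) (f s) p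
  fiber : ∀ s, FiberCondition (m + 1) m (onFiber B s) (f s)

namespace HyperpencilFamily

variable [∀ s, IsManifold 𝓘(ℝ, Cn (m + 1)) ∞ (X s)] (H : HyperpencilFamily m M X Y)

/-- `J` restricts to an `Ω`-tame complex vector bundle structure on the vertical tangent bundle
over `W`, which is `(ω_std, f)`-compatible on `W - B`. -/
structure IsTamingACSOn (Ω : VBilinField (m + 1) M X) (J : VEndField (m + 1) M X)
    (W : Set (TotalSpace M X)) : Prop where
  acs : IsVertACSOn (m + 1) J W
  tame : ∀ x ∈ W, IsTame (fun a b => Ω x a b) (ContinuousLinearMap.id ℝ _) (J x)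
  compatible : ∀ x ∈ W \ H.B, IsCompatible (vertOmegaStd (totalMap (m := m) H.f x)) (VD H.f x) (J x)

/-- The structures `f_*J` and `f_*J'` on `Im df_x` agree. -/
def PushEq (J J' : VEndField (m + 1) M X) (x : TotalSpace M X) : Prop :=
  ∀ v, VD H.f x (J x v) = VD H.f x (J' x v)

/-- `𝒲` is a set of pairs `(W, J)` as in the definition of an `Ω`-tame family. -/
structure IsTamingCover (Ω : VBilinField (m + 1) M X)
    (𝒲 : Set (Set (TotalSpace M X) × VEndField (m + 1) M X)) : Prop where
  isOpen : ∀ P ∈ 𝒲, IsOpen P.1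
  cover : ∀ x, ∃ P ∈ 𝒲, x ∈ P.1
  taming : ∀ P ∈ 𝒲, H.IsTamingACSOn Ω P.2 P.1
  agree : ∀ P ∈ 𝒲, ∀ Q ∈ 𝒲, ∀ x ∈ (P.1 ∩ Q.1) \ H.B, H.PushEq P.2 Q.2 x

/-- The family is `Ω`-tame. -/
def IsOmegaTame (Ω : VBilinField (m + 1) M X) : Prop := ∃ 𝒲, H.IsTamingCover Ω 𝒲

/-- The structures `f_*J`, for `(W, J) ∈ 𝒲`, agree near `B` with the standard complex structure of
the fibers of `Y` (multiplication by `i` on `CPᵐ`). -/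
def PushStandardNear (𝒲 : Set (Set (TotalSpace M X) × VEndField (m + 1) M X)) : Prop :=
  ∀ᶠ x in 𝓝ˢ H.B, x ∉ H.B → ∀ P ∈ 𝒲, x ∈ P.1 → ∀ v,
    tangentTriv (totalMap (m := m) H.f x) (VD H.f x (P.2 x v)) =
      mulI (tangentTriv (totalMap (m := m) H.f x) (VD H.f x v))

/-- Near `B`, the structure `J` is the fiberwise complex structure determined by the vector bundle
`V → B`. -/
def IsStandardNear (J : VEndField (m + 1) M X) : Prop :=
  ∀ᶠ x in 𝓝ˢ H.B, ∀ Ψ ∈ H.nbhd.triv, (∃ h : x ∈ H.nbhd.V, H.nbhd.ρ ⟨x, h⟩ ∈ Ψ.baseSet) →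
    ∀ v, D (m + 1) (m + 1) (nbhdCoordOn Ψ x.1) x.2 (J x v) =
      mulI (D (m + 1) (m + 1) (nbhdCoordOn Ψ x.1) x.2 v)

end HyperpencilFamily

end Families

end Hyperpencils

end

set_option linter.unusedSectionVars false

noncomputable section

namespace Hyperpencils

/-! ## Inverse square roots of operators without spectrum on the negative half-line -/

section BanachAlgebra

open MeasureTheory

/-! Tame structures are glued by averaging and retracting. A convex combination `A` of complex
structures tamed by `Ω` still satisfies `Ω(v, Av) > 0` for `v ≠ 0`, though not `A² = -1`. Skewness
of `Ω` gives `Ω((p - qA²)v, Av) = p Ω(v, Av) + q Ω(Av, A(Av))`, which is positive for weights `p, q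
≥ 0` that are not both zero. So `-A²` has no spectrum on the closed negative half-line, and `A
(-A²)^{-1/2}` is a complex structure (`retractJ`).

The inverse square root is `(2/π) ∫ (sin² θ + cos² θ B)⁻¹ dθ` over `[0, π/2]`, that is, `(1/π) ∫
s^{-1/2} (s + B)⁻¹ ds` over `(0, ∞)` after `s = tan² θ`. It is continuous in `B`, and every property
that passes to resolvents passes to it. Hence the retraction is natural under intertwining maps, so
continuity can be checked in frames. It keeps `Ω`-tameness and tameness relative to `T = df`
(`IsPretame.retraction`), it keeps skewness with respect to `T^*ω_std`, hence compatibility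
(`retractJ_skew`), and it keeps the structure induced on the image of `T` when all summands induce
the same one (`map_retractJ_apply`). It fixes complex structures, so nothing changes where a single
summand has weight one. A partition of unity then gives `exists_admissible_field`.

It remains to see that the standard structure `i` near a base point `b` can be one of the summands
(`tame_I_of_limit`, `tame_conjI_at_base`). At `tu` the kernel of `df` is the complex line through
`u`, and a compatible `J` preserves it. As `t → 0`, the limit `J_b` preserves every complex line, so
`J_b v = c v` with `c` complex. Approaching along a line that does not contain `v`, tameness
relative to `f` gives `Im c ≥ 0`; if the complex dimension is one, the orientation gives it. Since
`0 < Ω(v, J_b v) = Im c · Ω(v, iv)`, it follows that `Ω(v, iv) > 0`, and tameness is open.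
Compatibility off `B` is clear because `f` is holomorphic in the chart.

For families the same argument runs on the vertical tangent bundle. The total space is paracompact
Hausdorff because its fibers are compact and the base is metrizable, `B` is closed because it is
proper over the base, and the fiberwise structure is well defined because the transition maps of `V
→ B` are complex linear and locally constant along each fiber of `X → S`. -/

theorem hasDerivAt_intervalIntegral_of_continuous {G : Type*} [NormedAddCommGroup G]
    [NormedSpace ℝ G] [CompleteSpace G] {F F' : ℝ → ℝ → G} (hF : Continuous (Function.uncurry F))
    (hF' : Continuous (Function.uncurry F')) (h : ∀ x t, HasDerivAt (fun y => F y t) (F' x t) x)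
    (a b x : ℝ) :
    HasDerivAt (fun y => ∫ t in a..b, F y t) (∫ t in a..b, F' x t) x := by
  obtain ⟨C, hC⟩ := ((isCompact_Icc (a := x - 1) (b := x + 1)).prod
    (isCompact_uIcc (a := a) (b := b))).exists_bound_of_continuousOn hF'.continuousOn
  have hs : ∀ y, Continuous (F y) := fun y => hF.comp (Continuous.prodMk_right y)
  refine (intervalIntegral.hasDerivAt_integral_of_dominated_loc_of_deriv_le (bound := fun _ => C)
    (Icc_mem_nhds (sub_one_lt x) (lt_add_one x)) (.of_forall fun y => (hs y).aestronglyMeasurable)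
    ((hs x).intervalIntegrable _ _)
    (hF'.comp (Continuous.prodMk_right x)).aestronglyMeasurable ?_
    (intervalIntegrable_const) ?_).2
  · exact .of_forall fun t ht y hy => hC (y, t) ⟨hy, uIoc_subset_uIcc ht⟩
  · exact .of_forall fun t _ y _ => h y t

variable {𝔸 : Type*} [NormedRing 𝔸] [NormedAlgebra ℝ 𝔸]

/-- The spectrum of `B` does not meet the closed negative half-line. -/
def IsSlit (B : 𝔸) : Prop :=
  ∀ p q : ℝ, 0 ≤ p → 0 ≤ q → 0 < p + q → IsUnit (p • (1 : 𝔸) + q • B)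

/-- The operator `sin² θ + cos² θ B`. -/
def slitPencil (B : 𝔸) (θ : ℝ) : 𝔸 :=
  Real.sin θ ^ 2 • (1 : 𝔸) + Real.cos θ ^ 2 • B

/-- The inverse of `sin² θ + cos² θ B`. -/
def slitResolvent (B : 𝔸) (θ : ℝ) : 𝔸 :=
  Ring.inverse (slitPencil B θ)

/-- The inverse square root of `B`. -/
def invSqrt (B : 𝔸) : 𝔸 :=
  (2 / Real.pi) • ∫ θ in (0 : ℝ)..(Real.pi / 2), slitResolvent B θ

theorem IsSlit.isUnit {B : 𝔸} (hB : IsSlit B) (θ : ℝ) : IsUnit (slitPencil B θ) :=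
  hB _ _ (sq_nonneg _) (sq_nonneg _) (by rw [Real.sin_sq_add_cos_sq]; exact one_pos)

theorem IsSlit.pencil_mul {B : 𝔸} (hB : IsSlit B) (θ : ℝ) :
    slitPencil B θ * slitResolvent B θ = 1 := Ring.mul_inverse_cancel _ (hB.isUnit θ)

theorem IsSlit.mul_pencil {B : 𝔸} (hB : IsSlit B) (θ : ℝ) :
    slitResolvent B θ * slitPencil B θ = 1 := Ring.inverse_mul_cancel _ (hB.isUnit θ)

/-- The path from `1` to `B`. -/
def slitPath (B : 𝔸) (τ : ℝ) : 𝔸 :=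
  Real.cos τ ^ 2 • (1 : 𝔸) + Real.sin τ ^ 2 • B

/-- A nonnegative combination of `1` and a point of the path is one of `1` and `B` with the same
total weight. -/
theorem IsSlit.path {B : 𝔸} (hB : IsSlit B) (τ : ℝ) : IsSlit (slitPath B τ) := by
  intro p q hp hq hpq
  have h := hB (p + q * Real.cos τ ^ 2) (q * Real.sin τ ^ 2) (by positivity) (by positivity) (by
    rw [add_assoc, ← mul_add, Real.cos_sq_add_sin_sq]; linarith)
  convert h using 1
  rw [slitPath]
  module

theorem continuous_slitPath (B : 𝔸) : Continuous (slitPath B) := by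
  unfold slitPath; fun_prop

theorem hasDerivAt_slitPath (B : 𝔸) (τ : ℝ) :
    HasDerivAt (slitPath B) ((2 * Real.sin τ * Real.cos τ) • (B - 1)) τ := by
  have h1 := ((Real.hasDerivAt_cos τ).pow 2).smul_const (1 : 𝔸)
  have h2 := ((Real.hasDerivAt_sin τ).pow 2).smul_const B
  refine (h1.add h2).congr_deriv ?_
  simp only [Nat.cast_ofNat, Nat.add_one_sub_one, pow_one]
  module

variable [CompleteSpace 𝔸]

theorem continuous_slitResolvent {Z : Type*} [TopologicalSpace Z] {B : Z → 𝔸}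
    (hB : Continuous B) (hs : ∀ z, IsSlit (B z)) :
    Continuous fun p : Z × ℝ => slitResolvent (B p.1) p.2 := by
  refine continuous_iff_continuousAt.2 fun p => ?_
  have h1 : ContinuousAt Ring.inverse (slitPencil (B p.1) p.2) := by
    obtain ⟨u, hu⟩ := (hs p.1).isUnit p.2
    exact hu ▸ NormedRing.inverse_continuousAt u
  have h2 : Continuous fun q : Z × ℝ => slitPencil (B q.1) q.2 := by
    unfold slitPencil
    fun_prop
  exact ContinuousAt.comp (f := fun q : Z × ℝ => slitPencil (B q.1) q.2) h1 h2.continuousAt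

theorem continuous_slitResolvent_right {B : 𝔸} (hB : IsSlit B) :
    Continuous (slitResolvent B) := by
  have h := continuous_slitResolvent (Z := Unit) (B := fun _ => B) continuous_const fun _ => hB
  exact h.comp (g := fun p : Unit × ℝ => slitResolvent B p.2) (f := fun θ => ((), θ))
    (by fun_prop)

theorem continuousOn_invSqrt : ContinuousOn (invSqrt (𝔸 := 𝔸)) {B | IsSlit B} := by
  rw [continuousOn_iff_continuous_domRestrict]
  have h := continuous_slitResolvent (Z := {B : 𝔸 | IsSlit B})
    (B := fun B => B.1) continuous_subtype_val fun B => B.2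
  exact (intervalIntegral.continuous_parametric_intervalIntegral_of_continuous'
    (μ := MeasureTheory.volume) h _ _).const_smul _

theorem slitResolvent_comm {B : 𝔸} (hB : IsSlit B) {L : 𝔸} (h : Commute L B)
    (θ : ℝ) : Commute L (slitResolvent B θ) := by
  have h1 : Commute L (slitPencil B θ) :=
    ((Commute.one_right _).smul_right _).add_right (h.smul_right _)
  have h2 := congrArg (slitResolvent B θ * · * slitResolvent B θ) h1.eq
  simp only [← mul_assoc] at h2
  rw [mul_assoc _ _ (slitResolvent B θ), hB.pencil_mul, mul_one, hB.mul_pencil, one_mul] at h2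
  exact h2.symm

theorem mul_invSqrt {B : 𝔸} (hB : IsSlit B) (L : 𝔸) :
    L * invSqrt B = (2 / Real.pi) • ∫ θ in (0 : ℝ)..(Real.pi / 2), L * slitResolvent B θ := by
  rw [invSqrt, mul_smul_comm]
  congr 1
  exact ((ContinuousLinearMap.mul ℝ 𝔸 L).intervalIntegral_comp_comm
      ((continuous_slitResolvent_right hB).intervalIntegrable _ _)).symm

theorem invSqrt_comm {B : 𝔸} (hB : IsSlit B) {L : 𝔸} (h : Commute L B) :
    Commute L (invSqrt B) := by
  have e2 : invSqrt B * L =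
      (2 / Real.pi) • ∫ θ in (0 : ℝ)..(Real.pi / 2), slitResolvent B θ * L := by
    rw [invSqrt, smul_mul_assoc]
    congr 1
    exact (((ContinuousLinearMap.mul ℝ 𝔸).flip L).intervalIntegral_comp_comm
      ((continuous_slitResolvent_right hB).intervalIntegrable _ _)).symm
  rw [commute_iff_eq, mul_invSqrt hB, e2]
  simp_rw [(slitResolvent_comm hB h _).eq]

set_option synthInstance.maxHeartbeats 100000 in
theorem hasDerivAt_ringInverse_path {D : ℝ → 𝔸} {D' : 𝔸} {x : ℝ}
    (hD : HasDerivAt D D' x) (hu : IsUnit (D x)) :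
    HasDerivAt (fun y => Ring.inverse (D y))
      (-(Ring.inverse (D x) * D' * Ring.inverse (D x))) x := by
  obtain ⟨u, hu⟩ := hu
  have h1 := hasFDerivAt_ringInverse (𝕜 := ℝ) u
  rw [hu] at h1
  have h2 := h1.comp_hasDerivAt x hD
  have h3 : Ring.inverse (D x) = ↑u⁻¹ := by rw [← hu, Ring.inverse_unit]
  rw [h3]
  exact h2

/-- The integrand is the `θ`-derivative of `-sin θ cos θ · (sin² θ + cos² θ B)⁻¹`, which vanishes at
both ends of `[0, π/2]`. -/
theorem integral_slitResolvent_sq {B : 𝔸} (hB : IsSlit B) :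
    ∫ θ in (0 : ℝ)..(Real.pi / 2), (slitResolvent B θ -
      (2 * Real.cos θ ^ 2) • (B * (slitResolvent B θ * slitResolvent B θ))) = 0 := by
  have hr := continuous_slitResolvent_right hB
  have key : ∀ θ, HasDerivAt (fun θ => -((Real.sin θ * Real.cos θ) • slitResolvent B θ))
      (slitResolvent B θ -
      (2 * Real.cos θ ^ 2) • (B * (slitResolvent B θ * slitResolvent B θ))) θ := by
    intro θ
    have h1 : HasDerivAt (slitPencil B) ((2 * Real.sin θ * Real.cos θ) • (1 - B)) θ := by
      have h1 := ((Real.hasDerivAt_sin θ).pow 2).smul_const (1 : 𝔸)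
      have h2 := ((Real.hasDerivAt_cos θ).pow 2).smul_const B
      refine (h1.add h2).congr_deriv ?_
      simp only [Nat.cast_ofNat, Nat.add_one_sub_one, pow_one]
      module
    have h2 := (((Real.hasDerivAt_sin θ).mul (Real.hasDerivAt_cos θ)).smul
      (hasDerivAt_ringInverse_path h1 (hB.isUnit θ))).neg
    refine h2.congr_deriv ?_
    have e : Ring.inverse (slitPencil B θ) = slitResolvent B θ := rfl
    simp only [e, Pi.mul_apply]
    set r := slitResolvent B θ with hrdef
    have hc : r * B = B * r := ((slitResolvent_comm hB (Commute.refl B) θ).eq).symm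
    -- Expanding `r` as pencil times `r²` leaves only `r²` and `B r²`, so that comparing
    -- coefficients becomes trigonometry.
    have hone : r = Real.sin θ ^ 2 • (r * r) + Real.cos θ ^ 2 • (B * (r * r)) := by
      have := congrArg (· * r) (hB.pencil_mul θ)
      simp only [slitPencil, add_mul, smul_mul_assoc, one_mul, mul_assoc] at this
      exact this.symm
    have e3 : r * ((2 * Real.sin θ * Real.cos θ) • (1 - B)) * r =
        (2 * Real.sin θ * Real.cos θ) • (r * r - B * (r * r)) := by
      rw [mul_smul_comm, smul_mul_assoc, mul_sub, mul_one, hc, sub_mul, mul_assoc B]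
    rw [e3]
    have hsc : Real.sin θ ^ 2 = 1 - Real.cos θ ^ 2 := Real.sin_sq θ
    generalize B * (r * r) = Q at *
    generalize r * r = P at *
    rw [hone]
    have h4 : ∀ (s c : ℝ), s ^ 2 = 1 - c ^ 2 →
        -((s * c) • -((2 * s * c) • (P - Q)) + (c * c + s * -s) • (s ^ 2 • P + c ^ 2 • Q)) =
        s ^ 2 • P + c ^ 2 • Q - (2 * c ^ 2) • Q := by
      intro s c h
      have a1 : s ^ 2 * c ^ 2 = s ^ 2 - s ^ 2 * s ^ 2 := by rw [h]; ring
      have a2 : s ^ 2 * c ^ 2 = c ^ 2 - c ^ 2 * c ^ 2 := by rw [h]; ring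
      match_scalars <;> nlinarith [a1, a2]
    simpa using h4 _ _ hsc
  have hcont : Continuous fun θ => slitResolvent B θ -
      (2 * Real.cos θ ^ 2) • (B * (slitResolvent B θ * slitResolvent B θ)) := by fun_prop
  rw [intervalIntegral.integral_eq_sub_of_hasDerivAt (fun θ _ => key θ)
    (hcont.intervalIntegrable _ _)]
  simp

/-- The velocity of `slitPath`. -/
def slitVel (B : 𝔸) (τ : ℝ) : 𝔸 := (2 * Real.sin τ * Real.cos τ) • (B - 1)

theorem slitVel_comm (B : 𝔸) (τ : ℝ) : Commute (slitVel B τ) (slitPath B τ) := by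
  have h1 : Commute (B - 1) (slitPath B τ) := by
    refine Commute.add_right ?_ ?_
    · exact (Commute.one_right _).smul_right _
    · exact ((Commute.refl B).sub_left (Commute.one_left _)).smul_right _
  exact h1.smul_left _

/-- The derivative of the resolvents along `slitPath`. -/
def resolventVel (B : 𝔸) (τ θ : ℝ) : 𝔸 :=
  -(slitResolvent (slitPath B τ) θ * (Real.cos θ ^ 2 • slitVel B τ) *
    slitResolvent (slitPath B τ) θ)

theorem continuous_resolventVel {B : 𝔸} (hB : IsSlit B) :
    Continuous fun p : ℝ × ℝ => resolventVel B p.1 p.2 := by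
  have hr := continuous_slitResolvent (continuous_slitPath B) hB.path
  have hv : Continuous fun p : ℝ × ℝ => Real.cos p.2 ^ 2 • slitVel B p.1 := by
    unfold slitVel; fun_prop
  exact ((hr.mul hv).mul hr).neg

theorem hasDerivAt_invSqrt_slitPath {B : 𝔸} (hB : IsSlit B) (τ : ℝ) :
    HasDerivAt (fun σ => invSqrt (slitPath B σ))
      ((2 / Real.pi) • ∫ θ in (0 : ℝ)..(Real.pi / 2), resolventVel B τ θ) τ := by
  have hder : ∀ τ θ, HasDerivAt (fun σ => slitResolvent (slitPath B σ) θ)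
      (resolventVel B τ θ) τ := fun τ θ => by
    refine hasDerivAt_ringInverse_path ?_ ((hB.path τ).isUnit θ)
    exact ((hasDerivAt_slitPath B τ).const_smul (Real.cos θ ^ 2)).const_add _
  have h := hasDerivAt_intervalIntegral_of_continuous
    (F := fun σ θ => slitResolvent (slitPath B σ) θ) (F' := resolventVel B)
    (continuous_slitResolvent (continuous_slitPath B) hB.path) (continuous_resolventVel hB) hder
    0 (Real.pi / 2) τ
  exact h.const_smul (2 / Real.pi)

theorem mul_intervalIntegral {φ : ℝ → 𝔸} (hφ : Continuous φ) (L : 𝔸) (a b : ℝ) :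
    L * ∫ θ in a..b, φ θ = ∫ θ in a..b, L * φ θ :=
  ((ContinuousLinearMap.mul ℝ 𝔸 L).intervalIntegral_comp_comm (hφ.intervalIntegrable _ _)).symm

/-- The right side is the velocity times the exact integrand of `integral_slitResolvent_sq`.
Everything commutes because the velocity commutes with the path. -/
theorem slitVel_mul_resolvent_add {B : 𝔸} (hB : IsSlit B) (τ θ : ℝ) :
    slitVel B τ * slitResolvent (slitPath B τ) θ +
      (2 : ℝ) • (slitPath B τ * resolventVel B τ θ) =
      slitVel B τ * (slitResolvent (slitPath B τ) θ - (2 * Real.cos θ ^ 2) •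
        (slitPath B τ * (slitResolvent (slitPath B τ) θ * slitResolvent (slitPath B τ) θ))) := by
  have c1 := (slitResolvent_comm (hB.path τ) (slitVel_comm B τ) θ).eq.symm
  have c2 := (slitVel_comm B τ).eq.symm
  unfold resolventVel
  generalize slitResolvent (slitPath B τ) θ = r at *
  generalize slitPath B τ = b at *
  generalize slitVel B τ = b' at *
  rw [mul_smul_comm, c1, smul_mul_assoc, mul_neg, mul_smul_comm, mul_assoc b',
    ← mul_assoc b, c2, mul_assoc b', mul_sub, mul_smul_comm]
  module

/-- This is `b'R + 2bR' = 0`, the relation expected from `b R² = 1`, obtained without it by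
integrating the pointwise identity over `θ`. -/
theorem slitVel_mul_add {B : 𝔸} (hB : IsSlit B) (τ : ℝ) :
    slitVel B τ * invSqrt (slitPath B τ) + (2 : ℝ) • (slitPath B τ *
      ((2 / Real.pi) • ∫ θ in (0 : ℝ)..(Real.pi / 2), resolventVel B τ θ)) = 0 := by
  have hτ := hB.path τ
  have hrr := continuous_slitResolvent_right hτ
  have hgτ : Continuous (resolventVel B τ) :=
    (continuous_resolventVel hB).comp (g := fun p : ℝ × ℝ => resolventVel B p.1 p.2)
      (f := fun θ => (τ, θ)) (by fun_prop)
  have e1 := mul_invSqrt hτ (slitVel B τ)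
  have e2 := mul_intervalIntegral hgτ (slitPath B τ) 0 (Real.pi / 2)
  have i1 : Continuous fun θ => slitVel B τ * slitResolvent (slitPath B τ) θ :=
    continuous_const.mul hrr
  have i2 : Continuous fun θ => (2 : ℝ) • (slitPath B τ * resolventVel B τ θ) :=
    (continuous_const.mul hgτ).const_smul 2
  have i3 : Continuous fun θ => slitResolvent (slitPath B τ) θ - (2 * Real.cos θ ^ 2) •
      (slitPath B τ * (slitResolvent (slitPath B τ) θ * slitResolvent (slitPath B τ) θ)) := by
    fun_prop
  have e4 := mul_intervalIntegral i3 (slitVel B τ) 0 (Real.pi / 2)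
  rw [integral_slitResolvent_sq hτ, mul_zero] at e4
  have e5 : (∫ θ in (0 : ℝ)..(Real.pi / 2), slitVel B τ * slitResolvent (slitPath B τ) θ) +
      (2 : ℝ) • ∫ θ in (0 : ℝ)..(Real.pi / 2), slitPath B τ * resolventVel B τ θ = 0 := by
    rw [← intervalIntegral.integral_smul, ← intervalIntegral.integral_add
      (i1.intervalIntegrable _ _) (i2.intervalIntegrable _ _), e4]
    exact intervalIntegral.integral_congr fun θ _ => slitVel_mul_resolvent_add hB τ θ
  rw [mul_smul_comm, e1, e2, smul_comm (2 : ℝ), ← smul_add, e5, smul_zero]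

theorem hasDerivAt_mul_invSqrt_sq {B : 𝔸} (hB : IsSlit B) (τ : ℝ) :
    HasDerivAt (fun σ => slitPath B σ * (invSqrt (slitPath B σ) * invSqrt (slitPath B σ))) 0 τ := by
  have hR' := hasDerivAt_invSqrt_slitPath hB τ
  refine ((hasDerivAt_slitPath B τ).mul (hR'.mul hR')).congr_deriv ?_
  have hmain := slitVel_mul_add hB τ
  have hτ := hB.path τ
  have c3 : invSqrt (slitPath B τ) * slitVel B τ = slitVel B τ * invSqrt (slitPath B τ) :=
    (invSqrt_comm hτ (slitVel_comm B τ)).eq.symm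
  have hRb : invSqrt (slitPath B τ) * slitPath B τ = slitPath B τ * invSqrt (slitPath B τ) :=
    (invSqrt_comm hτ (Commute.refl _)).eq.symm
  have hbu : IsUnit (slitPath B τ) := by simpa using hτ 0 1 le_rfl zero_le_one (by norm_num)
  change slitVel B τ * (invSqrt (slitPath B τ) * invSqrt (slitPath B τ)) + slitPath B τ * _ = 0
  generalize ((2 / Real.pi) • ∫ θ in (0 : ℝ)..(Real.pi / 2), resolventVel B τ θ) = R' at *
  generalize invSqrt (slitPath B τ) = R at *
  generalize slitPath B τ = b at *
  generalize slitVel B τ = b' at *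
  have e4 : b * R' = -((1 / 2 : ℝ) • (b' * R)) := by
    have : b * R' = (1 / 2 : ℝ) • ((2 : ℝ) • (b * R')) := by module
    rw [this, eq_neg_of_add_eq_zero_right hmain, smul_neg]
  -- `R'` is an integral not yet known to commute with `R`. But `bR'` is a multiple of `b'R`, which
  -- does, and `b` is invertible.
  have hR'R : R' * R = R * R' := by
    refine hbu.mul_left_cancel ?_
    rw [← mul_assoc, e4, ← mul_assoc, ← hRb, mul_assoc R b, e4]
    simp only [neg_mul, mul_neg, smul_mul_assoc, mul_smul_comm, ← mul_assoc, c3]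
  calc b' * (R * R) + b * (R' * R + R * R')
      = (b' * R + (2 : ℝ) • (b * R')) * R := by
        rw [← hR'R, add_mul, smul_mul_assoc, two_smul, mul_add, mul_assoc, mul_assoc]
    _ = 0 := by rw [hmain, zero_mul]

theorem invSqrt_one : invSqrt (1 : 𝔸) = 1 := by
  have : ∀ θ, slitResolvent (1 : 𝔸) θ = 1 := fun θ => by
    rw [slitResolvent, slitPencil, ← add_smul, Real.sin_sq_add_cos_sq, one_smul,
      Ring.inverse_one]
  rw [invSqrt]
  simp only [this, intervalIntegral.integral_const, sub_zero, smul_smul]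
  rw [show 2 / Real.pi * (Real.pi / 2) = 1 by field_simp, one_smul]

/-- The inverse square root squares to the inverse. -/
theorem mul_invSqrt_mul_invSqrt {B : 𝔸} (hB : IsSlit B) :
    B * (invSqrt B * invSqrt B) = 1 := by
  -- Along the path, `b R²` has zero derivative, and it equals `1` at the starting point `b = 1`.
  have hconst := is_const_of_deriv_eq_zero
    (fun τ => (hasDerivAt_mul_invSqrt_sq hB τ).differentiableAt)
    (fun τ => (hasDerivAt_mul_invSqrt_sq hB τ).deriv) (Real.pi / 2) 0
  have h0 : slitPath B 0 = 1 := by simp [slitPath]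
  have h1 : slitPath B (Real.pi / 2) = B := by simp [slitPath]
  simpa [h0, h1, invSqrt_one] using hconst

/-! ## Retraction onto complex structures -/

/-- The complex structure `A (-A²)^{-1/2}` associated with an operator `A` without real
eigenvalues. -/
def retractJ (A : 𝔸) : 𝔸 := A * invSqrt (-(A * A))

theorem retractJ_commute {A : 𝔸} (hA : IsSlit (-(A * A))) :
    Commute A (invSqrt (-(A * A))) :=
  invSqrt_comm hA (((Commute.refl A).mul_right (Commute.refl A)).neg_right)

/-- `A` commutes with `R = (-A²)^{-1/2}`, so `(AR)² = -(-A²)R² = -1`. -/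
theorem retractJ_mul_self {A : 𝔸} (hA : IsSlit (-(A * A))) :
    retractJ A * retractJ A = -1 := by
  have hc := (retractJ_commute hA).eq
  have h := mul_invSqrt_mul_invSqrt hA
  have : retractJ A * retractJ A = -(-(A * A) * (invSqrt (-(A * A)) * invSqrt (-(A * A)))) := by
    rw [retractJ]
    conv_lhs => rw [mul_assoc, ← mul_assoc _ A, ← hc]
    simp only [neg_mul, neg_neg, mul_assoc]
  rw [this, h]

/-- This makes the map a retraction: averaging leaves the structure unchanged wherever only one
summand has nonzero weight. -/
theorem retractJ_of_sq {J : 𝔸} (hJ : J * J = -1) : retractJ J = J := by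
  rw [retractJ, hJ, neg_neg, invSqrt_one, mul_one]

theorem continuousOn_retractJ :
    ContinuousOn (retractJ (𝔸 := 𝔸)) {A | IsSlit (-(A * A))} := by
  refine continuousOn_id.mul (continuousOn_invSqrt.comp (by fun_prop) fun A hA => hA)

end BanachAlgebra

/-! ### Naturality of the retraction under intertwining maps -/

section Operators

variable {E : Type*} [NormedAddCommGroup E] [NormedSpace ℝ E] [CompleteSpace E]
  {F : Type*} [NormedAddCommGroup F] [NormedSpace ℝ F] [CompleteSpace F]

/-- Operators intertwining `B` and `B'` intertwine their inverse square roots. -/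
theorem slitResolvent_intertwine {B : E →L[ℝ] E} {B' : F →L[ℝ] F} (hB : IsSlit B)
    (hB' : IsSlit B') {L : E →L[ℝ] F} (h : L ∘L B = B' ∘L L) (θ : ℝ) :
    L ∘L slitResolvent B θ = slitResolvent B' θ ∘L L := by
  have h1 : L ∘L slitPencil B θ = slitPencil B' θ ∘L L := by
    ext v
    have := congrArg (fun T => T v) h
    simp only [ContinuousLinearMap.comp_apply] at this
    simp [slitPencil, this]
  ext v
  have h2 := congrArg (fun T => slitResolvent B' θ (T (slitResolvent B θ v))) h1
  have h3 := congrArg (fun T => T v) (hB.pencil_mul θ)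
  have h4 := congrArg (fun T => T (L (slitResolvent B θ v))) (hB'.mul_pencil θ)
  simp only [ContinuousLinearMap.comp_apply, mul_apply_eq_comp,
    one_apply_eq_self] at h2 h3 h4 ⊢
  rw [h3, h4] at h2
  exact h2.symm

theorem invSqrt_intertwine {B : E →L[ℝ] E} {B' : F →L[ℝ] F} (hB : IsSlit B)
    (hB' : IsSlit B') {L : E →L[ℝ] F} (h : L ∘L B = B' ∘L L) :
    L ∘L invSqrt B = invSqrt B' ∘L L := by
  have e1 : L ∘L invSqrt B =
      (2 / Real.pi) • ∫ θ in (0 : ℝ)..(Real.pi / 2), L ∘L slitResolvent B θ := by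
    rw [invSqrt, ContinuousLinearMap.comp_smul]
    congr 1
    exact (((ContinuousLinearMap.compL ℝ E E F) L).intervalIntegral_comp_comm
      ((continuous_slitResolvent_right hB).intervalIntegrable _ _)).symm
  have e2 : invSqrt B' ∘L L =
      (2 / Real.pi) • ∫ θ in (0 : ℝ)..(Real.pi / 2), slitResolvent B' θ ∘L L := by
    rw [invSqrt, ContinuousLinearMap.smul_comp]
    congr 1
    exact (((ContinuousLinearMap.compL ℝ E F F).flip L).intervalIntegral_comp_comm
      ((continuous_slitResolvent_right hB').intervalIntegrable _ _)).symm
  rw [e1, e2]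
  simp_rw [slitResolvent_intertwine hB hB' h]

/-- Applied to changes of frame, this makes the retraction an operation on endomorphisms of a vector
bundle. -/
theorem retractJ_intertwine {A : E →L[ℝ] E} {A' : F →L[ℝ] F} (hA : IsSlit (-(A * A)))
    (hA' : IsSlit (-(A' * A'))) {L : E →L[ℝ] F} (h : L ∘L A = A' ∘L L) :
    L ∘L retractJ A = retractJ A' ∘L L := by
  have h2 : L ∘L (-(A * A)) = (-(A' * A')) ∘L L := by
    ext v
    have e := fun v => congrArg (fun T => T v) h
    simp only [ContinuousLinearMap.comp_apply] at e
    simp [e]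
  have h3 := invSqrt_intertwine hA hA' h2
  ext v
  have e := fun v => congrArg (fun T => T v) h
  have e3 := fun v => congrArg (fun T => T v) h3
  simp only [ContinuousLinearMap.comp_apply] at e e3
  simp [retractJ, e, e3]

end Operators

/-! ## Tame operators -/

section Tame

variable {E : Type*} [NormedAddCommGroup E] [NormedSpace ℝ E] [FiniteDimensional ℝ E]
  {G : Type*} [NormedAddCommGroup G] [NormedSpace ℝ G] [FiniteDimensional ℝ G]

/-- `A` preserves `ker T`, and `τ(v, Av) > 0` for `v ∉ ker T`. -/
structure IsPretame (τ : E →L[ℝ] E →L[ℝ] ℝ) (T : E →L[ℝ] G) (A : E →L[ℝ] E) : Prop where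
  map_ker : ∀ v, T v = 0 → T (A v) = 0
  pos : ∀ v, T v ≠ 0 → 0 < τ v (A v)

/-- `τ` is skew and vanishes on `ker T`, i.e. it is the pull-back of a skew form by `T`. -/
structure IsPullbackForm (τ : E →L[ℝ] E →L[ℝ] ℝ) (T : E →L[ℝ] G) : Prop where
  skew : ∀ v w, τ v w = -τ w v
  ker : ∀ v w, T v = 0 → τ v w = 0

variable {τ : E →L[ℝ] E →L[ℝ] ℝ} {T : E →L[ℝ] G} {A : E →L[ℝ] E}

theorem IsPullbackForm.ker_right (hτ : IsPullbackForm τ T) (v w : E) (h : T w = 0) :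
    τ v w = 0 := by rw [hτ.skew, hτ.ker w v h, neg_zero]

theorem IsPretame.map_ne_zero (hτ : IsPullbackForm τ T) (hA : IsPretame τ T A) {v : E}
    (hv : T v ≠ 0) : T (A v) ≠ 0 := fun h => by
  have := hA.pos v hv
  rw [hτ.ker_right v _ h] at this
  exact this.false

/-- Skewness turns `τ(-A²v, Av)` into `τ(Av, A(Av))`, which is positive because `Av` is not in `ker
T` either. -/
theorem IsPretame.pencil_pos (hτ : IsPullbackForm τ T) (hA : IsPretame τ T A) {p q : ℝ}
    (hp : 0 ≤ p) (hq : 0 ≤ q) (hpq : 0 < p + q) {v : E} (hv : T v ≠ 0) :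
    0 < τ ((p • (1 : E →L[ℝ] E) + q • -(A * A)) v) (A v) := by
  have h1 := hA.pos v hv
  have h2 := hA.pos _ (hA.map_ne_zero hτ hv)
  have h3 := hτ.skew (A (A v)) (A v)
  have : τ ((p • (1 : E →L[ℝ] E) + q • -(A * A)) v) (A v) =
      p * τ v (A v) + q * τ (A v) (A (A v)) := by
    simp [h3]
  rw [this]
  rcases hp.eq_or_lt with rfl | hp
  · have : 0 < q := by simpa using hpq
    positivity
  · positivity

/-- A kernel vector of `p - qA²` would contradict the positivity of `pencil_pos` for `T = id`; in
finite dimension injectivity is invertibility. -/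
theorem IsPretame.isSlit {Ω : E →L[ℝ] E →L[ℝ] ℝ} (hΩ : ∀ v w, Ω v w = -Ω w v)
    (hA : ∀ v, v ≠ 0 → 0 < Ω v (A v)) : IsSlit (-(A * A)) := by
  intro p q hp hq hpq
  have hτ : IsPullbackForm Ω (ContinuousLinearMap.id ℝ E) :=
    ⟨hΩ, fun v w h => by simp [show v = 0 from h]⟩
  have hA' : IsPretame Ω (ContinuousLinearMap.id ℝ E) A :=
    ⟨fun v h => by simp [show v = 0 from h], hA⟩
  have hinj : Function.Injective (p • (1 : E →L[ℝ] E) + q • -(A * A)) := by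
    rw [injective_iff_map_eq_zero]
    intro v hv
    by_contra h
    have := hA'.pencil_pos hτ hp hq hpq (v := v) h
    rw [hv] at this
    simp at this
  rw [ContinuousLinearMap.isUnit_iff_bijective]
  exact ⟨hinj, (LinearMap.injective_iff_surjective
    (f := (p • (1 : E →L[ℝ] E) + q • -(A * A)).toLinearMap)).1 hinj⟩

theorem pencil_resolvent_apply (hs : IsSlit (-(A * A))) (θ : ℝ) (v : E) :
    slitPencil (-(A * A)) θ (slitResolvent (-(A * A)) θ v) = v :=
  congrArg (fun L => L v) (hs.pencil_mul θ)

theorem resolvent_pencil_apply (hs : IsSlit (-(A * A))) (θ : ℝ) (v : E) :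
    slitResolvent (-(A * A)) θ (slitPencil (-(A * A)) θ v) = v :=
  congrArg (fun L => L v) (hs.mul_pencil θ)

theorem map_invSqrt_apply {B : E →L[ℝ] E} (hs : IsSlit B) (L : E →L[ℝ] G) (v : E) :
    L (invSqrt B v) = (2 / Real.pi) • ∫ θ in (0 : ℝ)..(Real.pi / 2), L (slitResolvent B θ v) := by
  have h := continuous_slitResolvent_right hs
  have h1 := (L ∘L ContinuousLinearMap.apply ℝ E v).intervalIntegral_comp_comm
    (h.intervalIntegrable (μ := MeasureTheory.volume) 0 (Real.pi / 2))
  simp only [ContinuousLinearMap.comp_apply, ContinuousLinearMap.apply_apply] at h1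
  rw [invSqrt, h1, smul_apply, map_smul]

/-- The pencil maps `ker T` to itself injectively, hence onto by finite dimension, so its inverse
preserves `ker T` too. -/
theorem map_resolvent_eq_zero (hA : IsPretame τ T A) (hs : IsSlit (-(A * A))) (θ : ℝ) {v : E}
    (hv : T v = 0) : T (slitResolvent (-(A * A)) θ v) = 0 := by
  set N : Submodule ℝ E := LinearMap.ker T.toLinearMap
  have hmaps : ∀ w ∈ N, slitPencil (-(A * A)) θ w ∈ N := fun w (hw : T w = 0) => by
    have := hA.map_ker _ (hA.map_ker _ hw)
    change T _ = 0
    simp [slitPencil, hw, this]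
  have hinj : Function.Injective
      ((slitPencil (-(A * A)) θ).toLinearMap.restrict hmaps) := fun a b hab => by
    have h1 : slitPencil (-(A * A)) θ (a : E) = slitPencil (-(A * A)) θ b := congrArg Subtype.val hab
    have h2 := congrArg (fun x => slitResolvent (-(A * A)) θ x) h1
    rw [resolvent_pencil_apply hs, resolvent_pencil_apply hs] at h2
    exact Subtype.ext h2
  obtain ⟨w, hw⟩ := LinearMap.injective_iff_surjective.1 hinj ⟨v, hv⟩
  have h1 : slitPencil (-(A * A)) θ (w : E) = v := congrArg Subtype.val hw
  rw [← h1, resolvent_pencil_apply hs]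
  exact w.2

theorem map_resolvent_ne_zero (hA : IsPretame τ T A) (hs : IsSlit (-(A * A))) (θ : ℝ) {v : E}
    (hv : T v ≠ 0) : T (slitResolvent (-(A * A)) θ v) ≠ 0 := fun h => hv <| by
  rw [← pencil_resolvent_apply hs θ v]
  have := hA.map_ker _ (hA.map_ker _ h)
  simp [slitPencil, h, this]

theorem retractJ_apply (A : E →L[ℝ] E) (v : E) :
    retractJ A v = A (invSqrt (-(A * A)) v) := rfl

/-- For positivity, put `w = r v` with `r` the resolvent and `D` the pencil at `θ`. Then `τ(v, A r
v) = τ(D w, A w) > 0` for every `θ`, and this is integrated. -/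
theorem IsPretame.retraction (hτ : IsPullbackForm τ T) (hA : IsPretame τ T A)
    (hs : IsSlit (-(A * A))) : IsPretame τ T (retractJ A) where
  map_ker v hv := by
    rw [retractJ_apply]
    refine hA.map_ker _ ?_
    rw [map_invSqrt_apply hs]
    simp [map_resolvent_eq_zero hA hs _ hv]
  pos v hv := by
    have h1 : τ v (retractJ A v) = (2 / Real.pi) • ∫ θ in (0 : ℝ)..(Real.pi / 2),
        τ v (A (slitResolvent (-(A * A)) θ v)) := by
      have := map_invSqrt_apply hs ((τ v) ∘L A) v
      simpa only [retractJ_apply, ContinuousLinearMap.comp_apply] using this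
    rw [h1, smul_eq_mul]
    have hc := continuous_slitResolvent_right hs
    refine mul_pos (by positivity) (intervalIntegral.intervalIntegral_pos_of_pos
      (Continuous.intervalIntegrable (by fun_prop) _ _) (fun θ => ?_) (by positivity))
    have h2 := hA.pencil_pos hτ (sq_nonneg (Real.sin θ)) (sq_nonneg (Real.cos θ))
      (by rw [Real.sin_sq_add_cos_sq]; exact one_pos) (map_resolvent_ne_zero hA hs θ hv)
    have h3 := pencil_resolvent_apply hs θ v
    rw [slitPencil] at h3
    rwa [h3] at h2

/-- If `A` is `τ`-skew, then `A²`, its resolvents and their integral `R` are `τ`-symmetric. Since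
`R` commutes with `A`, the product `AR` is skew. -/
theorem retractJ_skew (hs : IsSlit (-(A * A))) (h : ∀ v w, τ (A v) w = -τ v (A w)) (v w : E) :
    τ (retractJ A v) w = -τ v (retractJ A w) := by
  have hD : ∀ θ v w, τ (slitPencil (-(A * A)) θ v) w = τ v (slitPencil (-(A * A)) θ w) := by
    intro θ v w
    simp [slitPencil, h]
  have hr : ∀ θ v w,
      τ (slitResolvent (-(A * A)) θ v) w = τ v (slitResolvent (-(A * A)) θ w) := by
    intro θ v w
    have := hD θ (slitResolvent (-(A * A)) θ v) (slitResolvent (-(A * A)) θ w)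
    rwa [pencil_resolvent_apply hs, pencil_resolvent_apply hs, eq_comm] at this
  have hR : ∀ v w, τ (invSqrt (-(A * A)) v) w = τ v (invSqrt (-(A * A)) w) := by
    intro v w
    have h1 := map_invSqrt_apply hs (τ.flip w) v
    have h2 := map_invSqrt_apply hs (τ v) w
    simp only [ContinuousLinearMap.flip_apply] at h1
    rw [h1, h2]
    simp_rw [hr]
  have hc := fun v => congrArg (fun L => L v) (retractJ_commute hs).eq
  simp only [mul_apply_eq_comp] at hc
  rw [retractJ_apply, retractJ_apply, h, hR, hc]

/-- Modulo `ker T`, `A` acts as `J`, so `-A²` acts as the identity, and so do its resolvents and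
their average. -/
theorem map_retractJ_apply (hs : IsSlit (-(A * A))) {J : E →L[ℝ] E}
    (hJ : ∀ v, J (J v) = -v) (hJT : ∀ v, T v = 0 → T (J v) = 0) (h : ∀ v, T (A v) = T (J v))
    (v : E) : T (retractJ A v) = T (J v) := by
  have h1 : ∀ a b, T a = T b → T (J a) = T (J b) := fun a b hab => by
    have := hJT (a - b) (by rw [map_sub, hab, sub_self])
    rwa [map_sub, map_sub, sub_eq_zero] at this
  have h2 : ∀ v, T (A (A v)) = -T v := fun v => by
    rw [h, h1 _ _ (h v), hJ, map_neg]
  have h3 : ∀ θ v, T (slitResolvent (-(A * A)) θ v) = T v := fun θ v => by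
    conv_rhs => rw [← pencil_resolvent_apply hs θ v]
    simp [slitPencil, h2, ← add_smul]
  have h4 : T (invSqrt (-(A * A)) v) = T v := by
    rw [map_invSqrt_apply hs]
    simp only [h3, intervalIntegral.integral_const, sub_zero, smul_smul]
    rw [show 2 / Real.pi * (Real.pi / 2) = 1 by field_simp, one_smul]
  rw [retractJ_apply, h, h1 _ _ h4]

/-! ## Admissible complex structures -/

/-- `J` is an `Ω`-tame complex structure which, if `c` holds, is compatible with the pull-back
`τ` of a skew form by `T`. -/
structure IsAdmissible (Ω τ : E →L[ℝ] E →L[ℝ] ℝ) (T : E →L[ℝ] G) (c : Prop)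
    (J : E →L[ℝ] E) : Prop where
  sq : ∀ v, J (J v) = -v
  tame : ∀ v, v ≠ 0 → 0 < Ω v (J v)
  pos : c → ∀ v, T v ≠ 0 → 0 < τ v (J v)
  invariant : c → ∀ v w, τ (J v) (J w) = τ v w

variable {Ω : E →L[ℝ] E →L[ℝ] ℝ} {c : Prop} {J : E →L[ℝ] E}

/-- If `Tv = 0` but `T(Jv) ≠ 0`, positivity at `Jv` reads `0 < -τ(Jv, v)`, whereas `τ(Jv, v) = 0`.
-/
theorem IsAdmissible.map_ker (hτ : IsPullbackForm τ T) (hJ : IsAdmissible Ω τ T c J) (hc : c)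
    (v : E) (hv : T v = 0) : T (J v) = 0 := by
  by_contra h
  have := hJ.pos hc _ h
  rw [hJ.sq, map_neg, hτ.ker_right _ _ hv, neg_zero] at this
  exact this.false

theorem IsAdmissible.skew (hJ : IsAdmissible Ω τ T c J) (hc : c) (v w : E) :
    τ (J v) w = -τ v (J w) := by
  rw [← hJ.invariant hc v (J w), hJ.sq, map_neg, neg_neg]

/-! ### Convex combinations of admissible structures -/

section Sum

variable {ι : Type*} {s : Finset ι} {ρ : ι → ℝ} {K : ι → E →L[ℝ] E}

theorem sum_pos_of_weights (h0 : ∀ i ∈ s, 0 ≤ ρ i) (h1 : ∑ i ∈ s, ρ i = 1) {x : ι → ℝ}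
    (hx : ∀ i ∈ s, ρ i ≠ 0 → 0 < x i) : 0 < ∑ i ∈ s, ρ i * x i := by
  obtain ⟨i, hi, hi0⟩ : ∃ i ∈ s, ρ i ≠ 0 := by
    by_contra! h
    rw [Finset.sum_eq_zero h] at h1
    exact zero_ne_one h1
  refine Finset.sum_pos' (fun j hj => ?_) ⟨i, hi, mul_pos ((h0 i hi).lt_of_ne' hi0) (hx i hi hi0)⟩
  by_cases hj0 : ρ j = 0
  · simp [hj0]
  · exact mul_nonneg (h0 j hj) (hx j hj hj0).le

/-- Tameness is linear in the structure and so survives averaging; the equation `J² = -1` does not,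
hence the retraction afterwards. -/
theorem tame_sum (h0 : ∀ i ∈ s, 0 ≤ ρ i) (h1 : ∑ i ∈ s, ρ i = 1)
    (hK : ∀ i ∈ s, ρ i ≠ 0 → IsAdmissible Ω τ T c (K i)) (v : E) (hv : v ≠ 0) :
    0 < Ω v ((∑ i ∈ s, ρ i • K i) v) := by
  simpa using sum_pos_of_weights h0 h1 (x := fun i => Ω v (K i v))
    fun i hi hi0 => (hK i hi hi0).tame v hv

theorem isPretame_sum (hτ : IsPullbackForm τ T) (h0 : ∀ i ∈ s, 0 ≤ ρ i) (h1 : ∑ i ∈ s, ρ i = 1)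
    (hK : ∀ i ∈ s, ρ i ≠ 0 → IsAdmissible Ω τ T c (K i)) (hc : c) :
    IsPretame τ T (∑ i ∈ s, ρ i • K i) where
  map_ker v hv := by
    simp only [sum_apply, smul_apply, map_sum, map_smul]
    refine Finset.sum_eq_zero fun i hi => ?_
    by_cases hi0 : ρ i = 0
    · simp [hi0]
    · rw [(hK i hi hi0).map_ker hτ hc v hv, smul_zero]
  pos v hv := by
    simpa using sum_pos_of_weights h0 h1 (x := fun i => τ v (K i v))
      fun i hi hi0 => (hK i hi hi0).pos hc v hv

theorem skew_sum (hK : ∀ i ∈ s, ρ i ≠ 0 → IsAdmissible Ω τ T c (K i)) (hc : c) (v w : E) :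
    τ ((∑ i ∈ s, ρ i • K i) v) w = -τ v ((∑ i ∈ s, ρ i • K i) w) := by
  simp only [sum_apply, smul_apply, map_sum, map_smul,
    ← Finset.sum_neg_distrib]
  refine Finset.sum_congr rfl fun i hi => ?_
  by_cases hi0 : ρ i = 0
  · simp [hi0]
  · rw [(hK i hi hi0).skew hc, smul_neg]

/-- The retraction of a convex combination of admissible structures is admissible. -/
theorem isAdmissible_retractJ_sum (hΩ : ∀ v w, Ω v w = -Ω w v) (hτ : c → IsPullbackForm τ T)
    (h0 : ∀ i ∈ s, 0 ≤ ρ i) (h1 : ∑ i ∈ s, ρ i = 1)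
    (hK : ∀ i ∈ s, ρ i ≠ 0 → IsAdmissible Ω τ T c (K i)) :
    IsAdmissible Ω τ T c (retractJ (∑ i ∈ s, ρ i • K i)) := by
  have ht := tame_sum h0 h1 hK
  have hs := IsPretame.isSlit hΩ ht
  have hsq : ∀ v, retractJ (∑ i ∈ s, ρ i • K i) (retractJ (∑ i ∈ s, ρ i • K i) v) = -v :=
    fun v => congrArg (fun L => L v) (retractJ_mul_self hs)
  refine ⟨hsq, ?_, fun hc => ?_, fun hc v w => ?_⟩
  · have hτ' : IsPullbackForm Ω (ContinuousLinearMap.id ℝ E) :=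
      ⟨hΩ, fun v w h => by simp [show v = 0 from h]⟩
    have hA' : IsPretame Ω (ContinuousLinearMap.id ℝ E) (∑ i ∈ s, ρ i • K i) :=
      ⟨fun v h => by simp [show v = 0 from h], ht⟩
    exact (hA'.retraction hτ' hs).pos
  · exact ((isPretame_sum (hτ hc) h0 h1 hK hc).retraction (hτ hc) hs).pos
  -- For an operator with square `-1`, skewness and invariance of `τ` are equivalent.
  · rw [retractJ_skew hs (skew_sum hK hc), hsq, map_neg, neg_neg]

/-- The reference structure `J` only has to induce the same structure on the image of `T` as the
summands; it need not be one of them. -/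
theorem map_retractJ_sum (hΩ : ∀ v w, Ω v w = -Ω w v) (hτ : IsPullbackForm τ T)
    (h0 : ∀ i ∈ s, 0 ≤ ρ i) (h1 : ∑ i ∈ s, ρ i = 1)
    (hK : ∀ i ∈ s, ρ i ≠ 0 → IsAdmissible Ω τ T c (K i)) (hc : c) (hJ : IsAdmissible Ω τ T c J)
    (h : ∀ i ∈ s, ρ i ≠ 0 → ∀ v, T (K i v) = T (J v)) (v : E) :
    T (retractJ (∑ i ∈ s, ρ i • K i) v) = T (J v) := by
  refine map_retractJ_apply (IsPretame.isSlit hΩ (tame_sum h0 h1 hK)) hJ.sq (hJ.map_ker hτ hc) (fun v => ?_) v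
  simp only [sum_apply, smul_apply, map_sum, map_smul]
  calc ∑ i ∈ s, ρ i • T (K i v) = ∑ i ∈ s, ρ i • T (J v) := by
        refine Finset.sum_congr rfl fun i hi => ?_
        by_cases hi0 : ρ i = 0
        · simp [hi0]
        · rw [h i hi hi0]
    _ = T (J v) := by rw [← Finset.sum_smul, h1, one_smul]

end Sum

/-! ## Orientations -/

/-- Two complex structures tamed by the same form induce the same orientation. -/
theorem IsPosComplexStructure.of_tame {n : ℕ} {Ω : Cn n →L[ℝ] Cn n →L[ℝ] ℝ}
    {J J' : Cn n →L[ℝ] Cn n} (hJ : IsPosComplexStructure J) (hJ' : ∀ v, J' (J' v) = -v)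
    (h : ∀ v, v ≠ 0 → 0 < Ω v (J v)) (h' : ∀ v, v ≠ 0 → 0 < Ω v (J' v)) :
    IsPosComplexStructure J' := by
  obtain ⟨hsq, A, hA, hAJ⟩ := hJ
  -- `J P_s = J + sJ'` is injective for `s ≥ 0`, since `Ω(v, Jv + sJ'v) > 0`. So `det P_1` has the
  -- sign of `det P_0 = 1`. Moreover `P_1 J' = J + J' = J P_1`, so `P_1` carries `J'` to `J`
  -- preserving orientation.
  set P : ℝ → Cn n →L[ℝ] Cn n := fun s => 1 - s • (J * J') with hP
  have hPc : Continuous P := by fun_prop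
  have hinj : ∀ s, 0 ≤ s → Function.Injective (P s) := by
    intro s hs
    rw [injective_iff_map_eq_zero]
    intro v hv
    by_contra hne
    have h1 : J v + s • J' v = 0 := by
      have := congrArg J hv
      simpa [hP, hsq] using this
    have h2 := congrArg (Ω v) h1
    simp only [map_add, map_smul, smul_eq_mul, map_zero] at h2
    have := h v hne
    have := mul_nonneg hs (h' v hne).le
    linarith
  have hdet : ∀ s, 0 ≤ s → (P s).det ≠ 0 := fun s hs h0 => by
    have := LinearMap.bot_lt_ker_of_det_eq_zero h0
    rw [LinearMap.ker_eq_bot.2 (hinj s hs)] at this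
    exact this.false
  have hpos : 0 < (P 1).det := by
    by_contra hneg
    have hcont : ContinuousOn (fun s => (P s).det) (Icc 0 1) :=
      (ContinuousLinearMap.continuous_det.comp hPc).continuousOn
    have h0 : (P 0).det = 1 := by
      simp [hP, ContinuousLinearMap.det]
    have := intermediate_value_Icc' zero_le_one hcont
      (show (0 : ℝ) ∈ Icc (P 1).det (P 0).det from ⟨not_lt.1 hneg, by simp [h0]⟩)
    obtain ⟨s, hs, hs0⟩ := this
    exact hdet s hs.1 hs0
  have hbij : Function.Bijective (P 1) := ⟨hinj 1 zero_le_one,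
    (LinearMap.injective_iff_surjective (f := (P 1).toLinearMap)).1 (hinj 1 zero_le_one)⟩
  refine ⟨hJ', (ContinuousLinearEquiv.ofBijective (P 1) (LinearMap.ker_eq_bot.2 hbij.1)
    (LinearMap.range_eq_top.2 hbij.2)).trans A, ?_, fun v => ?_⟩
  · change 0 < LinearMap.det ((A : Cn n →L[ℝ] Cn n).toLinearMap ∘ₗ (P 1).toLinearMap)
    rw [LinearMap.det_comp]
    exact mul_pos hA hpos
  · change A (P 1 (J' v)) = Complex.I • A (P 1 v)
    rw [← hAJ]
    congr 1
    simp [hP, hsq, hJ']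
    abel

end Tame

/-! ## Patching fields of complex structures -/

section Patching

variable {E : Type*} [NormedAddCommGroup E] [NormedSpace ℝ E] [FiniteDimensional ℝ E]
  {G : Type*} [NormedAddCommGroup G] [NormedSpace ℝ G] [FiniteDimensional ℝ G]

theorem IsSlit.conj {B P P' : E →L[ℝ] E} (hB : IsSlit B) (h : P * P' = 1) (h' : P' * P = 1) :
    IsSlit (P * B * P') := by
  intro p q hp hq hpq
  have hP : IsUnit P := ⟨⟨P, P', h, h'⟩, rfl⟩
  have hP' : IsUnit P' := ⟨⟨P', P, h', h⟩, rfl⟩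
  have := (hP.mul (hB p q hp hq hpq)).mul hP'
  convert this using 1
  rw [mul_add, add_mul, mul_smul_comm, smul_mul_assoc, mul_one, h, mul_smul_comm, smul_mul_assoc]

/-- Both the domain of the retraction and its value are independent of the frame in which an
endomorphism is written. -/
theorem retractJ_conj {A P P' : E →L[ℝ] E} (hA : IsSlit (-(A * A))) (h : P * P' = 1)
    (h' : P' * P = 1) :
    IsSlit (-((P * A * P') * (P * A * P'))) ∧ retractJ (P * A * P') = P * retractJ A * P' := by
  have e : -((P * A * P') * (P * A * P')) = P * (-(A * A)) * P' := by
    have : (P * A * P') * (P * A * P') = P * A * (P' * P) * A * P' := by simp only [mul_assoc]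
    rw [this, h', mul_one, mul_neg, neg_mul]
    simp only [mul_assoc]
  have hs : IsSlit (-((P * A * P') * (P * A * P'))) := e ▸ hA.conj h h'
  refine ⟨hs, ?_⟩
  have hi : P ∘L A = (P * A * P') ∘L P := by
    change P * A = P * A * P' * P
    rw [mul_assoc _ P', h', mul_one]
  have := retractJ_intertwine hA hs hi
  change P * _ = _ * P at this
  rw [this, mul_assoc (retractJ (P * A * P')), h, mul_one]

variable {Z : Type*} [TopologicalSpace Z]

/-- Local frames of a vector bundle with fiber `E`: the frame `i` consists of mutually inverse
isomorphisms defined near the point `pt i`. -/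
structure FrameSystem (Z E : Type*) [TopologicalSpace Z] [NormedAddCommGroup E] [NormedSpace ℝ E]
    (ι : Type*) where
  /-- The point near which the frame is defined. -/
  pt : ι → Z
  /-- The isomorphism from the fiber to the model. -/
  coord : ι → Z → E →L[ℝ] E
  /-- The isomorphism from the model to the fiber. -/
  vec : ι → Z → E →L[ℝ] E
  coord_vec : ∀ i, ∀ᶠ x in 𝓝 (pt i), coord i x * vec i x = 1
  vec_coord : ∀ i, ∀ᶠ x in 𝓝 (pt i), vec i x * coord i x = 1

/-- The field `J` of endomorphisms is continuous at the point of the frame `i`. -/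
def FrameSystem.ContAt {ι : Type*} (Φ : FrameSystem Z E ι) (J : Z → E →L[ℝ] E) (i : ι) : Prop :=
  ContinuousAt (fun x => Φ.coord i x * J x * Φ.vec i x) (Φ.pt i)

/-- In a frame the retracted field is the retraction of the field in that frame, and `retractJ` is
continuous on its domain. -/
theorem FrameSystem.ContAt.retraction {ι : Type*} {Φ : FrameSystem Z E ι} {A : Z → E →L[ℝ] E}
    {i : ι} (h : Φ.ContAt A i) (hA : ∀ x, IsSlit (-(A x * A x))) :
    Φ.ContAt (fun x => retractJ (A x)) i := by
  have h1 : ∀ᶠ x in 𝓝 (Φ.pt i), Φ.coord i x * A x * Φ.vec i x ∈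
      {A : E →L[ℝ] E | IsSlit (-(A * A))} ∧
      retractJ (Φ.coord i x * A x * Φ.vec i x) = Φ.coord i x * retractJ (A x) * Φ.vec i x := by
    filter_upwards [Φ.coord_vec i, Φ.vec_coord i] with x h1 h2
    exact retractJ_conj (hA x) h1 h2
  have h2 : ContinuousAt (fun x => retractJ (Φ.coord i x * A x * Φ.vec i x)) (Φ.pt i) :=
    (continuousOn_retractJ _ h1.self_of_nhds.1).tendsto.comp
      (tendsto_nhdsWithin_iff.2 ⟨h, h1.mono fun x hx => hx.1⟩)
  exact h2.congr (h1.mono fun x hx => hx.2)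

theorem FrameSystem.ContAt.congr {ι : Type*} {Φ : FrameSystem Z E ι} {A A' : Z → E →L[ℝ] E}
    {i : ι} (h : Φ.ContAt A i) (hA : ∀ᶠ x in 𝓝 (Φ.pt i), A x = A' x) : Φ.ContAt A' i :=
  ContinuousAt.congr h (hA.mono fun x hx => by simp only [hx])

theorem FrameSystem.contAt_finsum {ι κ : Type*} {Φ : FrameSystem Z E ι}
    (ρ : PartitionOfUnity κ Z univ) {K : κ → Z → E →L[ℝ] E} {i : ι}
    (hK : ∀ k, Φ.pt i ∈ tsupport (ρ k) → Φ.ContAt (K k) i) :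
    Φ.ContAt (fun x => ∑ᶠ k, ρ k x • K k x) i := by
  obtain ⟨N, hN, hfin⟩ := ρ.locallyFinite (Φ.pt i)
  have hsum : ∀ᶠ x in 𝓝 (Φ.pt i), ∑ k ∈ hfin.toFinset, ρ k x • K k x = ∑ᶠ k, ρ k x • K k x := by
    filter_upwards [hN] with x hx
    refine (finsum_eq_sum_of_support_subset _ fun k hk => ?_).symm
    have : ρ k x ≠ 0 := fun h => hk (by simp [h])
    simpa using ⟨x, this, hx⟩
  refine FrameSystem.ContAt.congr ?_ hsum
  have hterm : ∀ k, ContinuousAt (fun x => ρ k x • (Φ.coord i x * K k x * Φ.vec i x)) (Φ.pt i) := by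
    intro k
    by_cases hk : Φ.pt i ∈ tsupport (ρ k)
    · exact (ρ k).continuous.continuousAt.smul (hK k hk)
    -- Off the closed support of `ρ k` the term vanishes nearby, so the behavior of `K k` there is
    -- irrelevant.
    · have : ∀ᶠ x in 𝓝 (Φ.pt i), (0 : E →L[ℝ] E) = ρ k x • (Φ.coord i x * K k x * Φ.vec i x) := by
        filter_upwards [notMem_tsupport_iff_eventuallyEq.1 hk] with x hx
        rw [hx]
        simp
      exact continuousAt_const.congr this
  have : ContinuousAt (fun x => ∑ k ∈ hfin.toFinset, ρ k x • (Φ.coord i x * K k x * Φ.vec i x))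
      (Φ.pt i) := tendsto_finsetSum _ fun k _ => hterm k
  refine this.congr (.of_forall fun x => ?_)
  simp only [Finset.mul_sum, Finset.sum_mul, mul_smul_comm, smul_mul_assoc]

/-- Given a cover by open sets with admissible structures and an admissible structure `J₀` near a
closed set `B`, there is a global admissible structure that coincides with `J₀` near `B`. -/
theorem exists_admissible_field [NormalSpace Z] [ParacompactSpace Z] {ι : Type*}
    (Φ : FrameSystem Z E ι) {Ω τ : Z → E →L[ℝ] E →L[ℝ] ℝ} {T : Z → E →L[ℝ] G} {B : Set Z}
    (hB : IsClosed B) (hΩ : ∀ x v w, Ω x v w = -Ω x w v)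
    (hτ : ∀ x ∉ B, IsPullbackForm (τ x) (T x))
    {𝒲 : Set (Set Z × (Z → E →L[ℝ] E))} (hopen : ∀ Q ∈ 𝒲, IsOpen Q.1)
    (hcover : ∀ x, ∃ Q ∈ 𝒲, x ∈ Q.1)
    (hadm : ∀ Q ∈ 𝒲, ∀ x ∈ Q.1, IsAdmissible (Ω x) (τ x) (T x) (x ∉ B) (Q.2 x))
    (hcont : ∀ Q ∈ 𝒲, ∀ i, Φ.pt i ∈ Q.1 → Φ.ContAt Q.2 i)
    {U : Set Z} (hU : IsOpen U) (hBU : B ⊆ U) {J₀ : Z → E →L[ℝ] E}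
    (hadm₀ : ∀ x ∈ U, IsAdmissible (Ω x) (τ x) (T x) (x ∉ B) (J₀ x))
    (hcont₀ : ∀ i, Φ.pt i ∈ U → Φ.ContAt J₀ i) :
    ∃ J : Z → E →L[ℝ] E, (∀ x, IsAdmissible (Ω x) (τ x) (T x) (x ∉ B) (J x)) ∧
      (∀ i, Φ.ContAt J i) ∧ (∀ᶠ x in 𝓝ˢ B, J x = J₀ x) ∧
      ((∀ P ∈ 𝒲, ∀ Q ∈ 𝒲, ∀ x ∈ (P.1 ∩ Q.1) \ B, ∀ v, T x (P.2 x v) = T x (Q.2 x v)) →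
        (∀ x ∈ U \ B, ∀ Q ∈ 𝒲, x ∈ Q.1 → ∀ v, T x (J₀ x v) = T x (Q.2 x v)) →
        ∀ Q ∈ 𝒲, ∀ x ∈ Q.1 \ B, ∀ v, T x (J x v) = T x (Q.2 x v)) := by
  obtain ⟨V, hV, hBV, hVU⟩ := normal_exists_closure_subset hB hU hBU
  -- The index `none` carries `J₀` on `U`; the other sets avoid `closure V`. Over `V` the field `J₀`
  -- therefore has weight one and survives the retraction unchanged.
  set W : Option 𝒲 → Set Z := fun o => o.elim U fun Q => Q.1.1 \ closure V with hW
  set K : Option 𝒲 → Z → E →L[ℝ] E := fun o => o.elim J₀ fun Q => Q.1.2 with hK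
  have hWo : ∀ o, IsOpen (W o) := by
    rintro (_ | Q)
    · exact hU
    · exact (hopen Q.1 Q.2).sdiff isClosed_closure
  have hWc : univ ⊆ ⋃ o, W o := by
    intro x _
    by_cases hx : x ∈ closure V
    · exact mem_iUnion.2 ⟨none, hVU hx⟩
    · obtain ⟨Q, hQ, hxQ⟩ := hcover x
      exact mem_iUnion.2 ⟨some ⟨Q, hQ⟩, hxQ, hx⟩
  obtain ⟨ρ, hρ⟩ := PartitionOfUnity.exists_isSubordinate isClosed_univ W hWo hWc
  have hmem : ∀ {o x}, ρ o x ≠ 0 → x ∈ W o := fun {o x} h => hρ o (subset_tsupport _ h)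
  have hKadm : ∀ o x, x ∈ W o → IsAdmissible (Ω x) (τ x) (T x) (x ∉ B) (K o x) := by
    rintro (_ | Q) x hx
    · exact hadm₀ x hx
    · exact hadm Q.1 Q.2 x hx.1
  have hKcont : ∀ o i, Φ.pt i ∈ W o → Φ.ContAt (K o) i := by
    rintro (_ | Q) i hi
    · exact hcont₀ i hi
    · exact hcont Q.1 Q.2 i hi.1
  have hA : ∀ x, ∑ᶠ o, ρ o x • K o x = ∑ o ∈ ρ.finsupport x, ρ o x • K o x := fun x => by
    refine finsum_eq_sum_of_support_subset _ fun o ho => ?_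
    have : ρ o x ≠ 0 := fun h => ho (by simp [h])
    simpa using this
  have h0 : ∀ x, ∀ o ∈ ρ.finsupport x, 0 ≤ ρ o x := fun x o _ => ρ.nonneg o x
  have h1 : ∀ x, ∑ o ∈ ρ.finsupport x, ρ o x = 1 := fun x => ρ.sum_finsupport (mem_univ x)
  have hK' : ∀ x, ∀ o ∈ ρ.finsupport x, ρ o x ≠ 0 →
      IsAdmissible (Ω x) (τ x) (T x) (x ∉ B) (K o x) := fun x o _ h => hKadm o x (hmem h)
  have hfin : ∀ x, IsAdmissible (Ω x) (τ x) (T x) (x ∉ B) (retractJ (∑ᶠ o, ρ o x • K o x)) := by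
    intro x
    rw [hA]
    exact isAdmissible_retractJ_sum (hΩ x) (hτ x) (h0 x) (h1 x) (hK' x)
  refine ⟨fun x => retractJ (∑ᶠ o, ρ o x • K o x), hfin, fun i => ?_, ?_, ?_⟩
  · refine FrameSystem.ContAt.retraction
      (FrameSystem.contAt_finsum ρ fun o ho => hKcont o i (hρ o ho)) fun x => ?_
    rw [hA]
    exact IsPretame.isSlit (hΩ x) (tame_sum (h0 x) (h1 x) (hK' x))
  · filter_upwards [hV.mem_nhdsSet.2 hBV] with x hx
    have hz : ∀ o, o ≠ none → ρ o x = 0 := by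
      rintro (_ | Q) ho
      · exact absurd rfl ho
      · by_contra h
        exact (hmem h).2 (subset_closure hx)
    have h2 : ρ none x = 1 := by
      rw [← ρ.sum_eq_one (mem_univ x), finsum_eq_single _ none hz]
    rw [finsum_eq_single _ none fun o ho => by rw [hz o ho, zero_smul], h2, one_smul]
    refine retractJ_of_sq (ContinuousLinearMap.ext fun v => ?_)
    exact (hadm₀ x (hVU (subset_closure hx))).sq v
  · intro hagree hU' Q hQ x hx v
    simp only [hA]
    refine map_retractJ_sum (hΩ x) (hτ x hx.2) (h0 x) (h1 x) (hK' x) hx.2 (hadm Q hQ x hx.1)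
      (fun o _ ho v => ?_) v
    have hxo := hmem ho
    rcases o with _ | Q'
    · exact hU' x ⟨hxo, hx.2⟩ Q hQ hx.1 v
    · exact hagree Q'.1 Q'.2 Q hQ x ⟨⟨hxo.1, hx.1⟩, hx.2⟩ v

end Patching

/-! ## The Fubini-Study form -/

section FubiniStudy

variable {m : ℕ}

/-- The Fubini-Study form in an affine chart as a continuous bilinear form. -/
def fubiniStudy (w : Cn m) : Cn m →L[ℝ] Cn m →L[ℝ] ℝ :=
  (CP.affineFubiniStudy w).toContinuousBilinearMap

theorem fubiniStudy_apply (w u v : Cn m) : fubiniStudy w u v =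
    Real.pi⁻¹ * ((inner ℂ u v).im / (1 + ‖w‖ ^ 2) -
      (inner ℂ u w * inner ℂ w v).im / (1 + ‖w‖ ^ 2) ^ 2) := rfl

theorem fubiniStudy_skew (w u v : Cn m) : fubiniStudy w u v = -fubiniStudy w v u := by
  have h1 : (inner ℂ v u).im = -(inner ℂ u v).im := by
    rw [← inner_conj_symm v u, Complex.conj_im]
  have h2 : (inner ℂ v w * inner ℂ w u).im = -(inner ℂ u w * inner ℂ w v).im := by
    rw [← inner_conj_symm v w, ← inner_conj_symm w u, ← map_mul, Complex.conj_im, mul_comm]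
  rw [fubiniStudy_apply, fubiniStudy_apply, h1, h2]
  ring

theorem fubiniStudy_I (w u v : Cn m) :
    fubiniStudy w (Complex.I • u) (Complex.I • v) = fubiniStudy w u v := by
  rw [fubiniStudy_apply, fubiniStudy_apply]
  simp only [inner_smul_left, inner_smul_right, Complex.conj_I]
  have h : ∀ a b : ℂ, -Complex.I * a * (Complex.I * b) = a * b := fun a b => by
    linear_combination (-a * b) * Complex.I_mul_I
  have h' : ∀ a : ℂ, Complex.I * (-Complex.I * a) = a := fun a => by
    linear_combination (-a) * Complex.I_mul_I
  rw [h, h']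

/-- By Cauchy–Schwarz, `|⟨u, w⟩|² ≤ |u|²|w|²`, so over the common denominator `(1 + |w|²)²` the
numerator is at least `|u|²`. -/
theorem fubiniStudy_pos (w : Cn m) {u : Cn m} (hu : u ≠ 0) :
    0 < fubiniStudy w u (Complex.I • u) := by
  have h1 : (inner ℂ u (Complex.I • u)).im = ‖u‖ ^ 2 := by
    rw [inner_smul_right, inner_self_eq_norm_sq_to_K]
    simp [← Complex.ofReal_pow]
  have h2 : (inner ℂ u w * inner ℂ w (Complex.I • u)).im = ‖inner ℂ u w‖ ^ 2 := by
    rw [inner_smul_right, ← inner_conj_symm w u, mul_left_comm, Complex.mul_conj,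
      Complex.normSq_eq_norm_sq]
    simp [-Complex.ofReal_pow]
  rw [fubiniStudy_apply, h1, h2]
  have h3 : ‖inner ℂ u w‖ ^ 2 ≤ ‖u‖ ^ 2 * ‖w‖ ^ 2 := by
    rw [← mul_pow]
    exact pow_le_pow_left₀ (norm_nonneg _) (norm_inner_le_norm u w) 2
  have h4 : 0 < ‖u‖ ^ 2 := by positivity
  have h5 : ‖u‖ ^ 2 / (1 + ‖w‖ ^ 2) - ‖inner ℂ u w‖ ^ 2 / (1 + ‖w‖ ^ 2) ^ 2 =
      (‖u‖ ^ 2 + (‖u‖ ^ 2 * ‖w‖ ^ 2 - ‖inner ℂ u w‖ ^ 2)) / (1 + ‖w‖ ^ 2) ^ 2 := by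
    field_simp
    ring
  rw [h5]
  have : 0 < ‖u‖ ^ 2 + (‖u‖ ^ 2 * ‖w‖ ^ 2 - ‖inner ℂ u w‖ ^ 2) := by linarith
  positivity

theorem fubiniStudy_self (w u : Cn m) : fubiniStudy w u u = 0 := by
  have := fubiniStudy_skew w u u
  linarith

end FubiniStudy

/-! ## The projection `ℂᵐ⁺¹ - {0} → CPᵐ` -/

section Projection

variable {m : ℕ}

/-- The projection to projective space, extended by a junk value at `0`. -/
def mkT (z : Cn (m + 1)) : CP m :=
  open Classical in
  if h : z ≠ 0 then Projectivization.mk ℂ z h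
  else Projectivization.mk ℂ (CP.lift 0 0) (CP.lift_ne_zero 0 0)

theorem mkT_of_ne_zero {z : Cn (m + 1)} (h : z ≠ 0) : mkT z = Projectivization.mk ℂ z h := by
  rw [mkT, dif_pos h]

theorem mkT_smul {z : Cn (m + 1)} {c : ℂ} (hc : c ≠ 0) : mkT (c • z) = mkT z := by
  by_cases hz : z = 0
  · simp [hz]
  · rw [mkT_of_ne_zero hz, mkT_of_ne_zero (smul_ne_zero hc hz), Projectivization.mk_eq_mk_iff']
    exact ⟨c, rfl⟩

/-- The index of the affine chart at `p`. -/
def chartIdx (p : CP m) : Fin (m + 1) := (CP.exists_mem_affineSource p).choose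

theorem chartIdx_mkT_ne_zero {z : Cn (m + 1)} (hz : z ≠ 0) : z (chartIdx (mkT z)) ≠ 0 := by
  have h := (CP.exists_mem_affineSource (mkT z)).choose_spec
  rw [mkT_of_ne_zero hz, CP.mk_mem_affineSource] at h
  rw [mkT_of_ne_zero hz]
  exact h

/-- The derivative at `z` of the projection in the `i`-th affine chart. -/
def dmk (i : Fin (m + 1)) (z : Cn (m + 1)) : Cn (m + 1) →L[ℂ] Cn m :=
  (PiLp.continuousLinearEquiv 2 ℂ (fun _ : Fin m => ℂ)).symm.toContinuousLinearMap ∘L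
    ContinuousLinearMap.pi fun k => (z i)⁻¹ • EuclideanSpace.proj (i.succAbove k) -
      (z (i.succAbove k) / z i ^ 2) • EuclideanSpace.proj i

theorem dmk_apply (i : Fin (m + 1)) (z v : Cn (m + 1)) (k : Fin m) :
    dmk i z v k = (z i)⁻¹ * v (i.succAbove k) - z (i.succAbove k) / z i ^ 2 * v i := rfl

/-- Vanishing says `v_k z_i = z_k v_i` for all `k`, so the kernel is the complex line through `z`,
the tangent to the fiber of the projection. -/
theorem dmk_eq_zero_iff {i : Fin (m + 1)} {z : Cn (m + 1)} (hz : z i ≠ 0) (v : Cn (m + 1)) :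
    dmk i z v = 0 ↔ ∃ c : ℂ, v = c • z := by
  constructor
  · intro h
    refine ⟨v i / z i, ?_⟩
    ext j
    refine Fin.succAboveCases i ?_ (fun k => ?_) j
    · simp [hz]
    · have h1 := congrArg (fun u : Cn m => u k) h
      simp only [dmk_apply, PiLp.zero_apply] at h1
      simp only [PiLp.smul_apply, smul_eq_mul]
      field_simp at h1 ⊢
      linear_combination h1
  · rintro ⟨c, rfl⟩
    ext k
    simp only [dmk_apply, PiLp.smul_apply, smul_eq_mul, PiLp.zero_apply]
    field_simp
    ring

/-- A map homogeneous of degree `0` has derivative homogeneous of degree `-1`. This rescales data at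
`tu` to the fixed point `u`. -/
theorem dmk_smul {i : Fin (m + 1)} (z v : Cn (m + 1)) {c : ℂ} (hc : c ≠ 0) :
    dmk i (c • z) v = c⁻¹ • dmk i z v := by
  ext k
  simp only [dmk_apply, PiLp.smul_apply, smul_eq_mul]
  rw [mul_inv, mul_pow]
  by_cases hz : z i = 0
  · simp [hz]
  · field_simp

theorem hasFDerivAt_affine (i : Fin (m + 1)) {z : Cn (m + 1)} (hz : z i ≠ 0) :
    HasFDerivAt (fun w : Cn (m + 1) => (WithLp.toLp 2 fun k => w (i.succAbove k) / w i : Cn m))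
      ((dmk i z).restrictScalars ℝ) z := by
  refine HasFDerivAt.restrictScalars ℝ ?_
  rw [← hasFDerivWithinAt_univ, hasFDerivWithinAt_piLp]
  intro k
  rw [hasFDerivWithinAt_univ]
  have h1 : ∀ j, HasFDerivAt (fun w : Cn (m + 1) => w j)
      (EuclideanSpace.proj j : Cn (m + 1) →L[ℂ] ℂ) z := fun j =>
    (EuclideanSpace.proj j : Cn (m + 1) →L[ℂ] ℂ).hasFDerivAt
  have h2 := (h1 (i.succAbove k)).mul ((hasDerivAt_inv hz).comp_hasFDerivAt z (h1 i))
  refine h2.congr_fderiv ?_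
  ext v
  simp [dmk_apply]
  field_simp
  ring

theorem continuousAt_mkT {z : Cn (m + 1)} (hz : z ≠ 0) : ContinuousAt mkT z := by
  have h : ContinuousOn (mkT (m := m)) {z | z ≠ 0} := by
    rw [continuousOn_iff_continuous_domRestrict]
    refine CP.isQuotientMap_mk'.continuous.congr fun z => ?_
    exact (mkT_of_ne_zero z.2).symm
  exact h.continuousAt (isOpen_ne.mem_nhds hz)

/-- The chart of `CP m` at the image of `z` is by definition the affine chart of index `chartIdx`,
so no change of chart occurs. -/
theorem hasMFDerivAt_mkT {z : Cn (m + 1)} (hz : z ≠ 0) :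
    HasMFDerivAt 𝓘(ℝ, Cn (m + 1)) 𝓘(ℝ, Cn m) mkT z
      ((dmk (chartIdx (mkT z)) z).restrictScalars ℝ : Cn (m + 1) →L[ℝ] Cn m) := by
  refine ⟨continuousAt_mkT hz, ?_⟩
  have h := hasFDerivAt_affine _ (chartIdx_mkT_ne_zero hz)
  refine (h.congr_of_eventuallyEq ?_).hasFDerivWithinAt
  filter_upwards [isOpen_ne.mem_nhds hz] with w hw
  change CP.affineFun (chartIdx (mkT z)) (mkT w) = _
  rw [mkT_of_ne_zero hw]
  rfl

/-- The coordinates of `p` in the affine chart at `p`. -/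
def chartPt (p : CP m) : Cn m := chartAt (Cn m) p p

/-- The pull-back of the Fubini-Study form by a linear map to a tangent space of `CPᵐ`. -/
def pullFS {E : Type*} [NormedAddCommGroup E] [NormedSpace ℝ E] (w : Cn m) (T : E →L[ℝ] Cn m) :
    E →L[ℝ] E →L[ℝ] ℝ := (fubiniStudy w).bilinearComp T T

@[simp] theorem pullFS_apply {E : Type*} [NormedAddCommGroup E] [NormedSpace ℝ E] (w : Cn m)
    (T : E →L[ℝ] Cn m) (u v : E) : pullFS w T u v = fubiniStudy w (T u) (T v) := rfl

theorem isPullbackForm_pullFS {E : Type*} [NormedAddCommGroup E] [NormedSpace ℝ E] (w : Cn m)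
    (T : E →L[ℝ] Cn m) : IsPullbackForm (pullFS w T) T :=
  ⟨fun _ _ => fubiniStudy_skew _ _ _, fun v u h => by simp [h]⟩

end Projection

/-! ## Tameness at the base points -/

section BasePoint

variable {m : ℕ}

/-- In complex dimension one the orientation fixes the sign. In the basis `v`, `A` becomes a
real-linear map `L` of `ℂ` with `L c = i L 1`, whence `Im c · det L = |L 1|²`. -/
theorem cn_one_pos {J : Cn 1 →L[ℝ] Cn 1} (hJ : IsPosComplexStructure J) {v : Cn 1} (hv : v ≠ 0)
    {c : ℂ} (hc : J v = c • v) : 0 ≤ c.im := by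
  obtain ⟨-, A, hA, hAJ⟩ := hJ
  have hinj : Function.Injective (LinearMap.toSpanSingleton ℂ (Cn 1) v) := by
    intro a b hab
    exact smul_left_injective ℂ hv hab
  let e₀ : ℂ ≃ₗ[ℂ] Cn 1 := LinearEquiv.ofInjectiveOfFinrankEq _ hinj (by simp)
  let e : ℂ ≃ₗ[ℝ] Cn 1 := e₀.restrictScalars ℝ
  have he : ∀ z, e z = z • v := fun z => rfl
  have hes : ∀ (z : ℂ) (u : Cn 1), e.symm (z • u) = z * e.symm u := fun z u =>
    e₀.symm.map_smul z u
  set L : ℂ →ₗ[ℝ] ℂ := e.symm.toLinearMap ∘ₗ (A : Cn 1 →L[ℝ] Cn 1).toLinearMap ∘ₗ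
    e.symm.symm.toLinearMap with hL
  have hdet : 0 < LinearMap.det L := by
    rw [hL, LinearMap.det_conj]
    exact hA
  have hLapp : ∀ z, L z = e.symm (A (z • v)) := fun z => rfl
  have h1 : L c = Complex.I * L 1 := by
    rw [hLapp, hLapp, ← hc, hAJ, hes, one_smul]
  have h2 : L c = c.re • L 1 + c.im • L Complex.I := by
    rw [← map_smul, ← map_smul, ← map_add]
    congr 1
    apply Complex.ext <;> simp
  rw [h1] at h2
  have hre := congrArg Complex.re h2
  have him := congrArg Complex.im h2
  simp at hre him
  rw [← LinearMap.det_toMatrix Complex.basisOneI, Matrix.det_fin_two] at hdet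
  simp [LinearMap.toMatrix_apply] at hdet
  have h3 : c.im * ((L 1).re * (L Complex.I).im - (L Complex.I).re * (L 1).im) =
      (L 1).re ^ 2 + (L 1).im ^ 2 := by
    linear_combination (L 1).im * hre - (L 1).re * him
  by_contra! hneg
  have h4 := mul_neg_of_neg_of_pos hneg (sub_pos.2 hdet)
  rw [h3] at h4
  exact absurd h4 (not_lt.2 (by positivity))

open Filter in
/-- If a continuous family of structures on the lines through the origin preserves the kernels of
the projection to `CPᵐ` and is tame on the quotients, then multiplication by `i` is tamed by any
form that tames the limiting structure. -/
theorem tame_I_of_limit {J : Cn (m + 1) →L[ℝ] Cn (m + 1)} (hJ : IsPosComplexStructure J)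
    {Ω : Cn (m + 1) →L[ℝ] Cn (m + 1) →L[ℝ] ℝ} (hΩ : ∀ v w, Ω v w = -Ω w v)
    (ht : ∀ v, v ≠ 0 → 0 < Ω v (J v))
    (hlim : ∀ u : Cn (m + 1), u ≠ 0 → ∃ K : ℝ → Cn (m + 1) →L[ℝ] Cn (m + 1),
      Tendsto K (𝓝[>] 0) (𝓝 J) ∧ ∀ᶠ t : ℝ in 𝓝[>] 0,
        (∀ v, dmk (chartIdx (mkT u)) u v = 0 → dmk (chartIdx (mkT u)) u (K t v) = 0) ∧
        ∀ v, dmk (chartIdx (mkT u)) u v ≠ 0 → 0 < fubiniStudy (chartPt (mkT u))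
          (dmk (chartIdx (mkT u)) u v) (dmk (chartIdx (mkT u)) u (K t v)))
    (v : Cn (m + 1)) (hv : v ≠ 0) : 0 < Ω v (Complex.I • v) := by
  have hself : Ω v v = 0 := by have := hΩ v v; linarith
  -- Along the ray through `v` itself the kernel is `ℂ v` for every `t`. The `K t` preserve it,
  -- hence so does their limit.
  obtain ⟨c, hc⟩ : ∃ c : ℂ, J v = c • v := by
    obtain ⟨K, hK, hev⟩ := hlim v hv
    rw [← dmk_eq_zero_iff (chartIdx_mkT_ne_zero hv)]
    have h1 : Tendsto (fun t => dmk (chartIdx (mkT v)) v (K t v)) (𝓝[>] 0)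
        (𝓝 (dmk (chartIdx (mkT v)) v (J v))) :=
      ((dmk (chartIdx (mkT v)) v).continuous.tendsto _).comp
        (((ContinuousLinearMap.apply ℝ (Cn (m + 1)) v).continuous.tendsto _).comp hK)
    refine tendsto_nhds_unique h1 (tendsto_const_nhds.congr' ?_)
    filter_upwards [hev] with t ht
    exact (ht.1 v ((dmk_eq_zero_iff (chartIdx_mkT_ne_zero hv) v).2 ⟨1, by simp⟩)).symm
  have hcv : ∀ w : Cn (m + 1), c • w = c.re • w + c.im • (Complex.I • w) := fun w => by
    rw [← Complex.coe_smul, ← Complex.coe_smul, smul_smul, ← add_smul, Complex.re_add_im]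
  have hpos := ht v hv
  rw [hc, hcv, map_add, map_smul, map_smul, hself, smul_zero, zero_add, smul_eq_mul] at hpos
  -- Now `0 < Ω(v, Jv) = Im c · Ω(v, iv)`, which already excludes `Im c = 0`. So the weak
  -- inequality, which is all that a limit can give, suffices.
  suffices h : 0 ≤ c.im by
    rcases h.eq_or_lt with h | h
    · rw [← h, zero_mul] at hpos
      exact absurd hpos (lt_irrefl _)
    · exact (mul_pos_iff_of_pos_left h).1 hpos
  rcases Nat.eq_zero_or_pos m with rfl | hm
  · exact cn_one_pos hJ hv hc
  -- Along a ray outside `ℂ v` the image `L v` is nonzero. The limit of the tameness inequalities is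
  -- `Im c · ω_std(L v, i L v) ≥ 0`.
  · obtain ⟨u, hu⟩ : ∃ u : Cn (m + 1), u ∉ Submodule.span ℂ {v} := by
      by_contra! h
      have h1 : Module.finrank ℂ (Cn (m + 1)) ≤ 1 := by
        refine finrank_le_one v fun w => ?_
        exact Submodule.mem_span_singleton.1 (h w)
      rw [finrank_euclideanSpace_fin] at h1
      omega
    have hu0 : u ≠ 0 := fun h => hu (h ▸ Submodule.zero_mem _)
    have hne : dmk (chartIdx (mkT u)) u v ≠ 0 := fun h => by
      obtain ⟨a, ha⟩ := (dmk_eq_zero_iff (chartIdx_mkT_ne_zero hu0) v).1 h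
      have ha0 : a ≠ 0 := by rintro rfl; simp at ha; exact hv ha
      refine hu (Submodule.mem_span_singleton.2 ⟨a⁻¹, ?_⟩)
      rw [ha, smul_smul, inv_mul_cancel₀ ha0, one_smul]
    obtain ⟨K, hK, hev⟩ := hlim u hu0
    set L := dmk (chartIdx (mkT u)) u
    have h1 : Tendsto (fun t => fubiniStudy (chartPt (mkT u)) (L v) (L (K t v))) (𝓝[>] 0)
        (𝓝 (fubiniStudy (chartPt (mkT u)) (L v) (L (J v)))) :=
      ((fubiniStudy (chartPt (mkT u)) (L v)).continuous.tendsto _).comp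
        ((L.continuous.tendsto _).comp
          (((ContinuousLinearMap.apply ℝ (Cn (m + 1)) v).continuous.tendsto _).comp hK))
    have h2 : 0 ≤ fubiniStudy (chartPt (mkT u)) (L v) (L (J v)) :=
      ge_of_tendsto h1 (hev.mono fun t ht => (ht.2 v hne).le)
    have h3 : L (J v) = c.re • L v + c.im • (Complex.I • L v) := by
      rw [hc, map_smul, ← Complex.coe_smul, ← Complex.coe_smul, smul_smul, ← add_smul,
        Complex.re_add_im]
    rw [h3, map_add, map_smul, map_smul, fubiniStudy_self, smul_zero, zero_add,
      smul_eq_mul] at h2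
    exact nonneg_of_mul_nonneg_left h2 (fubiniStudy_pos _ hne)

end BasePoint

/-! ## Complex structures induced by isomorphisms onto `ℂᵏ` -/

section ConjI

variable {k : ℕ}

/-- Multiplication by `i`. -/
def mulICLM (k : ℕ) : Cn k →L[ℝ] Cn k := (Complex.I • ContinuousLinearMap.id ℂ (Cn k)).restrictScalars ℝ

@[simp] theorem mulICLM_apply (v : Cn k) : mulICLM k v = Complex.I • v := rfl

/-- The pull-back of the standard complex structure of `ℂᵏ` by an isomorphism. -/
def conjI (A : Cn k →L[ℝ] Cn k) : Cn k →L[ℝ] Cn k := A.inverse * mulICLM k * A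

variable {A J : Cn k →L[ℝ] Cn k}

theorem inverse_mul_of_det (hA : A.det ≠ 0) : A.inverse * A = 1 := by
  have h := A.coe_toContinuousLinearEquivOfDetNeZero hA
  rw [← h, ContinuousLinearMap.inverse_equiv]
  exact ContinuousLinearEquiv.coe_symm_comp_coe _

theorem mul_inverse_of_det (hA : A.det ≠ 0) : A * A.inverse = 1 := by
  have h := A.coe_toContinuousLinearEquivOfDetNeZero hA
  rw [← h, ContinuousLinearMap.inverse_equiv]
  exact ContinuousLinearEquiv.coe_comp_coe_symm _

theorem inverse_apply_of_det (hA : A.det ≠ 0) (v : Cn k) : A.inverse (A v) = v :=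
  congrArg (fun L => L v) (inverse_mul_of_det hA)

theorem apply_inverse_of_det (hA : A.det ≠ 0) (v : Cn k) : A (A.inverse v) = v :=
  congrArg (fun L => L v) (mul_inverse_of_det hA)

theorem det_ne_zero_of_mul_eq_one {A' : Cn k →L[ℝ] Cn k} (h : A * A' = 1) : A.det ≠ 0 := by
  intro h0
  have h1 : LinearMap.det (A.toLinearMap ∘ₗ A'.toLinearMap) = 1 := by
    change ContinuousLinearMap.det (A * A') = 1
    rw [h]
    simp [ContinuousLinearMap.det]
  rw [LinearMap.det_comp] at h1
  change A.det * _ = 1 at h1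
  rw [h0, zero_mul] at h1
  exact zero_ne_one h1

theorem det_mul (A A' : Cn k →L[ℝ] Cn k) : (A * A').det = A.det * A'.det :=
  LinearMap.det_comp A.toLinearMap A'.toLinearMap

theorem map_conjI (hA : A.det ≠ 0) (v : Cn k) : A (conjI A v) = Complex.I • A v := by
  simp [conjI, apply_inverse_of_det hA]

theorem conjI_eq_of_map (hA : A.det ≠ 0) (h : ∀ v, A (J v) = Complex.I • A v) : J = conjI A := by
  ext1 v
  rw [← inverse_apply_of_det hA (J v), h, ← map_conjI hA, inverse_apply_of_det hA]

theorem conjI_conjI (hA : A.det ≠ 0) (v : Cn k) : conjI A (conjI A v) = -v := by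
  rw [← inverse_apply_of_det hA (conjI A (conjI A v)), map_conjI hA, map_conjI hA, smul_smul,
    Complex.I_mul_I, neg_smul, one_smul, map_neg, inverse_apply_of_det hA]

/-- A complex-linear change of coordinates commutes with `i`. In particular a unitary change does
not affect the induced structure. -/
theorem conjI_complex_mul (g : Cn k →L[ℂ] Cn k) (hg : (g.restrictScalars ℝ).det ≠ 0)
    (hA : A.det ≠ 0) : conjI (g.restrictScalars ℝ * A) = conjI A := by
  have h : (g.restrictScalars ℝ * A).det ≠ 0 := by rw [det_mul]; exact mul_ne_zero hg hA
  refine (conjI_eq_of_map h fun v => ?_).symm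
  change g (A _) = Complex.I • g (A v)
  rw [map_conjI hA, map_smul]

theorem conjI_mul {P P' : Cn k →L[ℝ] Cn k} (hA : A.det ≠ 0) (h : P * P' = 1) :
    conjI (A * P') = P * conjI A * P' := by
  have hP' : P' * P = 1 := by
    have h0 := inverse_mul_of_det (det_ne_zero_of_mul_eq_one h)
    rwa [left_inv_eq_right_inv h0 h] at h0
  have hd : (A * P').det ≠ 0 := by
    rw [det_mul]; exact mul_ne_zero hA (det_ne_zero_of_mul_eq_one hP')
  refine (conjI_eq_of_map hd fun v => ?_).symm
  have h1 : ∀ v, P' (P v) = v := fun v => congrArg (fun L => L v) hP'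
  change A (P' (P (conjI A (P' v)))) = Complex.I • A (P' v)
  rw [h1, map_conjI hA]

theorem IsPosComplexStructure.conj (hJ : IsPosComplexStructure J) (hA : 0 < A.det) :
    IsPosComplexStructure (A * J * A.inverse) := by
  obtain ⟨hsq, C, hC, hCJ⟩ := hJ
  have h1 := inverse_apply_of_det hA.ne'
  have h2 := apply_inverse_of_det hA.ne'
  set e := A.toContinuousLinearEquivOfDetNeZero hA.ne' with he
  have hes : ∀ v, e.symm v = A.inverse v := fun v => by
    rw [e.symm_apply_eq]
    exact (h2 v).symm
  refine ⟨fun v => ?_, e.symm.trans C, ?_, fun v => ?_⟩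
  · simp [h1, h2, hsq]
  · have h3 : (((e.symm.trans C : Cn k ≃L[ℝ] Cn k) : Cn k →L[ℝ] Cn k) * A).det =
        (C : Cn k →L[ℝ] Cn k).det := by
      congr 1
      ext1 v
      change C (e.symm (A v)) = C v
      rw [hes, h1]
    rw [det_mul] at h3
    exact (mul_pos_iff_of_pos_right hA).1 (h3 ▸ hC)
  · change C (e.symm (A (J (A.inverse v)))) = Complex.I • C (e.symm v)
    rw [hes, hes, h1, hCJ]

theorem continuousAt_inverse {Z : Type*} [TopologicalSpace Z] {H : Z → Cn k →L[ℝ] Cn k} {z : Z}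
    (h : ContinuousAt H z) (hd : (H z).det ≠ 0) : ContinuousAt (fun x => (H x).inverse) z := by
  have h1 : IsUnit (H z) := ⟨⟨H z, (H z).inverse, mul_inverse_of_det hd, inverse_mul_of_det hd⟩, rfl⟩
  obtain ⟨u, hu⟩ := h1
  have h2 := NormedRing.inverse_continuousAt u
  rw [hu] at h2
  have h3 : ∀ L : Cn k →L[ℝ] Cn k, L.inverse = Ring.inverse L := fun L =>
    (congrFun ContinuousLinearMap.ringInverse_eq_inverse L).symm
  simp_rw [h3]
  exact h2.comp (f := H) h

/-- The real determinant of a complex-linear map is the squared modulus of its complex determinant.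
-/
theorem det_unitary_pos (g : UnitaryGp k) :
    0 < (((g : Cn k →L[ℂ] Cn k).restrictScalars ℝ).det) := by
  have h1 : (((g : Cn k →L[ℂ] Cn k).restrictScalars ℝ).det) =
      Complex.normSq (LinearMap.det (g : Cn k →L[ℂ] Cn k).toLinearMap) := by
    rw [← Algebra.norm_complex_apply, ← LinearMap.det_restrictScalars]
    rfl
  rw [h1]
  refine Complex.normSq_pos.2 fun h0 => ?_
  have := LinearMap.bot_lt_ker_of_det_eq_zero h0
  rw [LinearMap.ker_eq_bot.2 (unitaryAct_injective g)] at this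
  exact this.false

end ConjI

/-! ## Structures near the base locus -/

section NearBase

variable {m : ℕ} {Z ι : Type*} [TopologicalSpace Z]

/-- Where `T` is complex linear for `J`, compatibility is inherited from the positivity and
`i`-invariance of the Fubini–Study form. -/
theorem isAdmissible_of_map_I {E : Type*} [NormedAddCommGroup E] [NormedSpace ℝ E]
    {Ω : E →L[ℝ] E →L[ℝ] ℝ} {w : Cn m} {T : E →L[ℝ] Cn m} {c : Prop} {J : E →L[ℝ] E}
    (hJ : ∀ v, J (J v) = -v) (ht : ∀ v, v ≠ 0 → 0 < Ω v (J v))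
    (hT : c → ∀ v, T (J v) = Complex.I • T v) : IsAdmissible Ω (pullFS w T) T c J where
  sq := hJ
  tame := ht
  pos hc v hv := by
    rw [pullFS_apply, hT hc]
    exact fubiniStudy_pos w hv
  invariant hc v u := by
    rw [pullFS_apply, hT hc, hT hc, fubiniStudy_I, pullFS_apply]

/-- Tameness is an open condition. -/
theorem FrameSystem.ContAt.eventually_tame {E : Type*} [NormedAddCommGroup E] [NormedSpace ℝ E]
    [FiniteDimensional ℝ E] {Φ : FrameSystem Z E ι} {i : ι} {J : Z → E →L[ℝ] E}
    {Ω : Z → E →L[ℝ] E →L[ℝ] ℝ} (hJ : Φ.ContAt J i)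
    (hΩ : ∀ u v, ContinuousAt (fun x => Ω x (Φ.vec i x u) (Φ.vec i x v)) (Φ.pt i))
    (ht : ∀ v, v ≠ 0 → 0 < Ω (Φ.pt i) v (J (Φ.pt i) v)) :
    ∀ᶠ x in 𝓝 (Φ.pt i), ∀ v, v ≠ 0 → 0 < Ω x v (J x v) := by
  set Q : Z → E →L[ℝ] E →L[ℝ] ℝ := fun x => (Ω x).bilinearComp (Φ.vec i x) (Φ.vec i x) with hQ
  have hQc : ContinuousAt Q (Φ.pt i) := by
    rw [continuousAt_clm_apply]
    intro u
    rw [continuousAt_clm_apply]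
    exact hΩ u
  set K : Z → E →L[ℝ] E := fun x => Φ.coord i x * J x * Φ.vec i x with hK
  have hKc : ContinuousAt K (Φ.pt i) := hJ
  have hinv : ∀ x, Φ.vec i x * Φ.coord i x = 1 → ∀ v, Φ.vec i x (Φ.coord i x v) = v :=
    fun x hx v => congrArg (fun L => L v) hx
  have hinv' : ∀ x, Φ.coord i x * Φ.vec i x = 1 → ∀ v, Φ.coord i x (Φ.vec i x v) = v :=
    fun x hx v => congrArg (fun L => L v) hx
  have hval : ∀ x, Φ.vec i x * Φ.coord i x = 1 → ∀ u,
      Q x u (K x u) = Ω x (Φ.vec i x u) (J x (Φ.vec i x u)) := by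
    intro x hx u
    simp [hQ, hK, hinv x hx]
  have hq : ∀ u, ContinuousAt (fun p : Z × E => Q p.1 p.2 (K p.1 p.2)) (Φ.pt i, u) := by
    intro u
    have h1 : ContinuousAt (fun p : Z × E => Q p.1) (Φ.pt i, u) :=
      ContinuousAt.comp (x := (Φ.pt i, u)) (g := Q) (f := Prod.fst) hQc
        continuousAt_fst
    have h2 : ContinuousAt (fun p : Z × E => K p.1) (Φ.pt i, u) :=
      ContinuousAt.comp (x := (Φ.pt i, u)) (g := K) (f := Prod.fst) hKc
        continuousAt_fst
    exact (h1.clm_apply continuousAt_snd).clm_apply (h2.clm_apply continuousAt_snd)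
  -- Compactness of the unit sphere makes the neighborhood independent of `u`; homogeneity then
  -- covers all nonzero vectors.
  have hsphere : ∀ᶠ x in 𝓝 (Φ.pt i), ∀ u ∈ Metric.sphere (0 : E) 1, 0 < Q x u (K x u) := by
    refine (isCompact_sphere (0 : E) 1).eventually_forall_of_forall_eventually fun u hu => ?_
    refine (hq u).eventually (lt_mem_nhds ?_)
    have hb := (Φ.vec_coord i).self_of_nhds
    have hu0 : u ≠ 0 := by rintro rfl; simp at hu
    simp only [hval _ hb]
    refine ht _ fun h => hu0 ?_
    rw [← hinv' _ (Φ.coord_vec i).self_of_nhds u, h, map_zero]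
  filter_upwards [hsphere, Φ.vec_coord i] with x h1 h2 v hv
  have hu0 : Φ.coord i x v ≠ 0 := fun h => hv (by rw [← hinv x h2 v, h, map_zero])
  set u := Φ.coord i x v with hu
  have hn : 0 < ‖u‖ := norm_pos_iff.2 hu0
  have h3 := h1 (‖u‖⁻¹ • u) (by simp [norm_smul, hn.ne'])
  simp only [map_smul, smul_apply, smul_eq_mul] at h3
  rw [hval x h2, hu, hinv x h2] at h3
  have h4 : 0 < ‖u‖⁻¹ := inv_pos.2 hn
  exact (mul_pos_iff_of_pos_left h4).1 ((mul_pos_iff_of_pos_left h4).1 h3)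

variable {Φ : FrameSystem Z (Cn (m + 1)) ι} {i : ι} {H J : Z → Cn (m + 1) →L[ℝ] Cn (m + 1)}

/-- Written in the frame, the structure is `conjI` of `H x * vec x`, continuous because inversion
is. -/
theorem contAt_conjI (hH : ContinuousAt (fun x => H x * Φ.vec i x) (Φ.pt i))
    (hdet : ∀ᶠ x in 𝓝 (Φ.pt i), (H x).det ≠ 0) : Φ.ContAt (fun x => conjI (H x)) i := by
  have hd : (H (Φ.pt i) * Φ.vec i (Φ.pt i)).det ≠ 0 := by
    rw [det_mul]
    exact mul_ne_zero hdet.self_of_nhds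
      (det_ne_zero_of_mul_eq_one (Φ.vec_coord i).self_of_nhds)
  have h1 : ContinuousAt (fun x => conjI (H x * Φ.vec i x)) (Φ.pt i) :=
    ((continuousAt_inverse hH hd).mul continuousAt_const).mul hH
  refine h1.congr ?_
  filter_upwards [hdet, Φ.coord_vec i] with x h2 h3
  exact conjI_mul h2 h3

open Filter in
/-- At a base point, the complex structure of a chart in which the map is projectivization is
tamed by any form taming a compatible structure. -/
theorem tame_conjI_at_base {Ω : Z → Cn (m + 1) →L[ℝ] Cn (m + 1) →L[ℝ] ℝ} {w : Z → Cn m}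
    {T : Z → Cn (m + 1) →L[ℝ] Cn m} {c : Z → Prop} (hΩ : ∀ x v u, Ω x v u = -Ω x u v)
    (hJ : Φ.ContAt J i) (hJpos : IsPosComplexStructure (J (Φ.pt i)))
    (hJadm : ∀ᶠ x in 𝓝 (Φ.pt i), IsAdmissible (Ω x) (pullFS (w x) (T x)) (T x) (c x) (J x))
    (hH : ContinuousAt (fun x => H x * Φ.vec i x) (Φ.pt i))
    (hdet : ∀ᶠ x in 𝓝 (Φ.pt i), (H x).det ≠ 0) (hpos : 0 < (H (Φ.pt i)).det)
    (hγ : ∀ u : Cn (m + 1), u ≠ 0 → ∃ γ : ℝ → Z, Tendsto γ (𝓝[>] 0) (𝓝 (Φ.pt i)) ∧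
      ∀ᶠ t : ℝ in 𝓝[>] 0, c (γ t) ∧ w (γ t) = chartPt (mkT u) ∧
        ∀ v, T (γ t) v = dmk (chartIdx (mkT u)) ((t : ℂ) • u) (H (γ t) v))
    (v : Cn (m + 1)) (hv : v ≠ 0) : 0 < Ω (Φ.pt i) v (conjI (H (Φ.pt i)) v) := by
  set b := Φ.pt i
  set A := H b
  have hA := hpos.ne'
  set Ω' : Cn (m + 1) →L[ℝ] Cn (m + 1) →L[ℝ] ℝ := (Ω b).bilinearComp A.inverse A.inverse with hΩ'
  have hinj : ∀ v, v ≠ 0 → A.inverse v ≠ 0 := fun v hv h => hv (by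
    rw [← apply_inverse_of_det hA v, h, map_zero])
  have key := tame_I_of_limit (J := A * J b * A.inverse) (hJpos.conj hpos) (Ω := Ω')
    (fun v u => hΩ b _ _) (fun v hv => by
      have := hJadm.self_of_nhds.tame _ (hinj v hv)
      simpa [hΩ', inverse_apply_of_det hA] using this) (fun u hu => ?_) (A v) (fun h => hv (by
      rw [← inverse_apply_of_det hA v, h, map_zero]))
  · rw [← map_conjI hA] at key
    simpa [hΩ', inverse_apply_of_det hA] using key
  · obtain ⟨γ, hγb, hev⟩ := hγ u hu
    -- The limiting argument takes place in the coordinates `H`, so `J` along the ray is conjugated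
    -- by `H`.
    refine ⟨fun t => H (γ t) * J (γ t) * (H (γ t)).inverse, ?_, ?_⟩
    · have hd : (H b * Φ.vec i b).det ≠ 0 := by
        rw [det_mul]
        exact mul_ne_zero hA (det_ne_zero_of_mul_eq_one (Φ.vec_coord i).self_of_nhds)
      -- Only the expressions of `H` and `J` in the frame are known to be continuous; the frame
      -- factors cancel in the product.
      have h1 : ContinuousAt (fun x => (H x * Φ.vec i x) * (Φ.coord i x * J x * Φ.vec i x) *
          (H x * Φ.vec i x).inverse) b := (hH.mul hJ).mul (continuousAt_inverse hH hd)
      have h2 : ∀ᶠ x in 𝓝 b, (H x * Φ.vec i x) * (Φ.coord i x * J x * Φ.vec i x) *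
          (H x * Φ.vec i x).inverse = H x * J x * (H x).inverse := by
        filter_upwards [hdet, Φ.coord_vec i, Φ.vec_coord i] with x h2 h3 h4
        have h5 : (H x * Φ.vec i x).inverse = Φ.coord i x * (H x).inverse := by
          have hd' : (H x * Φ.vec i x).det ≠ 0 := by
            rw [det_mul]; exact mul_ne_zero h2 (det_ne_zero_of_mul_eq_one h4)
          refine left_inv_eq_right_inv (inverse_mul_of_det hd') ?_
          rw [mul_assoc, ← mul_assoc _ (Φ.coord i x), h4, one_mul, mul_inverse_of_det h2]
        rw [h5]
        calc H x * Φ.vec i x * (Φ.coord i x * J x * Φ.vec i x) * (Φ.coord i x * (H x).inverse)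
            = H x * (Φ.vec i x * Φ.coord i x) * J x * (Φ.vec i x * Φ.coord i x) *
                (H x).inverse := by simp only [mul_assoc]
          _ = H x * J x * (H x).inverse := by rw [h4, mul_one, mul_one]
      have h6 : Tendsto (fun x => H x * J x * (H x).inverse) (𝓝 b)
          (𝓝 (H b * J b * (H b).inverse)) := by
        have := h1.tendsto.congr' h2
        rwa [h2.self_of_nhds] at this
      exact h6.comp hγb
    · filter_upwards [hev, hγb.eventually hJadm, hγb.eventually hdet, self_mem_nhdsWithin] with t
        h1 h2 h3 (h4 : 0 < t)
      obtain ⟨hc, hw, hT⟩ := h1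
      have ht : (t : ℂ) ≠ 0 := by exact_mod_cast h4.ne'
      -- Homogeneity of degree `-1` trades the derivative at `tu` for the one at `u`; the positive
      -- factor `t` affects neither kernels nor signs.
      have hT' : ∀ v, dmk (chartIdx (mkT u)) u v = t • T (γ t) ((H (γ t)).inverse v) := by
        intro v
        rw [hT, apply_inverse_of_det h3, dmk_smul _ _ ht, ← Complex.coe_smul, smul_smul,
          mul_inv_cancel₀ ht, one_smul]
      have hKv : ∀ v, dmk (chartIdx (mkT u)) u ((H (γ t) * J (γ t) * (H (γ t)).inverse) v) =
          t • T (γ t) (J (γ t) ((H (γ t)).inverse v)) := fun v => by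
        rw [hT']
        simp [inverse_apply_of_det h3]
      refine ⟨fun v hv => ?_, fun v hv => ?_⟩
      · rw [hKv, h2.map_ker (isPullbackForm_pullFS _ _) hc, smul_zero]
        rw [hT'] at hv
        exact (smul_eq_zero.1 hv).resolve_left h4.ne'
      · rw [hT'] at hv
        have hv' := (smul_ne_zero_iff.1 hv).2
        have := h2.pos hc _ hv'
        rw [pullFS_apply, hw] at this
        rw [hKv, hT', map_smul, map_smul, smul_apply]
        simp only [smul_eq_mul]
        positivity

theorem mfderiv_eq_dmk {X : Type*} [TopologicalSpace X] [ChartedSpace (Cn (m + 1)) X]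
    {f : X → CP m} {φ : X → Cn (m + 1)} {x : X}
    (hφ : MDifferentiableAt 𝓘(ℝ, Cn (m + 1)) 𝓘(ℝ, Cn (m + 1)) φ x) (hz : φ x ≠ 0)
    (hf : f =ᶠ[𝓝 x] fun y => mkT (φ y)) (v : TangentSpace 𝓘(ℝ, Cn (m + 1)) x) :
    D (m + 1) m f x v = dmk (chartIdx (mkT (φ x))) (φ x) (D (m + 1) (m + 1) φ x v) := by
  have h := ((hasMFDerivAt_mkT hz).comp x hφ.hasMFDerivAt).congr_of_eventuallyEq hf
  exact congrArg (fun L : Cn (m + 1) →L[ℝ] Cn m => L v) h.mfderiv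

end NearBase

/-! ## Hyperpencils -/

section TangentFrames

variable {k : ℕ} {X : Type*} [TopologicalSpace X] [ChartedSpace (Cn k) X]
  [IsManifold 𝓘(ℝ, Cn k) ∞ X]

/-- The trivialization of the tangent bundle at `x₀`. -/
abbrev tanTriv (k : ℕ) {X : Type*} [TopologicalSpace X] [ChartedSpace (Cn k) X]
    [IsManifold 𝓘(ℝ, Cn k) ∞ X] (x₀ : X) : Trivialization (Cn k) (π (Cn k) (TangentSpace 𝓘(ℝ, Cn k) : X → Type _)) :=
  trivializationAt (Cn k) (TangentSpace 𝓘(ℝ, Cn k)) x₀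

theorem tanTriv_eventually (k : ℕ) {X : Type*} [TopologicalSpace X] [ChartedSpace (Cn k) X]
    [IsManifold 𝓘(ℝ, Cn k) ∞ X] (x₀ : X) : ∀ᶠ x in 𝓝 x₀, x ∈ (tanTriv k x₀).baseSet :=
  (tanTriv k x₀).open_baseSet.mem_nhds (FiberBundle.mem_baseSet_trivializationAt' x₀)

variable (k X) in
/-- The frames of the tangent bundle given by its trivializations. -/
def tangentFrames : FrameSystem X (Cn k) X where
  pt := id
  coord x₀ x := (tanTriv k x₀).continuousLinearMapAt ℝ x
  vec x₀ x := (tanTriv k x₀).symmL ℝ x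
  coord_vec x₀ := by
    filter_upwards [tanTriv_eventually k x₀] with x hx
    exact ContinuousLinearMap.ext fun v =>
      (tanTriv k x₀).continuousLinearMapAt_symmL hx v
  vec_coord x₀ := by
    filter_upwards [tanTriv_eventually k x₀] with x hx
    exact ContinuousLinearMap.ext fun v =>
      (tanTriv k x₀).symmL_continuousLinearMapAt hx v

theorem contAt_tangentFrames_iff (J : EndField k X) (x₀ : X) :
    (tangentFrames k X).ContAt J x₀ ↔
      ContinuousAt (fun x => (TotalSpace.mk' (Cn k →L[ℝ] Cn k) x (J x) :
        TotalSpace (Cn k →L[ℝ] Cn k)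
          (fun x : X => TangentSpace 𝓘(ℝ, Cn k) x →L[ℝ] TangentSpace 𝓘(ℝ, Cn k) x))) x₀ := by
  rw [continuousAt_hom_bundle (RingHom.id ℝ)]
  exact ⟨fun h => ⟨continuousAt_id, h⟩, fun h => h.2⟩

theorem IsContinuousTwoForm.continuousAt_frames {Ω : BilinField k X} (hΩ : IsContinuousTwoForm Ω)
    (x₀ : X) (u v : Cn k) : ContinuousAt (fun x => (Ω x : Cn k →L[ℝ] Cn k →L[ℝ] ℝ)
      ((tangentFrames k X).vec x₀ x u) ((tangentFrames k X).vec x₀ x v)) x₀ := by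
  -- Sections with constant coefficients in the trivialization at `x₀` are continuous there;
  -- evaluating `Ω` on them gives its matrix entries.
  have hsec : ∀ u : Cn k, ContinuousAt (fun x => (TotalSpace.mk' (Cn k) x
      ((tanTriv k x₀).symmL ℝ x u) : TotalSpace (Cn k) (TangentSpace 𝓘(ℝ, Cn k) : X → Type _))) x₀ := by
    intro u
    rw [FiberBundle.continuousAt_totalSpace]
    refine ⟨continuousAt_id, (continuousAt_const (y := u)).congr ?_⟩
    filter_upwards [tanTriv_eventually k x₀] with x hx
    exact ((tanTriv k x₀).continuousLinearMapAt_symmL (R := ℝ) hx u).symm.trans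
      ((tanTriv k x₀).continuousLinearMapAt_apply (R := ℝ) _ ▸ by
        exact congrFun ((tanTriv k x₀).coe_linearMapAt_of_mem (R := ℝ) hx) _)
  have h := (hΩ.continuous.continuousAt (x := x₀)).clm_bundle_apply₂
    (E₃ := Bundle.Trivial X ℝ) (hsec u) (hsec v)
  rw [FiberBundle.continuousAt_totalSpace] at h
  exact h.2

/-- The derivative of `φ : X → ℂᵏ`, on the model of the tangent spaces. -/
def dCoord (φ : X → Cn k) (x : X) : Cn k →L[ℝ] Cn k := D k k φ x

theorem continuousAt_dCoord_frames {φ : X → Cn k} {x₀ : X}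
    (hφ : ContMDiffAt 𝓘(ℝ, Cn k) 𝓘(ℝ, Cn k) ∞ φ x₀) :
    ContinuousAt (fun x => dCoord φ x * (tangentFrames k X).vec x₀ x) x₀ := by
  have h := (hφ.mfderiv_const (m := 0) (by simp)).continuousAt
  refine h.congr (.of_forall fun x => ?_)
  refine ContinuousLinearMap.ext fun v => ?_
  simp only [inTangentCoordinates, ContinuousLinearMap.inCoordinates]
  rw [TangentBundle.continuousLinearMapAt_model_space]
  rfl

end TangentFrames

/-! ### From taming structures on a manifold to pointwise admissibility -/

section Admissible

theorem skew_of_alternating {E : Type*} [NormedAddCommGroup E] [NormedSpace ℝ E]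
    {Ω : E →L[ℝ] E →L[ℝ] ℝ} (h : ∀ v, Ω v v = 0) (v w : E) : Ω v w = -Ω w v := by
  have h1 := h (v + w)
  simp only [map_add, add_apply, h] at h1
  linarith

variable {m : ℕ} {X : Type*} [TopologicalSpace X] [ChartedSpace (Cn (m + 1)) X]
  [IsManifold 𝓘(ℝ, Cn (m + 1)) ∞ X] {Ω : BilinField (m + 1) X} {B : Set X} {f : X → CP m}

/-- The derivative of `f`, on the model of the tangent spaces. -/
def dMap (f : X → CP m) (x : X) : Cn (m + 1) →L[ℝ] Cn m := D (m + 1) m f x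

theorem IsContinuousTwoForm.skew (hΩ : IsContinuousTwoForm Ω) (x : X) (v w : Cn (m + 1)) :
    (Ω x : Cn (m + 1) →L[ℝ] Cn (m + 1) →L[ℝ] ℝ) v w = -Ω x w v :=
  skew_of_alternating (Ω := (Ω x : Cn (m + 1) →L[ℝ] Cn (m + 1) →L[ℝ] ℝ)) (hΩ.alternating x) v w

theorem IsTamingACSOn.isAdmissible {J : EndField (m + 1) X} {W : Set X}
    (h : IsTamingACSOn Ω B f J W) {x : X} (hx : x ∈ W) :
    IsAdmissible (E := Cn (m + 1)) (Ω x) (pullFS (chartPt (f x)) (dMap f x)) (dMap f x) (x ∉ B)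
      (J x) where
  sq := (h.acs.complex x hx).1
  tame := h.tame x hx
  pos hc := (h.compatible x ⟨hx, hc⟩).1
  invariant hc := (h.compatible x ⟨hx, hc⟩).2

theorem isTamingACSOn_univ {J : EndField (m + 1) X}
    (h : ∀ x, IsAdmissible (E := Cn (m + 1)) (Ω x) (pullFS (chartPt (f x)) (dMap f x)) (dMap f x)
      (x ∉ B) (J x))
    (hpos : ∀ x, IsPosComplexStructure (n := m + 1) (J x))
    (hc : ∀ x, (tangentFrames (m + 1) X).ContAt J x) : IsTamingACSOn Ω B f J univ where
  acs := ⟨fun x _ => hpos x,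
    fun x _ => ((contAt_tangentFrames_iff J x).1 (hc x)).continuousWithinAt⟩
  tame x _ := (h x).tame
  compatible x hx := ⟨(h x).pos hx.2, (h x).invariant hx.2⟩

end Admissible

/-! ### Complex structures of standard charts -/

section StandardCharts

variable {m : ℕ} {X : Type*} [TopologicalSpace X] [ChartedSpace (Cn (m + 1)) X]
  [IsManifold 𝓘(ℝ, Cn (m + 1)) ∞ X] {Ω : BilinField (m + 1) X} {B : Set X} {f : X → CP m}
  {b : X} {φ : OpenPartialHomeomorph X (Cn (m + 1))}

theorem IsStandardChart.contMDiffAt (h : IsStandardChart B f b φ) {x : X} (hx : x ∈ φ.source) :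
    ContMDiffAt 𝓘(ℝ, Cn (m + 1)) 𝓘(ℝ, Cn (m + 1)) ∞ φ x :=
  contMDiffAt_of_mem_maximalAtlas h.mem_atlas hx

theorem IsStandardChart.det_pos (h : IsStandardChart B f b φ) {x : X} (hx : x ∈ φ.source) :
    0 < (dCoord φ x).det := h.oriented x hx

theorem IsStandardChart.eq_mkT (h : IsStandardChart B f b φ) {x : X} (hx : x ∈ φ.source)
    (hxb : x ≠ b) : φ x ≠ 0 ∧ f x = mkT (φ x) := by
  obtain ⟨-, h0, hf⟩ := h.eq_mk x hx hxb
  exact ⟨h0, by rw [hf, mkT_of_ne_zero h0]⟩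

theorem IsStandardChart.dMap_eq [T1Space X] (h : IsStandardChart B f b φ) {x : X}
    (hx : x ∈ φ.source) (hxb : x ≠ b) (v : Cn (m + 1)) :
    dMap f x v = dmk (chartIdx (mkT (φ x))) (φ x) (dCoord φ x v) := by
  refine mfderiv_eq_dmk ((h.contMDiffAt hx).mdifferentiableAt (by simp)) (h.eq_mkT hx hxb).1 ?_ v
  filter_upwards [φ.open_source.mem_nhds hx, isOpen_ne.mem_nhds hxb] with y hy hyb
  exact (h.eq_mkT hy hyb).2

/-- In a standard chart `f` is the holomorphic projection, whose derivative is complex linear. -/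
theorem IsStandardChart.dMap_conjI [T1Space X] (h : IsStandardChart B f b φ) {x : X}
    (hx : x ∈ φ.source) (hxb : x ≠ b) (v : Cn (m + 1)) :
    dMap f x (conjI (dCoord φ x) v) = Complex.I • dMap f x v := by
  rw [h.dMap_eq hx hxb, h.dMap_eq hx hxb, map_conjI (h.det_pos hx).ne', map_smul]

open Filter in
-- The path is the radial segment `t ↦ φ⁻¹(tu)`, which is meaningful for small `t` because the
-- target of `φ` contains a neighborhood of `0`.
theorem IsStandardChart.exists_path (h : IsStandardChart B f b φ) {u : Cn (m + 1)} (hu : u ≠ 0) :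
    ∃ γ : ℝ → X, Tendsto γ (𝓝[>] 0) (𝓝 b) ∧ ∀ᶠ t : ℝ in 𝓝[>] 0, γ t ∈ φ.source ∧ γ t ≠ b ∧
      φ (γ t) = (t : ℂ) • u := by
  have h0 : φ.symm 0 = b := by rw [← h.map_base, φ.left_inv h.mem_source]
  have h0t : (0 : Cn (m + 1)) ∈ φ.target := h.map_base ▸ φ.map_source h.mem_source
  have hu0 : Tendsto (fun t : ℝ => (t : ℂ) • u) (𝓝[>] 0) (𝓝 0) := by
    have : Continuous fun t : ℝ => (t : ℂ) • u := by fun_prop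
    simpa using (this.tendsto 0).mono_left nhdsWithin_le_nhds
  refine ⟨fun t => φ.symm ((t : ℂ) • u), ?_, ?_⟩
  · have := (φ.continuousAt_symm h0t).tendsto
    rw [h0] at this
    exact this.comp hu0
  · filter_upwards [hu0.eventually (φ.open_target.mem_nhds h0t), self_mem_nhdsWithin] with t ht
      (htpos : 0 < t)
    refine ⟨φ.map_target ht, fun hb => ?_, φ.right_inv ht⟩
    have h1 := φ.right_inv ht
    rw [hb, h.map_base, eq_comm, smul_eq_zero] at h1
    exact h1.elim (by exact_mod_cast htpos.ne') hu

theorem IsStandardChart.contAt_conjI (h : IsStandardChart B f b φ) {x : X} (hx : x ∈ φ.source) :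
    (tangentFrames (m + 1) X).ContAt (fun y => conjI (dCoord φ y)) x := by
  refine Hyperpencils.contAt_conjI (continuousAt_dCoord_frames (h.contMDiffAt hx)) ?_
  filter_upwards [φ.open_source.mem_nhds hx] with y hy
  exact (h.det_pos hy).ne'

/-- The complex structure induced by a standard chart is tame near the base point. -/
theorem IsStandardChart.eventually_tame [T1Space X] (h : IsStandardChart B f b φ)
    (hΩ : IsContinuousTwoForm Ω) {J : EndField (m + 1) X} {W : Set X} (hW : IsOpen W)
    (hb : b ∈ W) (hJ : IsTamingACSOn Ω B f J W) :
    ∀ᶠ x in 𝓝 b, ∀ v : Cn (m + 1), v ≠ 0 →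
      0 < (Ω x : Cn (m + 1) →L[ℝ] Cn (m + 1) →L[ℝ] ℝ) v (conjI (dCoord φ x) v) := by
  refine (h.contAt_conjI h.mem_source).eventually_tame (i := b)
    (Ω := fun x => (Ω x : Cn (m + 1) →L[ℝ] Cn (m + 1) →L[ℝ] ℝ))
    (hΩ.continuousAt_frames b) ?_
  have hcont : (tangentFrames (m + 1) X).ContAt J b :=
    (contAt_tangentFrames_iff J b).2 (hJ.acs.continuousOn.continuousAt (hW.mem_nhds hb))
  refine tame_conjI_at_base (Φ := tangentFrames (m + 1) X) (i := b) (H := dCoord φ)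
    (Ω := fun x => (Ω x : Cn (m + 1) →L[ℝ] Cn (m + 1) →L[ℝ] ℝ))
    (w := fun x => chartPt (f x)) (T := dMap f) (c := fun x => x ∉ B) hΩ.skew hcont
    (hJ.acs.complex b hb) ?_ (continuousAt_dCoord_frames (h.contMDiffAt h.mem_source)) ?_
    (h.det_pos h.mem_source) fun u hu => ?_
  · filter_upwards [hW.mem_nhds hb] with x hx
    exact hJ.isAdmissible hx
  · filter_upwards [φ.open_source.mem_nhds h.mem_source] with y hy
    exact (h.det_pos hy).ne'
  · obtain ⟨γ, hγ, hev⟩ := h.exists_path hu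
    refine ⟨γ, hγ, ?_⟩
    filter_upwards [hev, self_mem_nhdsWithin] with t ht (htpos : 0 < t)
    obtain ⟨h1, h2, h3⟩ := ht
    have ht0 : (t : ℂ) ≠ 0 := by exact_mod_cast htpos.ne'
    -- Along a ray the point of projective space is constant, so the chart of `CP m` and the base
    -- point of the Fubini–Study form do not move.
    have h4 : mkT (φ (γ t)) = mkT u := by rw [h3, mkT_smul ht0]
    refine ⟨(h.eq_mk _ h1 h2).1, ?_, fun v => ?_⟩
    · rw [(h.eq_mkT h1 h2).2, h4]
    · rw [h.dMap_eq h1 h2, h4, h3]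

end StandardCharts

/-! ### Global structures for one hyperpencil -/

section Single

variable {m : ℕ} {X : Type*} [TopologicalSpace X] [ChartedSpace (Cn (m + 1)) X]
  [IsManifold 𝓘(ℝ, Cn (m + 1)) ∞ X] {Ω : BilinField (m + 1) X} {B : Set X} {f : X → CP m}

/-- The structure of a family of charts with disjoint domains `O b`. -/
def chartStructure (φ : B → OpenPartialHomeomorph X (Cn (m + 1))) (O : B → Set X) (x : X) :
    Cn (m + 1) →L[ℝ] Cn (m + 1) :=
  open Classical in
  if h : ∃ b, x ∈ O b then conjI (dCoord (φ h.choose) x) else 0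

theorem chartStructure_eq {φ : B → OpenPartialHomeomorph X (Cn (m + 1))} {O : B → Set X}
    (hO : Pairwise (Function.onFun Disjoint O)) {b : B} {x : X} (hx : x ∈ O b) :
    chartStructure φ O x = conjI (dCoord (φ b) x) := by
  have h : ∃ b, x ∈ O b := ⟨b, hx⟩
  have hb : h.choose = b := by
    by_contra hne
    exact disjoint_left.1 (hO hne) h.choose_spec hx
  rw [chartStructure, dif_pos h, hb]

theorem IsTamingCover.exists_global [T2Space X] [CompactSpace X] (hB : B.Finite)
    (hΩ : IsContinuousTwoForm Ω) {𝒲 : Set (Set X × EndField (m + 1) X)}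
    (h𝒲 : IsTamingCover Ω B f 𝒲) {φ : B → OpenPartialHomeomorph X (Cn (m + 1))}
    (hφ : ∀ b : B, IsStandardChart B f b (φ b)) :
    ∃ J : EndField (m + 1) X, IsTamingACSOn Ω B f J univ ∧
      (∀ b : B, ∀ᶠ x in 𝓝 (b : X), IsChartStructureAt (φ b) J x) ∧
      (PushStandardNear B f 𝒲 → ∀ P ∈ 𝒲, ∀ x ∈ P.1 \ B, PushEq f J P.2 x) := by
  obtain ⟨O', hO', hdisj⟩ := hB.t2_separation
  set O : B → Set X := fun b => O' b ∩ (φ b).source with hO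
  have hOo : ∀ b, IsOpen (O b) := fun b => (hO' b).2.inter (φ b).open_source
  have hOb : ∀ b : B, (b : X) ∈ O b := fun b => ⟨(hO' b).1, (hφ b).mem_source⟩
  have hOd : Pairwise (Function.onFun Disjoint O) := fun b c hbc =>
    (hdisj b.2 c.2 (Subtype.coe_injective.ne hbc)).mono inter_subset_left inter_subset_left
  have hJ₀ : ∀ {b : B} {x : X}, x ∈ O b → chartStructure φ O x = conjI (dCoord (φ b) x) :=
    fun hx => chartStructure_eq hOd hx
  -- The points where the chart structure is tame and where, if the cover is standard near `B`, it
  -- induces the same structure on the image of `df` as the cover. The implication lets a single `J`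
  -- serve both assertions.
  set S : Set X := {x | (∃ b, x ∈ O b ∧ ∀ v : Cn (m + 1), v ≠ 0 →
      0 < (Ω x : Cn (m + 1) →L[ℝ] Cn (m + 1) →L[ℝ] ℝ) v (conjI (dCoord (φ b) x) v)) ∧
      (PushStandardNear B f 𝒲 → x ∉ B → ∀ P ∈ 𝒲, x ∈ P.1 → ∀ v,
        D (m + 1) m f x (P.2 x v) = mulI (D (m + 1) m f x v))} with hS
  have hSB : S ∈ 𝓝ˢ B := by
    rw [mem_nhdsSet_iff_forall]
    intro b hb
    obtain ⟨P, hP, hbP⟩ := h𝒲.cover b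
    have h1 := (hφ ⟨b, hb⟩).eventually_tame hΩ (h𝒲.isOpen P hP) hbP (h𝒲.taming P hP)
    have h2 : ∀ᶠ x in 𝓝 b, PushStandardNear B f 𝒲 → x ∉ B → ∀ P ∈ 𝒲, x ∈ P.1 → ∀ v,
        D (m + 1) m f x (P.2 x v) = mulI (D (m + 1) m f x v) := by
      by_cases hstd : PushStandardNear B f 𝒲
      · filter_upwards [nhds_le_nhdsSet hb hstd] with x hx _
        exact hx
      · exact .of_forall fun x h => absurd h hstd
    filter_upwards [h1, h2, (hOo ⟨b, hb⟩).mem_nhds (hOb ⟨b, hb⟩)] with x h1 h2 h3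
    exact ⟨⟨⟨b, hb⟩, h3, h1⟩, h2⟩
  have hxb : ∀ {b : B} {x : X}, x ∈ O b → x ∉ B → x ≠ b := fun _ hx h => hx (h ▸ Subtype.coe_prop _)
  have hadm₀ : ∀ x ∈ interior S, IsAdmissible (E := Cn (m + 1)) (Ω x)
      (pullFS (chartPt (f x)) (dMap f x)) (dMap f x) (x ∉ B) (chartStructure φ O x) := by
    intro x hx
    obtain ⟨⟨b, hb, ht⟩, -⟩ := interior_subset hx
    rw [hJ₀ hb]
    exact isAdmissible_of_map_I (conjI_conjI ((hφ b).det_pos hb.2).ne') ht fun hxB v =>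
      (hφ b).dMap_conjI hb.2 (hxb hb hxB) v
  have hcont₀ : ∀ x, x ∈ interior S → (tangentFrames (m + 1) X).ContAt (chartStructure φ O) x := by
    intro x hx
    obtain ⟨⟨b, hb, -⟩, -⟩ := interior_subset hx
    refine FrameSystem.ContAt.congr ((hφ b).contAt_conjI hb.2) ?_
    filter_upwards [(hOo b).mem_nhds hb] with y hy
    exact (hJ₀ hy).symm
  obtain ⟨J, hadm, hcont, hnear, hpush⟩ := exists_admissible_field (tangentFrames (m + 1) X)
    (Ω := fun x => (Ω x : Cn (m + 1) →L[ℝ] Cn (m + 1) →L[ℝ] ℝ))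
    (τ := fun x => pullFS (chartPt (f x)) (dMap f x)) (T := dMap f) hB.isClosed hΩ.skew
    (fun x _ => isPullbackForm_pullFS _ _) (𝒲 := 𝒲) h𝒲.isOpen h𝒲.cover
    (fun P hP x hx => (h𝒲.taming P hP).isAdmissible hx)
    (fun P hP x hx => (contAt_tangentFrames_iff P.2 x).2
      ((h𝒲.taming P hP).acs.continuousOn.continuousAt ((h𝒲.isOpen P hP).mem_nhds hx)))
    isOpen_interior (subset_interior_iff_mem_nhdsSet.2 hSB) hadm₀ hcont₀
  refine ⟨J, isTamingACSOn_univ hadm (fun x => ?_) hcont, fun b => ?_, fun hstd => ?_⟩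
  -- The retraction says nothing about orientation; it is inherited from a member of the cover tamed
  -- by the same form.
  · obtain ⟨P, hP, hx⟩ := h𝒲.cover x
    exact ((h𝒲.taming P hP).acs.complex x hx).of_tame (Ω := Ω x) (hadm x).sq
      ((h𝒲.taming P hP).tame x hx) (hadm x).tame
  · filter_upwards [nhds_le_nhdsSet b.2 hnear, (hOo b).mem_nhds (hOb b)] with x h1 h2 v
    rw [h1, hJ₀ h2]
    exact map_conjI ((hφ b).det_pos h2.2).ne' v
  · refine hpush h𝒲.agree fun x hx P hP hxP v => ?_
    obtain ⟨⟨b, hb, -⟩, hp⟩ := interior_subset hx.1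
    rw [hJ₀ hb]
    exact ((hφ b).dMap_conjI hb.2 (hxb hb hx.2) v).trans (hp hstd hx.2 P hP hxP v).symm

theorem IsHyperpencil.isOmegaTame_iff [T2Space X] [CompactSpace X] (hf : IsHyperpencil B f)
    (hΩ : IsContinuousTwoForm Ω) :
    IsOmegaTame Ω B f ↔ ∃ J : EndField (m + 1) X, IsTamingACSOn Ω B f J univ := by
  constructor
  · rintro ⟨𝒲, h𝒲⟩
    choose φ hφ using fun b : B => hf.chart b b.2
    obtain ⟨J, hJ, -⟩ := h𝒲.exists_global hf.finite hΩ hφ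
    exact ⟨J, hJ⟩
  · rintro ⟨J, hJ⟩
    refine ⟨{(univ, J)}, ?_, fun x => ⟨_, rfl, mem_univ x⟩, ?_, ?_⟩
    · rintro _ rfl
      exact isOpen_univ
    · rintro _ rfl
      exact hJ
    · rintro _ rfl _ rfl x _ v
      rfl

end Single

/-! ## Topology of bundles with compact fibers -/

section ProperMaps

open Filter

/-- The base coordinate of the ultrafilter converges by assumption and the fiber coordinate by
compactness. This is the ultrafilter criterion for properness. -/
theorem exists_le_nhds_of_trivialization {Z A F : Type*} [TopologicalSpace Z] [TopologicalSpace A]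
    [TopologicalSpace F] [CompactSpace F] {p : Z → A} (e : Trivialization F p) {a : A}
    (ha : a ∈ e.baseSet) {𝒰 : Ultrafilter Z} (h : Tendsto p 𝒰 (𝓝 a)) : ∃ z, p z = a ∧ 𝒰 ≤ 𝓝 z := by
  obtain ⟨y, -, hy⟩ := isCompact_univ.ultrafilter_le_nhds (𝒰.map fun z => (e z).2) (by simp)
  set z := e.toOpenPartialHomeomorph.symm (a, y)
  have hz : z ∈ e.source := e.map_target (e.mem_target.2 ha)
  have hpz : p z = a := e.proj_symm_apply' ha
  refine ⟨z, hpz, ?_⟩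
  have := (e.tendsto_nhds_iff (f := id) (l := 𝒰) hz).2 ⟨hpz.symm ▸ h, ?_⟩
  · exact this
  · have h2 : e z = (a, y) := e.apply_symm_apply' ha
    rw [h2]
    exact hy

theorem isProperMap_proj {S F : Type*} [TopologicalSpace S] [TopologicalSpace F] [CompactSpace F]
    {X : S → Type*} [TopologicalSpace (TotalSpace F X)] [∀ s, TopologicalSpace (X s)]
    [FiberBundle F X] : IsProperMap (π F X) :=
  isProperMap_iff_ultrafilter.2 ⟨FiberBundle.continuous_proj F X, fun _ s h =>
    exists_le_nhds_of_trivialization (trivializationAt F X s)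
      (FiberBundle.mem_baseSet_trivializationAt F X s) h⟩

theorem isProperMap_of_isCoveringMap {Z A : Type*} [TopologicalSpace Z] [TopologicalSpace A]
    {p : Z → A} (hp : IsCoveringMap p) (hfin : ∀ a, (p ⁻¹' {a}).Finite) : IsProperMap p := by
  refine isProperMap_iff_ultrafilter.2 ⟨hp.continuous, fun 𝒰 a h => ?_⟩
  have : Finite (p ⁻¹' {a}) := hfin a
  -- Over an empty fiber there is nothing to converge to; there an evenly covered neighborhood has
  -- empty preimage, which no ultrafilter contains.
  rcases isEmpty_or_nonempty (p ⁻¹' {a}) with hI | hI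
  · obtain ⟨-, U, haU, hU, -, H, -⟩ := hp a
    have hmem : p ⁻¹' U ∈ 𝒰 := h (hU.mem_nhds haU)
    obtain ⟨z, hz⟩ := 𝒰.nonempty_of_mem hmem
    exact hI.elim (H ⟨z, hz⟩).2
  · exact exists_le_nhds_of_trivialization (hp a).toTrivialization
      (hp a).mem_toTrivialization_baseSet h

/-- Finitely many members of the cover contain a given fiber, hence the preimage of a neighborhood
of its base point, as `p` is closed. A locally finite refinement of these neighborhoods pulls back,
each piece being cut by its finite list. -/
theorem paracompactSpace_of_isProperMap {Z A : Type*} [TopologicalSpace Z] [TopologicalSpace A]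
    [ParacompactSpace A] {p : Z → A} (hp : IsProperMap p) : ParacompactSpace Z := by
  refine ⟨fun α s hs hcov => ?_⟩
  have hfin : ∀ a, ∃ t : Finset α, p ⁻¹' {a} ⊆ ⋃ i ∈ t, s i := fun a =>
    (hp.isCompact_preimage isCompact_singleton).elim_finite_subcover s hs
      (hcov ▸ subset_univ _)
  choose t ht using hfin
  have hN : ∀ a, IsOpen (kernImage p (⋃ i ∈ t a, s i)) := fun a =>
    isClosedMap_iff_kernImage.1 hp.isClosedMap (isOpen_biUnion fun i _ => hs i)
  obtain ⟨v, hv, hvc, hvf, hvs⟩ := precise_refinement (fun a => kernImage p (⋃ i ∈ t a, s i)) hN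
    (iUnion_eq_univ_iff.2 fun a => ⟨a, fun z hz => ht a hz⟩)
  -- The refinement is indexed by its own members, which keeps the index type in the universe of
  -- `Z`.
  set R : Set (Set Z) := {U | ∃ a, ∃ i ∈ t a, U = s i ∩ p ⁻¹' v a} with hR
  refine ⟨R, (↑), ?_, ?_, fun z => ?_, ?_⟩
  · rintro ⟨_, a, i, -, rfl⟩
    exact (hs i).inter ((hv a).preimage hp.continuous)
  · refine iUnion_eq_univ_iff.2 fun z => ?_
    obtain ⟨a, ha⟩ := iUnion_eq_univ_iff.1 hvc (p z)
    obtain ⟨i, hi, hzi⟩ := mem_iUnion₂.1 (hvs a ha rfl)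
    exact ⟨⟨_, a, i, hi, rfl⟩, hzi, ha⟩
  · obtain ⟨O, hO, hOf⟩ := hvf (p z)
    refine ⟨p ⁻¹' O, hp.continuous.continuousAt hO, ?_⟩
    refine Finite.of_finite_image (f := Subtype.val) ?_ Subtype.val_injective.injOn
    refine (hOf.biUnion fun a _ => (t a).finite_toSet.image fun i => s i ∩ p ⁻¹' v a).subset ?_
    rintro _ ⟨⟨_, a, i, hi, rfl⟩, ⟨z', ⟨-, hz'⟩, hz''⟩, rfl⟩
    exact mem_biUnion (x := a) ⟨p z', hz', hz''⟩ ⟨i, hi, rfl⟩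
  · rintro ⟨_, a, i, -, rfl⟩
    exact ⟨i, inter_subset_left⟩

theorem t2Space_totalSpace {S F : Type*} [TopologicalSpace S] [T2Space S] [TopologicalSpace F]
    [T2Space F] {X : S → Type*} [TopologicalSpace (TotalSpace F X)] [∀ s, TopologicalSpace (X s)]
    [FiberBundle F X] : T2Space (TotalSpace F X) := by
  refine t2_iff_ultrafilter.2 fun {x y} 𝒰 hx hy => ?_
  have hc := FiberBundle.continuous_proj F X
  have hp : x.proj = y.proj :=
    tendsto_nhds_unique ((hc.tendsto x).mono_left hx) ((hc.tendsto y).mono_left hy)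
  set e := trivializationAt F X x.proj
  have hxe : x ∈ e.source := e.mem_source.2 (FiberBundle.mem_baseSet_trivializationAt F X _)
  have hye : y ∈ e.source := e.mem_source.2 (hp ▸ FiberBundle.mem_baseSet_trivializationAt F X _)
  exact e.injOn hxe hye (tendsto_nhds_unique ((e.continuousAt hxe).tendsto.mono_left hx)
    ((e.continuousAt hye).tendsto.mono_left hy))

/-- A finite covering is proper and the total space is Hausdorff, so the inclusion of `B` is proper
and its image closed. -/
theorem isClosed_of_isCoveringMap {S F : Type*} [TopologicalSpace S] [T2Space S] [TopologicalSpace F]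
    [T2Space F] {X : S → Type*} [TopologicalSpace (TotalSpace F X)] [∀ s, TopologicalSpace (X s)]
    [FiberBundle F X] {B : Set (TotalSpace F X)} (hB : IsCoveringMap (fun b : B => b.1.proj))
    (hfin : ∀ s, ((fun b : B => b.1.proj) ⁻¹' {s}).Finite) : IsClosed B := by
  have := t2Space_totalSpace (F := F) (X := X)
  have h := isProperMap_of_comp_of_t2 (f := ((↑) : B → TotalSpace F X)) continuous_subtype_val
    (FiberBundle.continuous_proj F X) (isProperMap_of_isCoveringMap hB hfin)
  simpa using h.isClosed_range

end ProperMaps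

/-! ## Frames of the vertical tangent bundle -/

section VerticalFrames

variable {S : Type*} [TopologicalSpace S] {k : ℕ}
  {F : Type*} [TopologicalSpace F] [ChartedSpace (Cn k) F] [IsManifold 𝓘(ℝ, Cn k) ∞ F]
  {X : S → Type*} [TopologicalSpace (TotalSpace F X)]
  [∀ s, TopologicalSpace (X s)] [∀ s, ChartedSpace (Cn k) (X s)]

theorem isOpen_vertDom (e : Trivialization F (π F X)) (c : F) : IsOpen (vertDom k e c) := by
  have h : vertDom k e c = e.source ∩ e ⁻¹' (Prod.snd ⁻¹' (chartAt (Cn k) c).source) := by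
    ext x
    simp [vertDom, e.mem_source]
  rw [h]
  exact e.continuousOn.isOpen_inter_preimage e.open_source
    ((chartAt (Cn k) c).open_source.preimage continuous_snd)

theorem det_mfderiv_chartAt_ne_zero {c y : F} (hy : y ∈ (chartAt (Cn k) c).source) :
    (D k k (chartAt (Cn k) c) y : Cn k →L[ℝ] Cn k).det ≠ 0 := by
  have h := (mdifferentiable_chart (I := 𝓘(ℝ, Cn k)) c).comp_symm_deriv
    ((chartAt (Cn k) c).map_source hy)
  rw [(chartAt (Cn k) c).left_inv hy] at h
  exact det_ne_zero_of_mul_eq_one h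

variable [FiberBundle F X]

theorem IsOrientedManifoldBundle.mdifferentiable_fiberTriv (hX : IsOrientedManifoldBundle k F X)
    {e : Trivialization F (π F X)} (he : e ∈ FiberBundle.trivializationAtlas F X) {s : S}
    (hs : s ∈ e.baseSet) : MDifferentiable 𝓘(ℝ, Cn k) 𝓘(ℝ, Cn k) (fiberTriv e s) := by
  obtain ⟨Φ, hΦ⟩ := (hX.fiber e he s hs).1
  exact hΦ ▸ Φ.mdifferentiable (by simp)

theorem IsOrientedManifoldBundle.det_vertDeriv_ne_zero (hX : IsOrientedManifoldBundle k F X)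
    {e : Trivialization F (π F X)} (he : e ∈ FiberBundle.trivializationAtlas F X) {c : F}
    {x : TotalSpace F X} (hx : x ∈ vertDom k e c) :
    (vertDeriv k e c x : Cn k →L[ℝ] Cn k).det ≠ 0 := by
  have h1 := hX.mdifferentiable_fiberTriv he hx.1 x.2
  have h2 : MDifferentiableAt 𝓘(ℝ, Cn k) 𝓘(ℝ, Cn k) (chartAt (Cn k) c) (fiberTriv e x.1 x.2) :=
    (mdifferentiable_chart (I := 𝓘(ℝ, Cn k)) c).mdifferentiableAt hx.2
  let A₁ : Cn k →L[ℝ] Cn k := D k k (chartAt (Cn k) c) (fiberTriv e x.1 x.2)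
  let A₂ : Cn k →L[ℝ] Cn k := D k k (fiberTriv e x.1) x.2
  have h3 : A₁ * A₂ = vertDeriv k e c x := (mfderiv_comp x.2 h2 h1).symm
  refine ne_of_eq_of_ne (congrArg ContinuousLinearMap.det h3).symm ?_
  rw [det_mul]
  exact mul_ne_zero (det_mfderiv_chartAt_ne_zero hx.2)
    ((hX.fiber e he x.1 hx.1).2 x.2).ne'

variable (k F X) in
/-- The indices of the frames of the vertical tangent bundle: a trivialization, a point specifying
a chart of the fiber, and a point of the domain of the resulting vertical coordinates. -/
abbrev VertIdx : Type _ := {q : Trivialization F (π F X) × F × TotalSpace F X //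
  q.1 ∈ FiberBundle.trivializationAtlas F X ∧ q.2.2 ∈ vertDom k q.1 q.2.1}

/-- The frames of the vertical tangent bundle given by vertical coordinates. -/
def IsOrientedManifoldBundle.frames (hX : IsOrientedManifoldBundle k F X) :
    FrameSystem (TotalSpace F X) (Cn k) (VertIdx k F X) where
  pt i := i.1.2.2
  coord i := vertDeriv k i.1.1 i.1.2.1
  vec i := vertVec k i.1.1 i.1.2.1
  coord_vec i := by
    filter_upwards [(isOpen_vertDom i.1.1 i.1.2.1).mem_nhds i.2.2] with x hx
    exact mul_inverse_of_det (hX.det_vertDeriv_ne_zero i.2.1 hx)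
  vec_coord i := by
    filter_upwards [(isOpen_vertDom i.1.1 i.1.2.1).mem_nhds i.2.2] with x hx
    exact inverse_mul_of_det (hX.det_vertDeriv_ne_zero i.2.1 hx)

variable (k) in
/-- A vertical frame near a given point. -/
def vertIdxAt (x : TotalSpace F X) : VertIdx k F X :=
  ⟨(trivializationAt F X x.1, (trivializationAt F X x.1 x).2, x),
    FiberBundle.trivialization_mem_atlas F X x.1, FiberBundle.mem_baseSet_trivializationAt F X x.1,
    mem_chart_source _ _⟩

theorem IsVertACSOn.contAt (hX : IsOrientedManifoldBundle k F X) {J : VEndField k F X}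
    {W : Set (TotalSpace F X)} (hJ : IsVertACSOn k J W) (hW : IsOpen W) {i : VertIdx k F X}
    (hi : hX.frames.pt i ∈ W) : hX.frames.ContAt J i := by
  refine continuousAt_clm_apply.2 fun u => ?_
  exact (hJ.continuousOn i.1.1 i.2.1 i.1.2.1 u).continuousAt
    ((hW.inter (isOpen_vertDom i.1.1 i.1.2.1)).mem_nhds ⟨hi, i.2.2⟩)

theorem IsVertACSOn.of_contAt (hX : IsOrientedManifoldBundle k F X) {J : VEndField k F X}
    (hpos : ∀ x, IsPosComplexStructure (n := k) (J x)) (hJ : ∀ i, hX.frames.ContAt J i) :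
    IsVertACSOn k J univ where
  complex x _ := hpos x
  continuousOn e he c u x hx := by
    have h : ContinuousAt _ _ := hJ ⟨(e, c, x), he, hx.2⟩
    exact (continuousAt_clm_apply.1 h u).continuousWithinAt

theorem IsContinuousVertTwoForm.continuousAt_frames (hX : IsOrientedManifoldBundle k F X)
    {Ω : VBilinField k F X} (hΩ : IsContinuousVertTwoForm k Ω) (i : VertIdx k F X) (u v : Cn k) :
    ContinuousAt (fun x => (Ω x : Cn k →L[ℝ] Cn k →L[ℝ] ℝ) (hX.frames.vec i x u)
      (hX.frames.vec i x v)) (hX.frames.pt i) :=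
  (hΩ.continuousOn i.1.1 i.2.1 i.1.2.1 u v).continuousAt
    ((isOpen_vertDom i.1.1 i.1.2.1).mem_nhds i.2.2)

theorem IsContinuousVertTwoForm.skew {Ω : VBilinField k F X} (hΩ : IsContinuousVertTwoForm k Ω)
    (x : TotalSpace F X) (v w : Cn k) :
    (Ω x : Cn k →L[ℝ] Cn k →L[ℝ] ℝ) v w = -Ω x w v :=
  skew_of_alternating (Ω := (Ω x : Cn k →L[ℝ] Cn k →L[ℝ] ℝ)) (hΩ.alternating x) v w

end VerticalFrames

/-! ## The complex structure near the base locus of a family -/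

namespace UnitaryNbhd

variable {S : Type*} [TopologicalSpace S] {m : ℕ}
  {M : Type*} [TopologicalSpace M] [ChartedSpace (Cn (m + 1)) M]
  {X : S → Type*} [TopologicalSpace (TotalSpace M X)]
  [∀ s, TopologicalSpace (X s)] [∀ s, ChartedSpace (Cn (m + 1)) (X s)] [FiberBundle M X]
  {B : Set (TotalSpace M X)} (N : UnitaryNbhd m M X B) {x : TotalSpace M X}
  {Ψ : Trivialization (Cn (m + 1)) N.ρ}

/-- The domain of a local trivialization, as a subset of the total space. -/
def dom (Ψ : Trivialization (Cn (m + 1)) N.ρ) : Set (TotalSpace M X) :=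
  {x | ∃ h : x ∈ N.V, N.ρ ⟨x, h⟩ ∈ Ψ.baseSet}

theorem isOpen_dom (Ψ : Trivialization (Cn (m + 1)) N.ρ) : IsOpen (N.dom Ψ) := by
  have h : N.dom Ψ = Subtype.val '' Ψ.source := by
    ext x
    simp [dom, Ψ.mem_source]
  exact h ▸ N.isOpen.isOpenMap_subtype_val _ Ψ.open_source

theorem mem_dom_base (b : B) : (b : TotalSpace M X) ∈ N.dom Ψ ↔ b ∈ Ψ.baseSet :=
  ⟨fun ⟨_, h⟩ => N.proj_base b ▸ h, fun h => ⟨N.subset b.2, (N.proj_base b).symm ▸ h⟩⟩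

theorem nbhdCoord_eq (h : x ∈ N.V) : nbhdCoord Ψ x = (Ψ ⟨x, h⟩).2 := dif_pos h

theorem symm_nbhdCoord (h : x ∈ N.V) (hb : N.ρ ⟨x, h⟩ ∈ Ψ.baseSet) :
    Ψ.toOpenPartialHomeomorph.symm (N.ρ ⟨x, h⟩, nbhdCoord Ψ x) = ⟨x, h⟩ := by
  rw [N.nbhdCoord_eq h]
  exact Ψ.symm_apply_mk_proj (Ψ.mem_source.2 hb)

theorem nbhdCoord_symm {b : B} (hb : b ∈ Ψ.baseSet) (z : Cn (m + 1)) :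
    nbhdCoord Ψ (Ψ.toOpenPartialHomeomorph.symm (b, z)).1 = z := by
  rw [N.nbhdCoord_eq (Subtype.coe_prop _)]
  exact congrArg Prod.snd (Ψ.apply_symm_apply' hb)

/-- A point with zero coordinate is the zero vector over its projection, and so lies in `B`. -/
theorem nbhdCoord_ne_zero (hΨ : Ψ ∈ N.triv) (h : x ∈ N.V) (hb : N.ρ ⟨x, h⟩ ∈ Ψ.baseSet)
    (hx : x ∉ B) : nbhdCoord Ψ x ≠ 0 := by
  intro h0
  have h1 := N.symm_nbhdCoord h hb
  have h2 : Ψ.toOpenPartialHomeomorph.symm (N.ρ ⟨x, h⟩, 0) =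
      ⟨(N.ρ ⟨x, h⟩).1, N.subset (N.ρ ⟨x, h⟩).2⟩ := by
    rw [← N.zero Ψ hΨ _ hb]
    exact Ψ.toOpenPartialHomeomorph.left_inv (Ψ.mem_source.2 ((N.proj_base _).symm ▸ hb))
  rw [h0, h2] at h1
  have h3 : (N.ρ ⟨x, h⟩).1 = x := congrArg Subtype.val h1
  exact hx (h3 ▸ (N.ρ ⟨x, h⟩).2)

/-- Within one fiber of `X → S`, `ρ` is continuous with values in the finite set of base points,
hence locally constant. Vertical derivatives therefore do not see how trivializations vary over `B`.
-/
theorem eventually_proj_eq [T1Space (TotalSpace M X)] (hB : (onFiber B x.1).Finite)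
    (h : x ∈ N.V) (hb : N.ρ ⟨x, h⟩ ∈ Ψ.baseSet) :
    ∀ᶠ p in 𝓝 x.2, ∃ h' : (⟨x.1, p⟩ : TotalSpace M X) ∈ N.V,
      N.ρ ⟨⟨x.1, p⟩, h'⟩ = N.ρ ⟨x, h⟩ := by
  set A : Set (TotalSpace M X) := (TotalSpace.mk x.1 '' onFiber B x.1) \ {(N.ρ ⟨x, h⟩).1} with hA
  have hAc : IsClosed A := ((hB.image _).subset sdiff_subset).isClosed
  have h1 : ∀ᶠ y : N.V in 𝓝 ⟨x, h⟩, (N.ρ y).1 ∉ A :=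
    (continuous_subtype_val.continuousAt.comp
      (Ψ.continuousAt_proj (Ψ.mem_source.2 hb))).eventually
      (hAc.isOpen_compl.mem_nhds fun h2 => h2.2 rfl)
  have h2 : ∀ᶠ y in 𝓝 x, ∃ h' : y ∈ N.V, (N.ρ ⟨y, h'⟩).1 ∉ A := by
    have h3 := N.isOpen.isOpenEmbedding_subtypeVal.map_nhds_eq ⟨x, h⟩
    change ∀ᶠ y in 𝓝 (Subtype.val (⟨x, h⟩ : N.V)), _
    rw [← h3, Filter.eventually_map]
    filter_upwards [h1] with y hy using ⟨y.2, hy⟩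
  have h3 := ((FiberBundle.continuous_totalSpaceMk M X x.1).tendsto x.2).eventually h2
  filter_upwards [h3] with p ⟨h', hp⟩
  refine ⟨h', Subtype.ext ?_⟩
  by_contra hne
  have h4 : (N.ρ ⟨⟨x.1, p⟩, h'⟩).1.proj = x.1 := N.lifts ⟨⟨x.1, p⟩, h'⟩
  refine hp ⟨?_, hne⟩
  generalize N.ρ ⟨⟨x.1, p⟩, h'⟩ = b at h4
  obtain ⟨⟨s, q⟩, hq⟩ := b
  obtain rfl : s = x.1 := h4
  exact ⟨q, hq, rfl⟩

/-- The vertical derivative of the linear coordinate of a trivialization. -/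
def coordD (Ψ : Trivialization (Cn (m + 1)) N.ρ) (x : TotalSpace M X) :
    Cn (m + 1) →L[ℝ] Cn (m + 1) :=
  D (m + 1) (m + 1) (nbhdCoordOn Ψ x.1) x.2

theorem mdifferentiableAt (hΨ : Ψ ∈ N.triv) (hx : x ∈ N.dom Ψ) :
    MDifferentiableAt 𝓘(ℝ, Cn (m + 1)) 𝓘(ℝ, Cn (m + 1)) (nbhdCoordOn Ψ x.1) x.2 :=
  (N.smooth Ψ hΨ ⟨x, hx.1⟩ hx.2).mdifferentiableAt (by simp)

theorem det_coordD (hΨ : Ψ ∈ N.triv) (hx : x ∈ N.dom Ψ) : 0 < (N.coordD Ψ x).det :=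
  N.oriented Ψ hΨ ⟨x, hx.1⟩ hx.2

theorem mfderiv_comp_unitary (hΨ : Ψ ∈ N.triv) (hx : x ∈ N.dom Ψ) (g : UnitaryGp (m + 1)) :
    MDifferentiableAt 𝓘(ℝ, Cn (m + 1)) 𝓘(ℝ, Cn (m + 1))
      (fun p => unitaryAct g (nbhdCoordOn Ψ x.1 p)) x.2 ∧
    (D (m + 1) (m + 1) (fun p => unitaryAct g (nbhdCoordOn Ψ x.1 p)) x.2 :
      Cn (m + 1) →L[ℝ] Cn (m + 1)) =
        (g : Cn (m + 1) →L[ℂ] Cn (m + 1)).restrictScalars ℝ * N.coordD Ψ x := by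
  have h := ((g : Cn (m + 1) →L[ℂ] Cn (m + 1)).restrictScalars ℝ).hasMFDerivAt.comp x.2
    (N.mdifferentiableAt hΨ hx).hasMFDerivAt
  exact ⟨h.mdifferentiableAt, h.mfderiv⟩

/-- Near `x` in its fiber the two coordinates differ by one fixed unitary map, which leaves the
induced structure unchanged. -/
theorem conjI_coordD_eq [T1Space (TotalSpace M X)] (hB : (onFiber B x.1).Finite)
    {Ψ' : Trivialization (Cn (m + 1)) N.ρ} (hΨ : Ψ ∈ N.triv) (hΨ' : Ψ' ∈ N.triv)
    (hx : x ∈ N.dom Ψ) (hx' : x ∈ N.dom Ψ') : conjI (N.coordD Ψ' x) = conjI (N.coordD Ψ x) := by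
  obtain ⟨h, hb⟩ := hx
  obtain ⟨g, -, hg⟩ := N.unitary Ψ hΨ Ψ' hΨ'
  set b := N.ρ ⟨x, h⟩ with hbdef
  have hev : nbhdCoordOn Ψ' x.1 =ᶠ[𝓝 x.2] fun p => unitaryAct (g b) (nbhdCoordOn Ψ x.1 p) := by
    filter_upwards [N.eventually_proj_eq hB h hb] with p ⟨h', hp⟩
    have h1 := N.symm_nbhdCoord (Ψ := Ψ) h' (hp ▸ hb)
    have h2 := hg b ⟨hb, hx'.2⟩ (nbhdCoord Ψ ⟨x.1, p⟩)
    rw [hp] at h1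
    rw [h1] at h2
    change nbhdCoord Ψ' ⟨x.1, p⟩ = _
    rw [N.nbhdCoord_eq h', h2]
    rfl
  have h3 : N.coordD Ψ' x = (g b : Cn (m + 1) →L[ℂ] Cn (m + 1)).restrictScalars ℝ * N.coordD Ψ x :=
    hev.mfderiv_eq.trans (N.mfderiv_comp_unitary hΨ ⟨h, hb⟩ (g b)).2
  rw [h3, conjI_complex_mul _ (det_unitary_pos _).ne' (N.det_coordD hΨ ⟨h, hb⟩).ne']

open Classical in
/-- The fiberwise complex structure determined by the vector bundle. -/
def stdJ (x : TotalSpace M X) : Cn (m + 1) →L[ℝ] Cn (m + 1) :=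
  if h : ∃ Ψ ∈ N.triv, x ∈ N.dom Ψ then conjI (N.coordD h.choose x) else 0

theorem stdJ_eq [T1Space (TotalSpace M X)] (hB : (onFiber B x.1).Finite) (hΨ : Ψ ∈ N.triv)
    (hx : x ∈ N.dom Ψ) : N.stdJ x = conjI (N.coordD Ψ x) := by
  have h : ∃ Ψ ∈ N.triv, x ∈ N.dom Ψ := ⟨Ψ, hΨ, hx⟩
  rw [stdJ, dif_pos h]
  exact N.conjI_coordD_eq hB hΨ h.choose_spec.1 hx h.choose_spec.2

variable [IsManifold 𝓘(ℝ, Cn (m + 1)) ∞ M]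

theorem continuousAt_coordD (hX : IsOrientedManifoldBundle (m + 1) M X) (hΨ : Ψ ∈ N.triv)
    {i : VertIdx (m + 1) M X} (hi : hX.frames.pt i ∈ N.dom Ψ) :
    ContinuousAt (fun x => N.coordD Ψ x * hX.frames.vec i x) (hX.frames.pt i) := by
  refine continuousAt_clm_apply.2 fun u => ?_
  exact (N.deriv_continuousOn Ψ hΨ i.1.1 i.2.1 i.1.2.1 u).continuousAt
    (((N.isOpen_dom Ψ).inter (isOpen_vertDom i.1.1 i.1.2.1)).mem_nhds ⟨hi, i.2.2⟩)

theorem contAt_conjI_coordD (hX : IsOrientedManifoldBundle (m + 1) M X) (hΨ : Ψ ∈ N.triv)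
    {i : VertIdx (m + 1) M X} (hi : hX.frames.pt i ∈ N.dom Ψ) :
    hX.frames.ContAt (fun x => conjI (N.coordD Ψ x)) i := by
  refine contAt_conjI (N.continuousAt_coordD hX hΨ hi) ?_
  filter_upwards [(N.isOpen_dom Ψ).mem_nhds hi] with y hy
  exact (N.det_coordD hΨ hy).ne'

theorem contAt_stdJ [T1Space (TotalSpace M X)] (hB : ∀ s, (onFiber B s).Finite)
    (hX : IsOrientedManifoldBundle (m + 1) M X) (hΨ : Ψ ∈ N.triv)
    {i : VertIdx (m + 1) M X} (hi : hX.frames.pt i ∈ N.dom Ψ) : hX.frames.ContAt N.stdJ i := by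
  refine (N.contAt_conjI_coordD hX hΨ hi).congr ?_
  filter_upwards [(N.isOpen_dom Ψ).mem_nhds hi] with y hy
  exact (N.stdJ_eq (hB _) hΨ hy).symm

open Filter in
/-- Paths of the form `t ↦ t u` ending at a base point. -/
theorem exists_path (hΨ : Ψ ∈ N.triv) {b : B} (hb : b ∈ Ψ.baseSet) {u : Cn (m + 1)} (hu : u ≠ 0) :
    ∃ γ : ℝ → TotalSpace M X, Tendsto γ (𝓝[>] 0) (𝓝 b.1) ∧ ∀ᶠ t : ℝ in 𝓝[>] 0,
      (∃ h : γ t ∈ N.V, N.ρ ⟨γ t, h⟩ = b) ∧ γ t ∉ B ∧ nbhdCoord Ψ (γ t) = (t : ℂ) • u := by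
  have hu0 : Tendsto (fun t : ℝ => (b, (t : ℂ) • u)) (𝓝[>] 0) (𝓝 (b, 0)) := by
    have : Continuous fun t : ℝ => (b, (t : ℂ) • u) := by fun_prop
    simpa using (this.tendsto 0).mono_left nhdsWithin_le_nhds
  have h0 : Ψ.toOpenPartialHomeomorph.symm (b, 0) = ⟨b.1, N.subset b.2⟩ := by
    rw [← N.zero Ψ hΨ _ hb]
    exact Ψ.toOpenPartialHomeomorph.left_inv (Ψ.mem_source.2 ((N.proj_base _).symm ▸ hb))
  refine ⟨fun t => (Ψ.toOpenPartialHomeomorph.symm (b, (t : ℂ) • u)).1, ?_, ?_⟩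
  · have h1 := (Ψ.toOpenPartialHomeomorph.continuousAt_symm (Ψ.mem_target.2 hb :
      (b, (0 : Cn (m + 1))) ∈ Ψ.target)).tendsto
    rw [h0] at h1
    exact ((continuous_subtype_val.tendsto _).comp h1).comp hu0
  · filter_upwards [self_mem_nhdsWithin] with t (ht : 0 < t)
    have h1 := N.nbhdCoord_symm hb ((t : ℂ) • u)
    have h2 : N.ρ (Ψ.toOpenPartialHomeomorph.symm (b, (t : ℂ) • u)) = b := Ψ.proj_symm_apply' hb
    -- A point of the path lying in `B` would be its own projection `b`, whose coordinate is `0` and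
    -- not `tu`.
    refine ⟨⟨Subtype.coe_prop _, h2⟩, fun hB => ?_, h1⟩
    have h3 := N.proj_base ⟨_, hB⟩
    have h4 := h3.symm.trans h2
    have h5 : (Ψ.toOpenPartialHomeomorph.symm (b, (t : ℂ) • u)).1 = b.1 := congrArg Subtype.val h4
    rw [h5, N.nbhdCoord_eq (N.subset b.2), N.zero Ψ hΨ b hb] at h1
    exact (smul_ne_zero (by exact_mod_cast ht.ne') hu) h1.symm

end UnitaryNbhd

/-! ## Families of hyperpencils -/

theorem unitaryAct_smul {k : ℕ} (g : UnitaryGp k) (c : ℂ) (z : Cn k) :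
    unitaryAct g (c • z) = c • unitaryAct g z := map_smul _ _ _

namespace HyperpencilFamily

variable {S : Type*} [TopologicalSpace S] {m : ℕ}
  {M : Type*} [TopologicalSpace M] [ChartedSpace (Cn (m + 1)) M]
  {X : S → Type*} [TopologicalSpace (TotalSpace M X)]
  [∀ s, TopologicalSpace (X s)] [∀ s, ChartedSpace (Cn (m + 1)) (X s)] [FiberBundle M X]
  {Y : S → Type*} [TopologicalSpace (TotalSpace (CP m) Y)]
  [∀ s, TopologicalSpace (Y s)] [∀ s, ChartedSpace (Cn m) (Y s)] [FiberBundle (CP m) Y]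
  [∀ s, IsManifold 𝓘(ℝ, Cn (m + 1)) ∞ (X s)] (H : HyperpencilFamily m M X Y)
  {x : TotalSpace M X} {Ω : VBilinField (m + 1) M X} {J J' : VEndField (m + 1) M X}
  {W : Set (TotalSpace M X)}

/-- The map to `CPᵐ` obtained by trivializing `Y` at each point of `S`. -/
def toCP (x : TotalSpace M X) : CP m :=
  fiberTriv (trivializationAt (CP m) Y x.1) x.1 (H.f x.1 x.2)

/-- The vertical derivative, with values in tangent spaces of `CPᵐ`. -/
def dCP (x : TotalSpace M X) : Cn (m + 1) →L[ℝ] Cn m :=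
  (tangentTriv (totalMap (m := m) H.f x)).comp (VD H.f x)

theorem dCP_apply (x : TotalSpace M X) (v : Cn (m + 1)) :
    H.dCP x v = tangentTriv (totalMap (m := m) H.f x) (VD H.f x v) := rfl

theorem tangentTriv_injective (hY : IsProjectiveBundle m Y) (y : TotalSpace (CP m) Y) :
    Function.Injective (tangentTriv y) := by
  obtain ⟨Φ, hΦ⟩ := hY.fiber (trivializationAt (CP m) Y y.1)
    (FiberBundle.trivialization_mem_atlas _ _ _) y.1 (FiberBundle.mem_baseSet_trivializationAt _ _ _)
  rw [tangentTriv, ← hΦ]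
  exact (Φ.mfderivToContinuousLinearEquiv (by simp) y.2).injective

theorem mdifferentiableAt_fiberTriv (hY : IsProjectiveBundle m Y) (y : TotalSpace (CP m) Y) :
    MDifferentiableAt 𝓘(ℝ, Cn m) 𝓘(ℝ, Cn m) (fiberTriv (trivializationAt (CP m) Y y.1) y.1) y.2 := by
  obtain ⟨Φ, hΦ⟩ := hY.fiber (trivializationAt (CP m) Y y.1)
    (FiberBundle.trivialization_mem_atlas _ _ _) y.1 (FiberBundle.mem_baseSet_trivializationAt _ _ _)
  exact hΦ ▸ Φ.mdifferentiable (by simp) y.2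

variable {H} in
theorem IsTamingACSOn.isAdmissible (h : H.IsTamingACSOn Ω J W) (hx : x ∈ W) :
    IsAdmissible (E := Cn (m + 1)) (Ω x) (pullFS (chartPt (H.toCP x)) (H.dCP x)) (H.dCP x)
      (x ∉ H.B) (J x) where
  sq := (h.acs.complex x hx).1
  tame := h.tame x hx
  pos hc v hv := (h.compatible x ⟨hx, hc⟩).1 v fun h0 => hv (by
    rw [dCP_apply, h0, map_zero]
    rfl)
  invariant hc := (h.compatible x ⟨hx, hc⟩).2

variable {H} in
theorem isTamingACSOn_univ [IsManifold 𝓘(ℝ, Cn (m + 1)) ∞ M]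
    (hX : IsOrientedManifoldBundle (m + 1) M X) (hY : IsProjectiveBundle m Y)
    (h : ∀ x, IsAdmissible (E := Cn (m + 1)) (Ω x) (pullFS (chartPt (H.toCP x)) (H.dCP x)) (H.dCP x)
      (x ∉ H.B) (J x))
    (hpos : ∀ x, IsPosComplexStructure (n := m + 1) (J x))
    (hc : ∀ i, hX.frames.ContAt J i) : H.IsTamingACSOn Ω J univ where
  acs := .of_contAt hX hpos hc
  tame x _ := (h x).tame
  compatible x hx := ⟨fun v hv => (h x).pos hx.2 v fun h0 => hv
    (tangentTriv_injective hY _ (h0.trans (map_zero _).symm)), (h x).invariant hx.2⟩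

theorem dCP_eq_iff (hY : IsProjectiveBundle m Y) {v w : Cn (m + 1)} :
    H.dCP x v = H.dCP x w ↔ VD H.f x v = VD H.f x w :=
  (tangentTriv_injective hY _).eq_iff

theorem pushEq_iff (hY : IsProjectiveBundle m Y) :
    H.PushEq J J' x ↔ ∀ v, H.dCP x (J x v) = H.dCP x (J' x v) :=
  forall_congr' fun _ => (H.dCP_eq_iff hY).symm

theorem isClosed_B [T2Space S] [T2Space M] : IsClosed H.B := by
  refine isClosed_of_isCoveringMap H.covering fun s => ?_
  refine Finite.of_finite_image (f := Subtype.val) ?_ Subtype.val_injective.injOn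
  refine ((H.finite s).image (TotalSpace.mk s)).subset ?_
  rintro _ ⟨⟨⟨s', p⟩, hb⟩, hs, rfl⟩
  obtain rfl : s' = s := hs
  exact ⟨p, hb, rfl⟩

/-- The trivialization is fixed while `p` moves in the fiber, so this is the chain rule; closedness
of `B` makes `f` smooth on a full neighborhood of `x` in that fiber. -/
theorem dCP_eq_mfderiv [T2Space S] [T2Space M] (hY : IsProjectiveBundle m Y) (hx : x ∉ H.B) :
    H.dCP x = D (m + 1) m
      (fun p => fiberTriv (trivializationAt (CP m) Y x.1) x.1 (H.f x.1 p)) x.2 := by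
  have h1 := mdifferentiableAt_fiberTriv hY (totalMap (m := m) H.f x)
  have ho : IsOpen (onFiber H.B x.1)ᶜ :=
    (H.isClosed_B.preimage (FiberBundle.continuous_totalSpaceMk M X x.1)).isOpen_compl
  have h2 : MDifferentiableAt 𝓘(ℝ, Cn (m + 1)) 𝓘(ℝ, Cn m) (H.f x.1) x.2 :=
    ((H.smooth x.1).contMDiffAt (ho.mem_nhds hx)).mdifferentiableAt (by simp)
  exact (mfderiv_comp x.2 h1 h2).symm

/-- On a fiber of `V → B`, the map is projectivization in suitable unitary coordinates, as is its
derivative. -/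
theorem exists_unitary [T2Space S] [T2Space M] (hY : IsProjectiveBundle m Y)
    {Ψ : Trivialization (Cn (m + 1)) H.nbhd.ρ} (hΨ : Ψ ∈ H.nbhd.triv) {b : H.B}
    (hb : b ∈ Ψ.baseSet) :
    ∃ g : UnitaryGp (m + 1), ∀ x (h : x ∈ H.nbhd.V), H.nbhd.ρ ⟨x, h⟩ = b → x ∉ H.B →
      unitaryAct g (nbhdCoord Ψ x) ≠ 0 ∧ H.toCP x = mkT (unitaryAct g (nbhdCoord Ψ x)) ∧
      ∀ v, H.dCP x v = dmk (chartIdx (mkT (unitaryAct g (nbhdCoord Ψ x))))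
        (unitaryAct g (nbhdCoord Ψ x)) (unitaryAct g (H.nbhd.coordD Ψ x v)) := by
  have : T2Space (TotalSpace M X) := t2Space_totalSpace
  obtain ⟨g, hg⟩ := H.eq_mk Ψ hΨ (trivializationAt (CP m) Y b.1.proj)
    (FiberBundle.trivialization_mem_atlas _ _ _) b hb (FiberBundle.mem_baseSet_trivializationAt _ _ _)
  have h0 : ∀ z, z ≠ 0 → unitaryAct g z ≠ 0 := fun z hz h =>
    hz (unitaryAct_injective g (h.trans (map_zero _).symm))
  have hval : ∀ x (h : x ∈ H.nbhd.V), H.nbhd.ρ ⟨x, h⟩ = b → x ∉ H.B →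
      unitaryAct g (nbhdCoord Ψ x) ≠ 0 ∧ H.toCP x = mkT (unitaryAct g (nbhdCoord Ψ x)) := by
    rintro x h rfl hx
    have hz := H.nbhd.nbhdCoord_ne_zero hΨ h hb hx
    have h1 := hg _ hz
    rw [H.nbhd.symm_nbhdCoord h hb, H.nbhd.lifts ⟨x, h⟩] at h1
    refine ⟨h0 _ hz, ?_⟩
    rw [mkT_of_ne_zero (h0 _ hz)]
    exact h1
  refine ⟨g, fun x h hbx hx => ⟨(hval x h hbx hx).1, (hval x h hbx hx).2, fun v => ?_⟩⟩
  have hxd : x ∈ H.nbhd.dom Ψ := ⟨h, hbx ▸ hb⟩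
  obtain ⟨hd, hd'⟩ := H.nbhd.mfderiv_comp_unitary hΨ hxd g
  have hxB : ∀ᶠ p in 𝓝 x.2, (⟨x.1, p⟩ : TotalSpace M X) ∉ H.B :=
    ((FiberBundle.continuous_totalSpaceMk M X x.1).tendsto x.2).eventually
      (H.isClosed_B.isOpen_compl.mem_nhds hx)
  have hev : (fun p => fiberTriv (trivializationAt (CP m) Y x.1) x.1 (H.f x.1 p)) =ᶠ[𝓝 x.2]
      fun p => mkT (unitaryAct g (nbhdCoordOn Ψ x.1 p)) := by
    -- The formula for `f` must hold on a neighborhood in the fiber to be differentiated: nearby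
    -- points keep the same `b`, hence the same `g`, and stay off `B`.
    filter_upwards [H.nbhd.eventually_proj_eq (H.finite _) h hxd.2, hxB] with p ⟨h', hp⟩ hpB
    exact (hval ⟨x.1, p⟩ h' (hp.trans hbx) hpB).2
  have e1 := congrArg (fun L : Cn (m + 1) →L[ℝ] Cn m => L v) (H.dCP_eq_mfderiv hY hx)
  have e2 := mfderiv_eq_dmk hd (hval x h hbx hx).1 hev v
  have e3 := congrArg (fun L : Cn (m + 1) →L[ℝ] Cn (m + 1) =>
    dmk (chartIdx (mkT (unitaryAct g (nbhdCoord Ψ x)))) (unitaryAct g (nbhdCoord Ψ x)) (L v)) hd'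
  exact e1.trans (e2.trans e3)

theorem dCP_conjI [T2Space S] [T2Space M] (hY : IsProjectiveBundle m Y)
    {Ψ : Trivialization (Cn (m + 1)) H.nbhd.ρ} (hΨ : Ψ ∈ H.nbhd.triv) (hx : x ∈ H.nbhd.dom Ψ)
    (hxB : x ∉ H.B) (v : Cn (m + 1)) :
    H.dCP x (conjI (H.nbhd.coordD Ψ x) v) = Complex.I • H.dCP x v := by
  obtain ⟨g, hg⟩ := H.exists_unitary hY hΨ hx.2
  obtain ⟨-, -, h⟩ := hg x hx.1 rfl hxB
  rw [h, h, map_conjI (H.nbhd.det_coordD hΨ hx).ne', unitaryAct_smul, map_smul]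

/-- The fiberwise complex structure of `V → B` is tame near `B`. -/
theorem eventually_tame [IsManifold 𝓘(ℝ, Cn (m + 1)) ∞ M] [T2Space S] [T2Space M]
    (hX : IsOrientedManifoldBundle (m + 1) M X) (hY : IsProjectiveBundle m Y)
    (hΩ : IsContinuousVertTwoForm (m + 1) Ω)
    {Ψ : Trivialization (Cn (m + 1)) H.nbhd.ρ} (hΨ : Ψ ∈ H.nbhd.triv) {b : H.B}
    (hb : b ∈ Ψ.baseSet) (hW : IsOpen W) (hbW : b.1 ∈ W) (hJ : H.IsTamingACSOn Ω J W) :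
    ∀ᶠ x in 𝓝 b.1, ∀ v : Cn (m + 1), v ≠ 0 →
      0 < (Ω x : Cn (m + 1) →L[ℝ] Cn (m + 1) →L[ℝ] ℝ) v (conjI (H.nbhd.coordD Ψ x) v) := by
  have hbd : b.1 ∈ H.nbhd.dom Ψ := (H.nbhd.mem_dom_base b).2 hb
  obtain ⟨g, hg⟩ := H.exists_unitary hY hΨ hb
  -- Composing the coordinate with `g` makes the map over `b` exactly `z ↦ [z]`, without changing
  -- the induced complex structure.
  set G : Cn (m + 1) →L[ℝ] Cn (m + 1) := (g : Cn (m + 1) →L[ℂ] Cn (m + 1)).restrictScalars ℝ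
  set i : VertIdx (m + 1) M X := vertIdxAt (m + 1) b.1
  have hdet : ∀ x ∈ H.nbhd.dom Ψ, 0 < (G * H.nbhd.coordD Ψ x).det := fun x hx => by
    rw [det_mul]
    exact mul_pos (det_unitary_pos g) (H.nbhd.det_coordD hΨ hx)
  have hconj : ∀ x ∈ H.nbhd.dom Ψ, conjI (G * H.nbhd.coordD Ψ x) = conjI (H.nbhd.coordD Ψ x) :=
    fun x hx => conjI_complex_mul _ (det_unitary_pos g).ne' (H.nbhd.det_coordD hΨ hx).ne'
  refine (H.nbhd.contAt_conjI_coordD hX hΨ (i := i) hbd).eventually_tame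
    (Ω := fun x => (Ω x : Cn (m + 1) →L[ℝ] Cn (m + 1) →L[ℝ] ℝ))
    (hΩ.continuousAt_frames hX i) ?_
  intro v hv
  change 0 < (Ω b.1 : Cn (m + 1) →L[ℝ] Cn (m + 1) →L[ℝ] ℝ) v (conjI (H.nbhd.coordD Ψ b.1) v)
  rw [← hconj b.1 hbd]
  refine tame_conjI_at_base (Φ := hX.frames) (i := i) (H := fun x => G * H.nbhd.coordD Ψ x)
    (J := J) (Ω := fun x => (Ω x : Cn (m + 1) →L[ℝ] Cn (m + 1) →L[ℝ] ℝ))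
    (w := fun x => chartPt (H.toCP x)) (T := H.dCP) (c := fun x => x ∉ H.B) hΩ.skew
    (hJ.acs.contAt hX hW hbW) (hJ.acs.complex b.1 hbW) ?_ ?_ ?_ (hdet _ hbd) (fun u hu => ?_) v hv
  · filter_upwards [hW.mem_nhds hbW] with x hx
    exact hJ.isAdmissible hx
  · have := (continuousAt_const (y := G)).mul (H.nbhd.continuousAt_coordD hX hΨ (i := i) hbd)
    exact this.congr (.of_forall fun x => (mul_assoc _ _ _).symm)
  · filter_upwards [(H.nbhd.isOpen_dom Ψ).mem_nhds hbd] with x hx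
    exact (hdet x hx).ne'
  · have hgu : unitaryAct g (unitaryAct g⁻¹ u) = u := by
      have h1 : (g : Cn (m + 1) →L[ℂ] Cn (m + 1)) * (g⁻¹ : UnitaryGp (m + 1)) = 1 := by
        rw [← Submonoid.coe_mul, mul_inv_cancel]
        rfl
      exact congrArg (fun L : Cn (m + 1) →L[ℂ] Cn (m + 1) => L u) h1
    have hu' : unitaryAct g⁻¹ u ≠ 0 := fun h => hu (by
      rw [← hgu, h, unitaryAct, map_zero])
    -- In the original coordinate the ray has direction `g⁻¹u`, so that it becomes the ray through
    -- `u` after applying `g`.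
    obtain ⟨γ, hγ, hev⟩ := H.nbhd.exists_path hΨ hb hu'
    refine ⟨γ, hγ, ?_⟩
    filter_upwards [hev, self_mem_nhdsWithin] with t ⟨⟨h1, h2⟩, h3, h4⟩ (htpos : 0 < t)
    have ht0 : (t : ℂ) ≠ 0 := by exact_mod_cast htpos.ne'
    have h5 : unitaryAct g (nbhdCoord Ψ (γ t)) = (t : ℂ) • u := by
      rw [h4, unitaryAct_smul, hgu]
    obtain ⟨-, h6, h7⟩ := hg _ h1 h2 h3
    rw [h5, mkT_smul ht0] at h6 h7
    exact ⟨h3, by rw [h6], h7⟩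

end HyperpencilFamily

/-! ### Global structures for families -/

namespace HyperpencilFamily

variable {S : Type*} [TopologicalSpace S] [TopologicalSpace.MetrizableSpace S] {m : ℕ}
  {M : Type*} [TopologicalSpace M] [T2Space M] [CompactSpace M] [ChartedSpace (Cn (m + 1)) M]
  [IsManifold 𝓘(ℝ, Cn (m + 1)) ∞ M]
  {X : S → Type*} [TopologicalSpace (TotalSpace M X)]
  [∀ s, TopologicalSpace (X s)] [∀ s, ChartedSpace (Cn (m + 1)) (X s)] [FiberBundle M X]
  {Y : S → Type*} [TopologicalSpace (TotalSpace (CP m) Y)]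
  [∀ s, TopologicalSpace (Y s)] [∀ s, ChartedSpace (Cn m) (Y s)] [FiberBundle (CP m) Y]
  [∀ s, IsManifold 𝓘(ℝ, Cn (m + 1)) ∞ (X s)] {H : HyperpencilFamily m M X Y}
  {Ω : VBilinField (m + 1) M X}

theorem IsTamingCover.exists_global (hX : IsOrientedManifoldBundle (m + 1) M X)
    (hY : IsProjectiveBundle m Y) (hΩ : IsContinuousVertTwoForm (m + 1) Ω)
    {𝒲 : Set (Set (TotalSpace M X) × VEndField (m + 1) M X)} (h𝒲 : H.IsTamingCover Ω 𝒲) :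
    ∃ J : VEndField (m + 1) M X, H.IsTamingACSOn Ω J univ ∧ H.IsStandardNear J ∧
      (H.PushStandardNear 𝒲 → ∀ P ∈ 𝒲, ∀ x ∈ P.1 \ H.B, H.PushEq J P.2 x) := by
  -- A metric makes `S` paracompact, and this lifts along the proper projection with fiber the
  -- compact `M`. Partitions of unity then exist on the total space.
  let _ := TopologicalSpace.metrizableSpaceMetric S
  have : T2Space (TotalSpace M X) := t2Space_totalSpace
  have : ParacompactSpace (TotalSpace M X) :=
    paracompactSpace_of_isProperMap (isProperMap_proj (F := M) (X := X))
  set D' : Set (TotalSpace M X) := {x | (∃ Ψ ∈ H.nbhd.triv, x ∈ H.nbhd.dom Ψ ∧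
      ∀ v : Cn (m + 1), v ≠ 0 →
        0 < (Ω x : Cn (m + 1) →L[ℝ] Cn (m + 1) →L[ℝ] ℝ) v (conjI (H.nbhd.coordD Ψ x) v)) ∧
      (H.PushStandardNear 𝒲 → x ∉ H.B → ∀ P ∈ 𝒲, x ∈ P.1 → ∀ v,
        tangentTriv (totalMap (m := m) H.f x) (VD H.f x (P.2 x v)) =
          mulI (tangentTriv (totalMap (m := m) H.f x) (VD H.f x v)))} with hD'
  have hDB : D' ∈ 𝓝ˢ H.B := by
    rw [mem_nhdsSet_iff_forall]
    intro b hb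
    obtain ⟨P, hP, hbP⟩ := h𝒲.cover b
    obtain ⟨Ψ, hΨ, hbΨ⟩ := H.nbhd.exists_mem ⟨b, hb⟩
    have h1 := H.eventually_tame hX hY hΩ hΨ hbΨ (h𝒲.isOpen P hP) hbP (h𝒲.taming P hP)
    have h2 : ∀ᶠ x in 𝓝 b, H.PushStandardNear 𝒲 → x ∉ H.B → ∀ P ∈ 𝒲, x ∈ P.1 → ∀ v,
        tangentTriv (totalMap (m := m) H.f x) (VD H.f x (P.2 x v)) =
          mulI (tangentTriv (totalMap (m := m) H.f x) (VD H.f x v)) := by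
      by_cases hstd : H.PushStandardNear 𝒲
      · filter_upwards [nhds_le_nhdsSet hb hstd] with x hx _
        exact hx
      · exact .of_forall fun x h => absurd h hstd
    filter_upwards [h1, h2, (H.nbhd.isOpen_dom Ψ).mem_nhds
      ((H.nbhd.mem_dom_base ⟨b, hb⟩).2 hbΨ)] with x h1 h2 h3
    exact ⟨⟨Ψ, hΨ, h3, h1⟩, h2⟩
  have hadm₀ : ∀ x ∈ interior D', IsAdmissible (E := Cn (m + 1)) (Ω x)
      (pullFS (chartPt (H.toCP x)) (H.dCP x)) (H.dCP x) (x ∉ H.B) (H.nbhd.stdJ x) := by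
    intro x hx
    obtain ⟨⟨Ψ, hΨ, hd, ht⟩, -⟩ := interior_subset hx
    rw [H.nbhd.stdJ_eq (H.finite _) hΨ hd]
    exact isAdmissible_of_map_I (conjI_conjI (H.nbhd.det_coordD hΨ hd).ne') ht fun hxB v =>
      H.dCP_conjI hY hΨ hd hxB v
  have hcont₀ : ∀ i, hX.frames.pt i ∈ interior D' → hX.frames.ContAt H.nbhd.stdJ i := by
    intro i hi
    obtain ⟨⟨Ψ, hΨ, hd, -⟩, -⟩ := interior_subset hi
    exact H.nbhd.contAt_stdJ H.finite hX hΨ hd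
  obtain ⟨J, hadm, hcont, hnear, hpush⟩ := exists_admissible_field hX.frames
    (Ω := fun x => (Ω x : Cn (m + 1) →L[ℝ] Cn (m + 1) →L[ℝ] ℝ))
    (τ := fun x => pullFS (chartPt (H.toCP x)) (H.dCP x)) (T := H.dCP) H.isClosed_B hΩ.skew
    (fun x _ => isPullbackForm_pullFS _ _) (𝒲 := 𝒲) h𝒲.isOpen h𝒲.cover
    (fun P hP x hx => (h𝒲.taming P hP).isAdmissible hx)
    (fun P hP i hi => (h𝒲.taming P hP).acs.contAt hX (h𝒲.isOpen P hP) hi)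
    isOpen_interior (subset_interior_iff_mem_nhdsSet.2 hDB) hadm₀ hcont₀
  refine ⟨J, isTamingACSOn_univ hX hY hadm (fun x => ?_) hcont, ?_, fun hstd P hP x hx => ?_⟩
  · obtain ⟨P, hP, hx⟩ := h𝒲.cover x
    exact ((h𝒲.taming P hP).acs.complex x hx).of_tame (Ω := Ω x) (hadm x).sq
      ((h𝒲.taming P hP).tame x hx) (hadm x).tame
  · filter_upwards [hnear] with x h1 Ψ hΨ hd v
    rw [h1, H.nbhd.stdJ_eq (H.finite _) hΨ hd]
    exact map_conjI (H.nbhd.det_coordD hΨ hd).ne' v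
  -- Agreement in the fibers of `Y` and agreement after the identification with `CP m` are
  -- equivalent, because `tangentTriv` is injective.
  · refine (H.pushEq_iff hY).2 (hpush (fun P hP Q hQ x hx => (H.pushEq_iff hY).1
      (h𝒲.agree P hP Q hQ x hx)) (fun x hx P hP hxP v => ?_) P hP x hx)
    obtain ⟨⟨Ψ, hΨ, hd, -⟩, hp⟩ := interior_subset hx.1
    rw [H.nbhd.stdJ_eq (H.finite _) hΨ hd]
    exact (H.dCP_conjI hY hΨ hd hx.2 v).trans (hp hstd hx.2 P hP hxP v).symm

theorem isOmegaTame_iff (hX : IsOrientedManifoldBundle (m + 1) M X)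
    (hY : IsProjectiveBundle m Y) (hΩ : IsContinuousVertTwoForm (m + 1) Ω) :
    H.IsOmegaTame Ω ↔ ∃ J : VEndField (m + 1) M X, H.IsTamingACSOn Ω J univ := by
  constructor
  · rintro ⟨𝒲, h𝒲⟩
    obtain ⟨J, hJ, -⟩ := h𝒲.exists_global hX hY hΩ
    exact ⟨J, hJ⟩
  · rintro ⟨J, hJ⟩
    refine ⟨{(univ, J)}, ?_, fun x => ⟨_, rfl, mem_univ x⟩, ?_, ?_⟩
    · rintro _ rfl
      exact isOpen_univ
    · rintro _ rfl
      exact hJ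
    · rintro _ rfl _ rfl x _ v
      rfl

end HyperpencilFamily

end Hyperpencils

end

/-! ### The lemma for one hyperpencil and for families -/

theorem lemma2p10 (m : ℕ) :
    -- a single hyperpencil on a closed oriented manifold of real dimension `2 (m + 1)`
    (∀ (X : Type*) [TopologicalSpace X] [T2Space X] [CompactSpace X]
      [ChartedSpace (Hyperpencils.Cn (m + 1)) X]
      [IsManifold 𝓘(ℝ, Hyperpencils.Cn (m + 1)) ∞ X] [Hyperpencils.IsOrientedManifold (m + 1) X]
      (B : Set X) (f : X → Hyperpencils.CP m) (_ : Hyperpencils.IsHyperpencil B f)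
      (Ω : Hyperpencils.BilinField (m + 1) X) (_ : Hyperpencils.IsContinuousTwoForm Ω),
      (Hyperpencils.IsOmegaTame Ω B f ↔
        ∃ J : Hyperpencils.EndField (m + 1) X, Hyperpencils.IsTamingACSOn Ω B f J univ) ∧
      ∀ (𝒲 : Set (Set X × Hyperpencils.EndField (m + 1) X)),
        Hyperpencils.IsTamingCover Ω B f 𝒲 →
        ∀ φ : B → OpenPartialHomeomorph X (Hyperpencils.Cn (m + 1)),
          (∀ b : B, Hyperpencils.IsStandardChart B f b (φ b)) →
          ∃ J : Hyperpencils.EndField (m + 1) X, Hyperpencils.IsTamingACSOn Ω B f J univ ∧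
            (∀ b : B, ∀ᶠ x in 𝓝 (b : X), Hyperpencils.IsChartStructureAt (φ b) J x) ∧
            (Hyperpencils.PushStandardNear B f 𝒲 →
              ∀ P ∈ 𝒲, ∀ x ∈ P.1 \ B, Hyperpencils.PushEq f J P.2 x)) ∧
    -- a family of hyperpencils over a metrizable space
    (∀ (S : Type*) [TopologicalSpace S] [TopologicalSpace.MetrizableSpace S]
      (M : Type*) [TopologicalSpace M] [T2Space M] [CompactSpace M]
      [ChartedSpace (Hyperpencils.Cn (m + 1)) M]
      [IsManifold 𝓘(ℝ, Hyperpencils.Cn (m + 1)) ∞ M] [Hyperpencils.IsOrientedManifold (m + 1) M]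
      (X : S → Type*) [TopologicalSpace (TotalSpace M X)] [∀ s, TopologicalSpace (X s)]
      [∀ s, ChartedSpace (Hyperpencils.Cn (m + 1)) (X s)]
      [∀ s, IsManifold 𝓘(ℝ, Hyperpencils.Cn (m + 1)) ∞ (X s)]
      [∀ s, Hyperpencils.IsOrientedManifold (m + 1) (X s)] [FiberBundle M X]
      (Y : S → Type*) [TopologicalSpace (TotalSpace (Hyperpencils.CP m) Y)]
      [∀ s, TopologicalSpace (Y s)] [∀ s, ChartedSpace (Hyperpencils.Cn m) (Y s)]
      [∀ s, IsManifold 𝓘(ℝ, Hyperpencils.Cn m) ∞ (Y s)] [FiberBundle (Hyperpencils.CP m) Y]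
      (_ : Hyperpencils.IsOrientedManifoldBundle (m + 1) M X) (_ : Hyperpencils.IsProjectiveBundle m Y)
      (H : Hyperpencils.HyperpencilFamily m M X Y)
      (Ω : Hyperpencils.VBilinField (m + 1) M X) (_ : Hyperpencils.IsContinuousVertTwoForm (m + 1) Ω),
      (H.IsOmegaTame Ω ↔
        ∃ J : Hyperpencils.VEndField (m + 1) M X, H.IsTamingACSOn Ω J univ) ∧
      ∀ (𝒲 : Set (Set (TotalSpace M X) × Hyperpencils.VEndField (m + 1) M X)),
        H.IsTamingCover Ω 𝒲 →
          ∃ J : Hyperpencils.VEndField (m + 1) M X, H.IsTamingACSOn Ω J univ ∧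
            H.IsStandardNear J ∧
            (H.PushStandardNear 𝒲 → ∀ P ∈ 𝒲, ∀ x ∈ P.1 \ H.B, H.PushEq J P.2 x)) := by
  refine ⟨?_, ?_⟩
  · intro X _ _ _ _ _ _ B f hf Ω hΩ
    exact ⟨hf.isOmegaTame_iff hΩ, fun 𝒲 h𝒲 φ hφ => h𝒲.exists_global hf.finite hΩ hφ⟩
  · intro S _ _ M _ _ _ _ _ _ X _ _ _ _ _ _ Y _ _ _ _ _ hX hY H Ω hΩ
    exact ⟨Hyperpencils.HyperpencilFamily.isOmegaTame_iff hX hY hΩ,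
      fun 𝒲 h𝒲 => h𝒲.exists_global hX hY hΩ⟩
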